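/- **Setting.** Let $\Omega=(x_l,x_r)$, $T>0$, $0<\mu_0\le\mu_1$, let $\mu\in C^3(\overline\Omega)$ satisfy $\mu_0\le\mu\le\mu_1$, and let $\kappa>0$, $|c(x)|\le\kappa$ on $\Omega$, $0<\alpha<1$, $\sigma\in(0,1)\cup(1,2)$. Write $\omega_\beta(t)=t^{\beta-1}/\Gamma(\beta)$, let $\partial_t^\alpha v(t)=\int_0^t\omega_{1-\alpha}(t-s)v'(s)\,ds$ be the Caputo derivative, $\mathcal Lv=-(\mu v')'$, and $E_\alpha(z)=\sum_{k\ge0}z^k/\Gamma(1+k\alpha)$. Let $u$ solve $$\partial_t^\alpha u+\mathcal Lu=c(x)u+f(x,t)\ (x\in\Omega,\ 0<t\le T),\qquad u=u_b\ (x\in\partial\Omega,\ 0<t\le T),\qquad u(\cdot,0)=u_0\ (x\in\Omega),$$ where the boundary data $u_b$ do not depend on time (for instance $u_b=0$). Assume $u\in C([0,T];H^4(\Omega))\cap C^2_\sigma((0,T];H^1(\Omega))$, with a constant $K$ such that $\|u(t)\|_{H^4}\le K$ on $[0,T]$ and $\|\partial_t^\ell u(t)\|_{H^1}\le K(1+t^{\sigma-\ell})$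 for $\ell=1,2$, $0<t\le T$; here $C^2_\sigma((0,T];H^1)$ consists of the functions in $C([0,T];H^1)\cap C^2((0,T];H^1)$ satisfying a bound of the latter form. **Scheme.** Let $0=t_0<t_1<\dots<t_N=T$ ($N\ge1$), $\tau_k=t_k-t_{k-1}$, $\tau=\max_{1\le k\le N}\tau_k$, $h=(x_r-x_l)/M$ ($M\ge1$), $x_i=x_l+ih$. For grid functions put $$(\mathcal L_hv)(x_i)=-\frac1h\Big[\mu(x_{i+\frac12})\frac{v(x_{i+1})-v(x_i)}h-\mu(x_{i-\frac12})\frac{v(x_i)-v(x_{i-1})}h\Big],\qquad \langle v,w\rangle=h\sum_{0<i<M}v(x_i)w(x_i),$$ $x_{i\pm\frac12}=x_i\pm\frac h2$, $\|v\|=\langle v,v\rangle^{1/2}$ and, for $v$ vanishing at $x_0,x_M$, $|v|_1=\langle v,\mathcal L_hv\rangle^{1/2}$. The L1 scheme is $$\sum_{k=1}^nA^{(n)}_{n-k}(u_h^k-u_h^{k-1})+\mathcal L_hu_h^n=c\,u_h^n+f(\cdot,t_n),\qquad A^{(n)}_{n-k}=\frac1{\tau_k}\int_{t_{k-1}}^{t_k}\omega_{1-\alpha}(t_n-s)\,ds,$$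 at the interior grid points for $1\le n\le N$, with $u_h^n=u_b(\cdot,t_n)$ at $x_0,x_M$ for $1\le n\le N$ and $u_h^0=u_0$ at the interior points. **Mesh conditions.** (A3) $\tau_k/\tau_{k+1}\le\rho$ for $1\le k\le N-1$, with a constant $\rho>0$. (M-conv) With $\gamma\ge1$ and $C_\gamma>0$: $\tau_k\le C_\gamma\tau\min\{1,t_k^{1-1/\gamma}\}$ for $1\le k\le N$, and $t_k\le C_\gamma t_{k-1}$, $\tau_k/t_k\le C_\gamma\tau_{k-1}/t_{k-1}$ for $2\le k\le N$. **Theorem.** There is a constant $C_\Omega>0$ depending only on $\Omega,\mu_0,\mu_1$ such that $\|v\|^2\le C_\Omega|v|_1^2$ for every $M\ge1$ and every grid function $v$ vanishing at $x_0,x_M$. Let $C_\Omega>0$ be any constant for which this inequality holds for the given $\mu$ and all such $M$ and $v$. There is a constant $C_u>0$, depending only on $\Omega,\mu_0,\mu_1,\mu,T,\gamma,C_\gamma$ and $K$ (so it depends on $u$ only through $K$, is uniform in $\alpha$ and $\sigma$, and is independent of the temporal and spatial meshes), such that if (A3) and (M-conv) hold and $\tau\le\big(2\Gamma(2-\alpha)\kappa^2C_\Omega\big)^{-1/\alpha}$,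 then every solution $u_h$ of the L1 scheme satisfies $$|u(t_n)-u_h^n|_1\le\frac{C_u}{\sigma(1-\alpha)}E_\alpha\big(2\max\{1,\rho\}\kappa^2C_\Omega t_n^\alpha\big)\Big(\tau^{\min\{2-\alpha,\gamma\sigma\}}+t_n^{\alpha/2}h^2\Big),\qquad 1\le n\le N.$$ If moreover $\gamma\ge\max\{1,(2-\alpha)/\sigma\}$, the same bound holds with $\tau^{2-\alpha}$ in place of $\tau^{\min\{2-\alpha,\gamma\sigma\}}$. -/

import Mathlib

open MeasureTheory Set
open scoped ContDiff

noncomputable section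

/-! Sobolev spaces on a bounded interval -/

/-- The measure space underlying `L²(a,b)`. -/
abbrev L2Space (a b : ℝ) : Type := Lp ℝ 2 (volume.restrict (Ioo a b))

/-- `w` is the weak derivative of `v` on the interval `(a,b)`: integration by parts holds against
every smooth function with compact support in `(a,b)`. -/
def IsWeakDeriv (a b : ℝ) (v w : L2Space a b) : Prop :=
  ∀ φ : ℝ → ℝ, ContDiff ℝ ∞ φ → HasCompactSupport φ → tsupport φ ⊆ Ioo a b →
    ∫ x in Ioo a b, v x * deriv φ x = - ∫ x in Ioo a b, w x * φ x

theorem integrable_L2_mul_test (a b : ℝ) (v : L2Space a b) (ψ : ℝ → ℝ) (hψ : Continuous ψ)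
    (hc : HasCompactSupport ψ) :
    Integrable (fun x => v x * ψ x) (volume.restrict (Ioo a b)) := by
  have h1 : Integrable (v : ℝ → ℝ) (volume.restrict (Ioo a b)) :=
    (Lp.memLp v).integrable (by norm_num)
  obtain ⟨C, hC⟩ := hc.exists_bound_of_continuous hψ
  exact h1.mul_bdd hψ.aestronglyMeasurable (Filter.Eventually.of_forall hC)

/-- The Sobolev space `H^m(a,b)`: an element is the tuple `(v, v', …, v^(m))` of a function in
`L²(a,b)` and its weak derivatives up to order `m`, all in `L²(a,b)`. The norm inherited from the
`ℓ²`-product is `(∑_{j ≤ m} ‖v^(j)‖²_{L²})^{1/2}`. -/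
def SobolevH (a b : ℝ) (m : ℕ) : Submodule ℝ (PiLp 2 (fun _ : Fin (m + 1) => L2Space a b)) where
  carrier := {V | ∀ j : Fin m, IsWeakDeriv a b (V j.castSucc) (V j.succ)}
  zero_mem' := by
    intro j φ _ _ _
    have h : ∀ ψ : ℝ → ℝ, ∫ x in Ioo a b, (0 : L2Space a b) x * ψ x = 0 := by
      intro ψ
      have : (fun x => (0 : L2Space a b) x * ψ x) =ᵐ[volume.restrict (Ioo a b)] fun _ => 0 := by
        filter_upwards [Lp.coeFn_zero ℝ 2 (volume.restrict (Ioo a b))] with x hx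
        rw [hx, Pi.zero_apply, zero_mul]
      rw [integral_congr_ae this, integral_zero]
    rw [PiLp.zero_apply, PiLp.zero_apply, h, h, neg_zero]
  add_mem' := by
    intro V W hV hW j φ h1 h2 h3
    have key : ∀ (p q : L2Space a b) (ψ : ℝ → ℝ), Continuous ψ → HasCompactSupport ψ →
        ∫ x in Ioo a b, (p + q : L2Space a b) x * ψ x
          = (∫ x in Ioo a b, p x * ψ x) + ∫ x in Ioo a b, q x * ψ x := by
      intro p q ψ hψ hc
      rw [← integral_add (integrable_L2_mul_test a b p ψ hψ hc)
        (integrable_L2_mul_test a b q ψ hψ hc)]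
      apply integral_congr_ae
      filter_upwards [Lp.coeFn_add p q] with x hx
      rw [hx, Pi.add_apply, add_mul]
    have hd : Continuous (deriv φ) := h1.continuous_deriv (by simp)
    rw [PiLp.add_apply, PiLp.add_apply, key _ _ _ hd h2.deriv, key _ _ _ h1.continuous h2,
      hV j φ h1 h2 h3, hW j φ h1 h2 h3]
    ring
  smul_mem' := by
    intro r V hV j φ h1 h2 h3
    have key : ∀ (p : L2Space a b) (ψ : ℝ → ℝ),
        ∫ x in Ioo a b, (r • p : L2Space a b) x * ψ x = r * ∫ x in Ioo a b, p x * ψ x := by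
      intro p ψ
      rw [← integral_const_mul]
      apply integral_congr_ae
      filter_upwards [Lp.coeFn_smul r p] with x hx
      rw [hx, Pi.smul_apply, smul_eq_mul, mul_assoc]
    rw [PiLp.smul_apply, PiLp.smul_apply, key, key, hV j φ h1 h2 h3]
    ring

/-- The function `v` on `[a,b]` is the continuous representative of the Sobolev function `V`. -/
def Represents {a b : ℝ} {m : ℕ} (V : SobolevH a b m) (v : ℝ → ℝ) : Prop :=
  ContinuousOn v (Icc a b) ∧
    (((V : PiLp 2 (fun _ : Fin (m + 1) => L2Space a b)) 0 : L2Space a b) : ℝ → ℝ)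
      =ᵐ[volume.restrict (Ioo a b)] v

/-- `u ∈ C([0,T]; H^m(a,b))` with `max_t ‖u(t)‖_{H^m} ≤ K`; here `u x t` is the value at the
space point `x` and the time `t`. -/
def MemCSobolev (a b T : ℝ) (m : ℕ) (K : ℝ) (u : ℝ → ℝ → ℝ) : Prop :=
  ∃ U : ℝ → SobolevH a b m,
    (∀ t ∈ Icc 0 T, Represents (U t) (fun x => u x t)) ∧
    ContinuousOn U (Icc 0 T) ∧
    ∀ t ∈ Icc 0 T, ‖U t‖ ≤ K

/-- `u ∈ C_σ^k((0,T]; H^m(a,b))`: as an `H^m`-valued function of time, `u` is continuous on `[0,T]`,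
`k` times continuously differentiable on `(0,T]`, and
`‖∂_t^ℓ u(t)‖_{H^m} ≤ K (1 + t^(σ-ℓ))` for `1 ≤ ℓ ≤ k` and `0 < t ≤ T`. -/
def MemCSigmaSobolev (a b T σ : ℝ) (k m : ℕ) (K : ℝ) (u : ℝ → ℝ → ℝ) : Prop :=
  ∃ U : ℝ → SobolevH a b m,
    (∀ t ∈ Icc 0 T, Represents (U t) (fun x => u x t)) ∧
    ContinuousOn U (Icc 0 T) ∧
    ContDiffOn ℝ k U (Ioc 0 T) ∧
    ∀ l : ℕ, 1 ≤ l → l ≤ k → ∀ t ∈ Ioc 0 T,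
      ‖iteratedDerivWithin l U (Ioc 0 T) t‖ ≤ K * (1 + t ^ (σ - (l : ℝ)))

/-! The continuous problem -/

/-- `ω_β(t) = t^(β-1) / Γ(β)`. -/
def omegaKernel (β t : ℝ) : ℝ := t ^ (β - 1) / Real.Gamma β

/-- The Caputo derivative `∫₀ᵗ ω_{1-α}(t-s) v'(s) ds`. -/
def caputo (α : ℝ) (v : ℝ → ℝ) (t : ℝ) : ℝ :=
  ∫ s in (0 : ℝ)..t, omegaKernel (1 - α) (t - s) * deriv v s

/-- The elliptic operator `v ↦ -(μ v')'`. -/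
def ellipticOp (μ v : ℝ → ℝ) (x : ℝ) : ℝ := - deriv (fun y => μ y * deriv v y) x

/-- The Mittag-Leffler function `E_α(z) = ∑_{k ≥ 0} z^k / Γ(1 + kα)`. -/
def mittagLeffler (α z : ℝ) : ℝ := ∑' k : ℕ, z ^ k / Real.Gamma (1 + (k : ℝ) * α)

/-- `u` solves the reaction-subdiffusion problem on `(xl,xr) × (0,T]` with reaction coefficient
`c`, source `f`, boundary data `ub` and initial data `u0`. -/
structure SolvesSubdiffusion (α xl xr T : ℝ) (μ c : ℝ → ℝ) (f ub : ℝ → ℝ → ℝ) (u0 : ℝ → ℝ)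
    (u : ℝ → ℝ → ℝ) : Prop where
  equation : ∀ x ∈ Ioo xl xr, ∀ t ∈ Ioc 0 T,
    caputo α (fun s => u x s) t + ellipticOp μ (fun y => u y t) x = c x * u x t + f x t
  boundary : ∀ x ∈ ({xl, xr} : Set ℝ), ∀ t ∈ Ioc 0 T, u x t = ub x t
  initial : ∀ x ∈ Ioo xl xr, u x 0 = u0 x

/-! The time mesh -/

/-- `0 = t_0 < t_1 < … < t_N = T`, with `N ≥ 1`; only the values `t k` for `k ≤ N` matter. -/
structure IsTimeMesh (T : ℝ) (N : ℕ) (t : ℕ → ℝ) : Prop where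
  one_le : 1 ≤ N
  zero : t 0 = 0
  last : t N = T
  lt_succ : ∀ k < N, t k < t (k + 1)

/-- The step size `τ_k = t_k - t_{k-1}`, for `k ≥ 1`. -/
def stepSize (t : ℕ → ℝ) (k : ℕ) : ℝ := t k - t (k - 1)

/-- The maximum step size `τ = max_{1 ≤ k ≤ N} τ_k`. -/
def maxStep (N : ℕ) (t : ℕ → ℝ) : ℝ := ⨆ k : Fin N, stepSize t (k + 1)

/-- All local step ratios `τ_k / τ_{k+1}`, `1 ≤ k ≤ N - 1`, are at most `ρ`. -/
def StepRatioBound (N : ℕ) (t : ℕ → ℝ) (ρ : ℝ) : Prop :=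
  ∀ k : ℕ, 1 ≤ k → k + 1 ≤ N → stepSize t k / stepSize t (k + 1) ≤ ρ

/-- The graded-mesh condition with grading exponent `γ` and constant `Cγ`. -/
structure GradedMesh (N : ℕ) (t : ℕ → ℝ) (γ Cγ : ℝ) : Prop where
  step_le : ∀ k : ℕ, 1 ≤ k → k ≤ N →
    stepSize t k ≤ Cγ * maxStep N t * min 1 (t k ^ (1 - 1 / γ))
  node_le : ∀ k : ℕ, 2 ≤ k → k ≤ N → t k ≤ Cγ * t (k - 1)
  ratio_le : ∀ k : ℕ, 2 ≤ k → k ≤ N →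
    stepSize t k / t k ≤ Cγ * (stepSize t (k - 1) / t (k - 1))

/-- The L1 kernel `A^(n)_{n-k} = (1/τ_k) ∫_{t_{k-1}}^{t_k} ω_{1-α}(t_n - s) ds`, `1 ≤ k ≤ n`. -/
def l1Kernel (α : ℝ) (t : ℕ → ℝ) (n k : ℕ) : ℝ :=
  (∫ s in (t (k - 1))..(t k), omegaKernel (1 - α) (t n - s)) / stepSize t k

/-- The L1 formula `∑_{k=1}^n A^(n)_{n-k} (v^k - v^{k-1})`. -/
def l1Caputo (α : ℝ) (t : ℕ → ℝ) (v : ℕ → ℝ) (n : ℕ) : ℝ :=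
  ∑ k ∈ Finset.Icc 1 n, l1Kernel α t n k * (v k - v (k - 1))

/-! The space grid: a grid function is given by its values `v i` at the points
`x_i = xl + i h`, `0 ≤ i ≤ M`; values at larger indices play no role. -/

/-- The mesh width `h = (xr - xl) / M`. -/
def meshWidth (xl xr : ℝ) (M : ℕ) : ℝ := (xr - xl) / M

/-- The grid point `x_i = xl + i h`. -/
def gridPoint (xl xr : ℝ) (M i : ℕ) : ℝ := xl + i * meshWidth xl xr M

/-- The difference operator `-∂_h(μ ∂_h v)` at the interior grid point `x_i`, `1 ≤ i ≤ M - 1`. -/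
def discreteOp (xl xr : ℝ) (μ : ℝ → ℝ) (M : ℕ) (v : ℕ → ℝ) (i : ℕ) : ℝ :=
  -((μ (gridPoint xl xr M i + meshWidth xl xr M / 2) * ((v (i + 1) - v i) / meshWidth xl xr M)
    - μ (gridPoint xl xr M i - meshWidth xl xr M / 2) * ((v i - v (i - 1)) / meshWidth xl xr M))
      / meshWidth xl xr M)

/-- The discrete inner product `h ∑_{x ∈ Ω_h} v(x) w(x)` over the interior grid points. -/
def gridInner (xl xr : ℝ) (M : ℕ) (v w : ℕ → ℝ) : ℝ :=
  meshWidth xl xr M * ∑ i ∈ Finset.Ioo 0 M, v i * w i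

/-- The discrete `L²` norm. -/
def gridL2 (xl xr : ℝ) (M : ℕ) (v : ℕ → ℝ) : ℝ := √(gridInner xl xr M v v)

/-- The discrete `H¹` seminorm `|v|₁ = ⟨v, L_h v⟩^{1/2}` of a grid function that vanishes at both
end points. -/
def gridH1 (xl xr : ℝ) (μ : ℝ → ℝ) (M : ℕ) (v : ℕ → ℝ) : ℝ :=
  √(gridInner xl xr M v (discreteOp xl xr μ M v))

/-- The discrete embedding inequality `‖v‖² ≤ CΩ |v|₁²` holds on every grid, for all grid functions
that vanish at both end points. -/
def EmbeddingConstant (xl xr : ℝ) (μ : ℝ → ℝ) (CΩ : ℝ) : Prop :=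
  ∀ M : ℕ, 1 ≤ M → ∀ v : ℕ → ℝ, v 0 = 0 → v M = 0 →
    gridL2 xl xr M v ^ 2 ≤ CΩ * gridH1 xl xr μ M v ^ 2

/-- `uh n i` (the value at `x_i` and time level `n`) solves the fully discrete L1 scheme. -/
structure SolvesL1Scheme (α xl xr : ℝ) (μ c : ℝ → ℝ) (f ub : ℝ → ℝ → ℝ) (u0 : ℝ → ℝ)
    (N : ℕ) (t : ℕ → ℝ) (M : ℕ) (uh : ℕ → ℕ → ℝ) : Prop where
  equation : ∀ n : ℕ, 1 ≤ n → n ≤ N → ∀ i : ℕ, 0 < i → i < M →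
    l1Caputo α t (fun k => uh k i) n + discreteOp xl xr μ M (uh n) i
      = c (gridPoint xl xr M i) * uh n i + f (gridPoint xl xr M i) (t n)
  boundary : ∀ n : ℕ, 1 ≤ n → n ≤ N → uh n 0 = ub xl (t n) ∧ uh n M = ub xr (t n)
  initial : ∀ i : ℕ, 0 < i → i < M → uh 0 i = u0 (gridPoint xl xr M i)

end

/-!
The proof combines an energy argument in space with a discrete fractional Grönwall inequality in
time; every bound has to hold uniformly in the fractional order `α` and on nonuniform meshes.

**Energy estimate.** The error `e^n = u(t_n) - u_h^n` vanishes at the end points and satisfies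
`∂e + L_h e = c e - w + R`, with the L1 formula `∂`, its error `w` and the error `R` of the
difference operator. Testing with `L_h e^n` and using that the L1 coefficients increase towards the
diagonal gives `∂(|e|₁²) ≤ κ² CΩ |e|₁² + 2 |e|₁ ξ + η²` (`energy_inequality`). Here `η` is the
discrete `L²` norm of `R`, which is of order `h²` for `H⁴` functions (`gridInner_consistency_le`).
The term with `w` is treated by summation by parts, so that only the time regularity in `H¹` is
needed: tested against `L_h e^n`, the temporal errors at all the grid points add up to the L1 error
of one scalar function `l(u(t))`, with a functional `l` on `H¹` of norm at most `√μ₁ |e^n|₁`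
(`abs_gridForm_l1_defect_le`). The constancy in time of the boundary values makes `w` vanish at the
end points.

**Complementary kernels.** The weights `p` with `∑_{j=k}^n p_j A_{jk} = 1` invert the L1 formula
(`IsComplementary`). Against them the truncation errors of a function with
`|v''(s)| ≤ B (1 + s^(σ-2))` telescope to diagonal terms, which the grading of the mesh bounds by
`τ^min(2-α, γσ) / (σ (1-α))` (`IsComplementary.sum_truncationBound_le_rpow`), and the sum of the
weights is at most `2 t_n^α`, which explains the factor `t_n^(α/2)` at `h²`.

**Grönwall inequality.** Applied to the powers `ω_{1+kα}(t_j)`, the weights behave like the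
fractional integral, up to the factor `max 1 ρ`: for concave powers by Chebyshev's integral
inequality, for convex ones by a shift of one step. Summing the Mittag-Leffler series,
`t ↦ E_α(2 max(1,ρ) κ² CΩ t^α)` is a supersolution (`IsComplementary.sum_mittagLeffler_le`), and
`discrete_fractional_gronwall` concludes; the step size restriction absorbs the diagonal term.

On a one-dimensional interval the functions of `H^m` are handled through their continuous
representatives, which are primitives of the weak derivatives by the du Bois-Reymond lemma
(`IsWeakDeriv.exists_ae_eq`). The embedding constant `(xr - xl)² / μ₀` is the discrete Poincaré
inequality (`embeddingConstant_of_bounds`).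
-/

noncomputable section

/-! ### Power kernels -/

theorem omegaKernel_nonneg {β t : ℝ} (hβ : 0 < β) (ht : 0 ≤ t) : 0 ≤ omegaKernel β t :=
  div_nonneg (Real.rpow_nonneg ht _) (Real.Gamma_pos_of_pos hβ).le

theorem omegaKernel_pos {β t : ℝ} (hβ : 0 < β) (ht : 0 < t) : 0 < omegaKernel β t :=
  div_pos (Real.rpow_pos_of_pos ht _) (Real.Gamma_pos_of_pos hβ)

theorem omegaKernel_antitone {β x y : ℝ} (hβ : 0 < β) (hβ1 : β ≤ 1) (hx : 0 < x) (hxy : x ≤ y) :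
    omegaKernel β y ≤ omegaKernel β x :=
  div_le_div_of_nonneg_right (Real.rpow_le_rpow_of_nonpos hx hxy (by linarith))
    (Real.Gamma_pos_of_pos hβ).le

theorem omegaKernel_monotone {β x y : ℝ} (hβ : 1 ≤ β) (hx : 0 ≤ x) (hxy : x ≤ y) :
    omegaKernel β x ≤ omegaKernel β y :=
  div_le_div_of_nonneg_right (Real.rpow_le_rpow hx hxy (by linarith))
    (Real.Gamma_pos_of_pos (by linarith)).le

theorem omegaKernel_sub_intervalIntegrable {β : ℝ} (hβ : 0 < β) (a b c : ℝ) :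
    IntervalIntegrable (fun s => omegaKernel β (c - s)) volume a b := by
  have h := (intervalIntegral.intervalIntegrable_rpow' (a := c - a) (b := c - b)
    (r := β - 1) (by linarith)).comp_sub_left c
  simp only [sub_sub_cancel] at h
  exact h.div_const _

theorem omegaKernel_intervalIntegrable {β : ℝ} (hβ : 0 < β) (a b : ℝ) :
    IntervalIntegrable (fun s => omegaKernel β s) volume a b :=
  (intervalIntegral.intervalIntegrable_rpow' (by linarith)).div_const _

theorem integral_omegaKernel {β : ℝ} (hβ : 0 < β) (a b : ℝ) :
    ∫ s in a..b, omegaKernel β s = omegaKernel (β + 1) b - omegaKernel (β + 1) a := by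
  unfold omegaKernel
  rw [intervalIntegral.integral_div, integral_rpow (Or.inl (by linarith)),
    Real.Gamma_add_one hβ.ne', sub_add_cancel, add_sub_cancel_right]
  have := (Real.Gamma_pos_of_pos hβ).ne'
  field_simp

theorem integral_omegaKernel_sub {β : ℝ} (hβ : 0 < β) (a c : ℝ) :
    ∫ s in a..c, omegaKernel β (c - s) = omegaKernel (β + 1) (c - a) := by
  rw [intervalIntegral.integral_comp_sub_left (fun s => omegaKernel β s), integral_omegaKernel hβ,
    sub_self]
  have : omegaKernel (β + 1) 0 = 0 := by
    unfold omegaKernel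
    rw [add_sub_cancel_right, Real.zero_rpow hβ.ne', zero_div]
  rw [this, sub_zero]

theorem intervalIntegrable_rpow_mul_rpow {a b t : ℝ} (ha : 0 < a) (hb : 0 < b) (ht : 0 < t) :
    IntervalIntegrable (fun s => (t - s) ^ (a - 1) * s ^ (b - 1)) volume 0 t := by
  have key : ∀ p q : ℝ, 0 < p → 0 < q →
      IntervalIntegrable (fun s => (t - s) ^ (p - 1) * s ^ (q - 1)) volume 0 (t / 2) := by
    intro p q hp hq
    apply IntervalIntegrable.continuousOn_mul
    · exact intervalIntegral.intervalIntegrable_rpow' (by linarith)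
    · intro x hx
      rw [uIcc_of_le (by positivity)] at hx
      apply ContinuousAt.continuousWithinAt
      apply ContinuousAt.rpow_const (by fun_prop)
      left
      have := hx.2
      linarith
  refine (key a b ha hb).trans ?_
  have h2 := (key b a hb ha).comp_sub_left t
  simp only [sub_zero, sub_sub_cancel] at h2
  rw [show t - t / 2 = t / 2 by ring] at h2
  refine h2.symm.congr ?_
  intro s _
  exact mul_comm _ _

theorem integral_rpow_mul_rpow {a b t : ℝ} (ha : 0 < a) (hb : 0 < b) (ht : 0 < t) :
    ∫ s in (0 : ℝ)..t, (t - s) ^ (a - 1) * s ^ (b - 1)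
      = Real.Gamma a * Real.Gamma b / Real.Gamma (a + b) * t ^ (a + b - 1) := by
  have h1 := Complex.betaIntegral_scaled (b : ℂ) (a : ℂ) ht
  have h2 : ∫ x in (0 : ℝ)..t, (x : ℂ) ^ ((b : ℂ) - 1) * ((t : ℂ) - x) ^ ((a : ℂ) - 1)
      = ((∫ s in (0 : ℝ)..t, (t - s) ^ (a - 1) * s ^ (b - 1) : ℝ) : ℂ) := by
    rw [← intervalIntegral.integral_ofReal]
    apply intervalIntegral.integral_congr
    intro s hs
    rw [uIcc_of_le ht.le] at hs
    simp only
    rw [Complex.ofReal_mul, Complex.ofReal_cpow (by linarith [hs.2]), Complex.ofReal_cpow hs.1]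
    push_cast
    ring
  rw [h2, Complex.betaIntegral_eq_Gamma_mul_div _ _ (by simpa) (by simpa)] at h1
  have h3 : ((t : ℂ) ^ ((b : ℂ) + a - 1)) = ((t ^ (a + b - 1) : ℝ) : ℂ) := by
    rw [Complex.ofReal_cpow ht.le]; push_cast; ring_nf
  rw [h3, ← Complex.ofReal_add, Complex.Gamma_ofReal, Complex.Gamma_ofReal, Complex.Gamma_ofReal]
    at h1
  have h4 := h1
  norm_cast at h4
  rw [h4, add_comm b a]
  ring

/-- The convolution identity `ω_a * ω_b = ω_{a+b}`. -/
theorem integral_omegaKernel_mul_omegaKernel {a b t : ℝ} (ha : 0 < a) (hb : 0 < b) (ht : 0 < t) :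
    ∫ s in (0 : ℝ)..t, omegaKernel a (t - s) * omegaKernel b s = omegaKernel (a + b) t := by
  have h : ∀ s, omegaKernel a (t - s) * omegaKernel b s
      = ((t - s) ^ (a - 1) * s ^ (b - 1)) / (Real.Gamma a * Real.Gamma b) := by
    intro s; unfold omegaKernel; rw [div_mul_div_comm]
  simp_rw [h]
  rw [intervalIntegral.integral_div, integral_rpow_mul_rpow ha hb ht]
  unfold omegaKernel
  have h1 := (Real.Gamma_pos_of_pos ha).ne'
  have h2 := (Real.Gamma_pos_of_pos hb).ne'
  field_simp

theorem intervalIntegrable_omegaKernel_mul_rpow {a b t : ℝ} (ha : 0 < a) (hb : 0 < b)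
    (ht : 0 < t) :
    IntervalIntegrable (fun s => omegaKernel a (t - s) * s ^ (b - 1)) volume 0 t := by
  have h := (intervalIntegrable_rpow_mul_rpow ha hb ht).div_const (Real.Gamma a)
  refine h.congr ?_
  intro s _
  unfold omegaKernel
  ring

/-- Chebyshev's integral inequality for an increasing and a decreasing function. -/
theorem integral_mul_le_of_monotoneOn_antitoneOn {a b : ℝ} (hab : a < b) {f g : ℝ → ℝ}
    (hf : MonotoneOn f (Ioo a b)) (hg : AntitoneOn g (Ioo a b))
    (fi : IntervalIntegrable f volume a b) (gi : IntervalIntegrable g volume a b)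
    (fgi : IntervalIntegrable (fun s => f s * g s) volume a b) :
    (b - a) * ∫ s in a..b, f s * g s ≤ (∫ s in a..b, f s) * ∫ s in a..b, g s := by
  have h1 : ∀ y ∈ Ioo a b,
      (∫ s in a..b, f s * g s) - g y * (∫ s in a..b, f s) - f y * (∫ s in a..b, g s)
        + (f y * g y) * (b - a) ≤ 0 := by
    intro y hy
    have e : ∫ s in a..b, (f s * g s - g y * f s - f y * g s + f y * g y)
        = (∫ s in a..b, f s * g s) - g y * (∫ s in a..b, f s) - f y * (∫ s in a..b, g s)
        + (f y * g y) * (b - a) := by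
      rw [intervalIntegral.integral_add ((fgi.sub (fi.const_mul _)).sub (gi.const_mul _))
        (by simp), intervalIntegral.integral_sub (fgi.sub (fi.const_mul _)) (gi.const_mul _),
        intervalIntegral.integral_sub fgi (fi.const_mul _), intervalIntegral.integral_const_mul,
        intervalIntegral.integral_const_mul, intervalIntegral.integral_const, smul_eq_mul]
      ring
    rw [← e, intervalIntegral.integral_of_le hab.le, integral_Ioc_eq_integral_Ioo]
    apply setIntegral_nonpos measurableSet_Ioo
    intro x hx
    have : (f x - f y) * (g x - g y) ≤ 0 := by
      rcases le_total x y with h | h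
      · exact mul_nonpos_of_nonpos_of_nonneg (sub_nonpos.2 (hf hx hy h)) (sub_nonneg.2 (hg hx hy h))
      · exact mul_nonpos_of_nonneg_of_nonpos (sub_nonneg.2 (hf hy hx h)) (sub_nonpos.2 (hg hy hx h))
    nlinarith
  set I := ∫ s in a..b, f s * g s
  set F := ∫ s in a..b, f s
  set G := ∫ s in a..b, g s
  have h2 : ∫ y in a..b, (I - g y * F - f y * G + (f y * g y) * (b - a)) ≤ 0 := by
    rw [intervalIntegral.integral_of_le hab.le, integral_Ioc_eq_integral_Ioo]
    exact setIntegral_nonpos measurableSet_Ioo h1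
  have h3 : ∫ y in a..b, (I - g y * F - f y * G + (f y * g y) * (b - a))
      = I * (b - a) - G * F - F * G + I * (b - a) := by
    have c : IntervalIntegrable (fun _ : ℝ => I) volume a b := by simp
    rw [intervalIntegral.integral_add ((c.sub (gi.mul_const _)).sub (fi.mul_const _))
        (fgi.mul_const _), intervalIntegral.integral_sub (c.sub (gi.mul_const _)) (fi.mul_const _),
        intervalIntegral.integral_sub c (gi.mul_const _), intervalIntegral.integral_mul_const,
        intervalIntegral.integral_mul_const, intervalIntegral.integral_mul_const,
        intervalIntegral.integral_const, smul_eq_mul]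
    ring
  rw [h3] at h2
  linarith

theorem convexOn_omegaKernel {β : ℝ} (hβ : 0 < β) (hβ1 : β < 1) :
    ConvexOn ℝ (Ioi 0) (omegaKernel β) := by
  have hd : ∀ x ∈ Ioi (0 : ℝ), HasDerivAt (omegaKernel β)
      ((β - 1) * x ^ (β - 1 - 1) / Real.Gamma β) x := fun x hx =>
    (Real.hasDerivAt_rpow_const (Or.inl (ne_of_gt hx))).div_const _
  apply MonotoneOn.convexOn_of_deriv (convex_Ioi 0)
  · exact fun x hx => (hd x hx).continuousAt.continuousWithinAt
  · rw [interior_Ioi]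
    exact fun x hx => (hd x hx).differentiableAt.differentiableWithinAt
  · rw [interior_Ioi]
    intro x hx y hy hxy
    rw [(hd x hx).deriv, (hd y hy).deriv]
    apply div_le_div_of_nonneg_right _ (Real.Gamma_pos_of_pos hβ).le
    have := Real.rpow_le_rpow_of_nonpos hx hxy (show β - 1 - 1 ≤ 0 by linarith)
    nlinarith

/-- The trapezoidal rule overestimates the integral of the (convex) kernel. -/
theorem integral_omegaKernel_sub_le {β a b c : ℝ} (hβ : 0 < β) (hβ1 : β < 1) (hab : a < b)
    (hbc : b < c) :
    ∫ s in a..b, omegaKernel β (c - s)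
      ≤ (b - a) * ((omegaKernel β (c - a) + omegaKernel β (c - b)) / 2) := by
  have hconv := convexOn_omegaKernel hβ hβ1
  set A := omegaKernel β (c - a)
  set B := omegaKernel β (c - b)
  have hpt : ∀ s ∈ Icc a b, omegaKernel β (c - s) ≤ A + (B - A) / (b - a) * (s - a) := by
    intro s hs
    have hba : 0 < b - a := by linarith
    have h := hconv.2 (show c - a ∈ Ioi (0 : ℝ) by simp; linarith)
      (show c - b ∈ Ioi (0 : ℝ) by simp; linarith)
      (show 0 ≤ (b - s) / (b - a) from div_nonneg (by linarith [hs.2]) hba.le)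
      (show 0 ≤ (s - a) / (b - a) from div_nonneg (by linarith [hs.1]) hba.le)
      (by field_simp; ring)
    simp only [smul_eq_mul] at h
    have e : (b - s) / (b - a) * (c - a) + (s - a) / (b - a) * (c - b) = c - s := by
      field_simp; ring
    rw [e] at h
    refine h.trans (le_of_eq ?_)
    change (b - s) / (b - a) * A + (s - a) / (b - a) * B = _
    field_simp; ring
  have h2 := intervalIntegral.integral_mono_on hab.le
    (omegaKernel_sub_intervalIntegrable hβ a b c)
    (show IntervalIntegrable (fun s => A + (B - A) / (b - a) * (s - a)) volume a b from
      (by fun_prop : Continuous fun s => A + (B - A) / (b - a) * (s - a)).intervalIntegrable _ _)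
    hpt
  refine h2.trans (le_of_eq ?_)
  rw [intervalIntegral.integral_add (by simp)
    ((by fun_prop : Continuous fun s => (B - A) / (b - a) * (s - a)).intervalIntegrable _ _),
    intervalIntegral.integral_const, intervalIntegral.integral_const_mul,
    intervalIntegral.integral_sub (by simp) (by simp), integral_id,
    intervalIntegral.integral_const, smul_eq_mul, smul_eq_mul]
  have hba : b - a ≠ 0 := by linarith
  field_simp
  ring

/-- A lower bound for the growth of `Γ`, from the part of its integral over `(R, ∞)`; it makes the
Mittag-Leffler series converge. -/
theorem Real.rpow_mul_exp_neg_le_Gamma {R x : ℝ} (hR : 0 < R) (hx : 0 ≤ x) :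
    R ^ x * Real.exp (-R) ≤ Real.Gamma (1 + x) := by
  have h1 : 0 < 1 + x := by linarith
  rw [Real.Gamma_eq_integral h1, add_sub_cancel_left]
  have hi := Real.GammaIntegral_convergent h1
  rw [add_sub_cancel_left] at hi
  have h2 : ∫ t in Ioi R, Real.exp (-t) * R ^ x ≤ ∫ t in Ioi R, Real.exp (-t) * t ^ x := by
    apply setIntegral_mono_on _ (hi.mono_set (Ioi_subset_Ioi hR.le)) measurableSet_Ioi
    · intro t ht
      exact mul_le_mul_of_nonneg_left (Real.rpow_le_rpow hR.le (le_of_lt ht) hx)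
        (Real.exp_pos _).le
    · exact (integrableOn_exp_neg_Ioi R).mul_const _
  have h3 : ∫ t in Ioi R, Real.exp (-t) * t ^ x ≤ ∫ t in Ioi 0, Real.exp (-t) * t ^ x := by
    apply setIntegral_mono_set hi
    · filter_upwards [ae_restrict_mem measurableSet_Ioi] with t ht
      exact mul_nonneg (Real.exp_pos _).le (Real.rpow_nonneg (le_of_lt ht) _)
    · exact (Ioi_subset_Ioi hR.le).eventuallyLE
  rw [integral_mul_const, integral_exp_neg_Ioi] at h2
  linarith [mul_comm (R ^ x) (Real.exp (-R))]

theorem summable_mittagLeffler {α z : ℝ} (hα : 0 < α) (hz : 0 ≤ z) :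
    Summable fun k : ℕ => z ^ k / Real.Gamma (1 + (k : ℝ) * α) := by
  -- with `R ^ α = 2 z + 1`, the terms are dominated by a geometric series of ratio at most `1 / 2`
  set R : ℝ := (2 * z + 1) ^ (1 / α)
  have hR : 0 < R := Real.rpow_pos_of_pos (by linarith) _
  have hRα : ∀ k : ℕ, R ^ ((k : ℝ) * α) = (2 * z + 1) ^ k := by
    intro k
    rw [← Real.rpow_mul (by linarith), ← Real.rpow_natCast]
    congr 1
    field_simp
  have hs : Summable fun k : ℕ => Real.exp R * (z / (2 * z + 1)) ^ k := by
    apply (summable_geometric_of_lt_one (div_nonneg hz (by linarith)) _).mul_left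
    rw [div_lt_one (by linarith)]; linarith
  refine hs.of_nonneg_of_le (fun k => ?_) (fun k => ?_)
  · exact div_nonneg (pow_nonneg hz k) (Real.Gamma_pos_of_pos (by positivity)).le
  · have h := Real.rpow_mul_exp_neg_le_Gamma hR (x := (k : ℝ) * α) (by positivity)
    rw [hRα] at h
    have h2 : 0 < (2 * z + 1) ^ k * Real.exp (-R) := by positivity
    calc z ^ k / Real.Gamma (1 + (k : ℝ) * α) ≤ z ^ k / ((2 * z + 1) ^ k * Real.exp (-R)) := by
          gcongr
      _ = _ := by
          rw [Real.exp_neg, div_pow]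
          field_simp

theorem summable_omegaKernel {α Λ t : ℝ} (hα : 0 < α) (hΛ : 0 ≤ Λ) (ht : 0 ≤ t) :
    Summable fun k : ℕ => Λ ^ k * omegaKernel (1 + (k : ℝ) * α) t := by
  refine (summable_mittagLeffler hα (mul_nonneg hΛ (Real.rpow_nonneg ht α))).congr fun k => ?_
  unfold omegaKernel
  rw [mul_pow, add_sub_cancel_left, mul_comm (k : ℝ) α, Real.rpow_mul ht, Real.rpow_natCast]
  ring

theorem mittagLeffler_eq_tsum {α Λ t : ℝ} (ht : 0 ≤ t) :
    mittagLeffler α (Λ * t ^ α) = ∑' k : ℕ, Λ ^ k * omegaKernel (1 + (k : ℝ) * α) t := by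
  unfold mittagLeffler
  congr 1
  funext k
  unfold omegaKernel
  rw [mul_pow, add_sub_cancel_left, mul_comm (k : ℝ) α, Real.rpow_mul ht, Real.rpow_natCast]
  ring

theorem one_le_mittagLeffler {α z : ℝ} (hα : 0 < α) (hz : 0 ≤ z) : 1 ≤ mittagLeffler α z := by
  have h := (summable_mittagLeffler hα hz).le_tsum 0 (fun k _ =>
    div_nonneg (pow_nonneg hz k) (Real.Gamma_pos_of_pos (by positivity)).le)
  simpa [mittagLeffler] using h

theorem mittagLeffler_mono {α z w : ℝ} (hα : 0 < α) (hz : 0 ≤ z) (hzw : z ≤ w) :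
    mittagLeffler α z ≤ mittagLeffler α w := by
  refine (summable_mittagLeffler hα hz).tsum_le_tsum (fun k => ?_)
    (summable_mittagLeffler hα (hz.trans hzw))
  have : 0 < Real.Gamma (1 + (k : ℝ) * α) := Real.Gamma_pos_of_pos (by positivity)
  gcongr

/-! ### Time meshes and the L1 kernel -/

namespace IsTimeMesh

variable {T : ℝ} {N : ℕ} {t : ℕ → ℝ}

theorem lt (ht : IsTimeMesh T N t) {j k : ℕ} (hjk : j < k) (hk : k ≤ N) : t j < t k := by
  induction k, hjk using Nat.le_induction with
  | base => exact ht.lt_succ j hk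
  | succ m hm ih => exact (ih (by omega)).trans (ht.lt_succ m hk)

theorem le (ht : IsTimeMesh T N t) {j k : ℕ} (hjk : j ≤ k) (hk : k ≤ N) : t j ≤ t k := by
  rcases hjk.eq_or_lt with rfl | h
  · exact le_rfl
  · exact (ht.lt h hk).le

theorem nonneg (ht : IsTimeMesh T N t) {k : ℕ} (hk : k ≤ N) : 0 ≤ t k :=
  ht.zero ▸ ht.le (Nat.zero_le k) hk

theorem pos (ht : IsTimeMesh T N t) {k : ℕ} (h1 : 1 ≤ k) (hk : k ≤ N) : 0 < t k :=
  ht.zero ▸ ht.lt h1 hk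

theorem le_last (ht : IsTimeMesh T N t) {k : ℕ} (hk : k ≤ N) : t k ≤ T :=
  ht.last ▸ ht.le hk le_rfl

theorem pred_lt (ht : IsTimeMesh T N t) {k : ℕ} (h1 : 1 ≤ k) (hk : k ≤ N) : t (k - 1) < t k :=
  ht.lt (by omega) hk

theorem stepSize_pos (ht : IsTimeMesh T N t) {k : ℕ} (h1 : 1 ≤ k) (hk : k ≤ N) :
    0 < stepSize t k :=
  sub_pos.2 (ht.pred_lt h1 hk)

theorem stepSize_le_maxStep (_ht : IsTimeMesh T N t) {k : ℕ} (h1 : 1 ≤ k) (hk : k ≤ N) :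
    stepSize t k ≤ maxStep N t := by
  have h := le_ciSup (f := fun k : Fin N => stepSize t (k + 1)) (Set.finite_range _).bddAbove
    (⟨k - 1, by omega⟩ : Fin N)
  simpa [Nat.sub_add_cancel h1, maxStep] using h

theorem maxStep_pos (ht : IsTimeMesh T N t) : 0 < maxStep N t :=
  (ht.stepSize_pos le_rfl ht.one_le).trans_le (ht.stepSize_le_maxStep le_rfl ht.one_le)

theorem maxStep_le (ht : IsTimeMesh T N t) : maxStep N t ≤ T := by
  have : Nonempty (Fin N) := ⟨⟨0, ht.one_le⟩⟩
  refine ciSup_le fun k => ?_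
  have h1 := ht.nonneg (k := (k : ℕ)) (by omega)
  have h2 := ht.le_last (k := (k : ℕ) + 1) (by omega)
  simp only [stepSize, Nat.add_sub_cancel]
  linarith

end IsTimeMesh

theorem sum_integral_mesh {f : ℝ → ℝ} {t : ℕ → ℝ} {n : ℕ}
    (h : ∀ k, 1 ≤ k → k ≤ n → IntervalIntegrable f volume (t (k - 1)) (t k)) :
    ∑ k ∈ Finset.Icc 1 n, ∫ s in (t (k - 1))..(t k), f s = ∫ s in (t 0)..(t n), f s := by
  have h2 := intervalIntegral.sum_integral_adjacent_intervals (μ := volume) (f := f) (a := t)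
    (n := n) (fun k hk => h (k + 1) (by omega) hk)
  have h3 := Finset.sum_Ico_add' (fun k => ∫ s in (t (k - 1))..(t k), f s) 0 n 1
  rw [← h2, Finset.range_eq_Ico]
  simp only [Nat.add_sub_cancel] at h3
  rw [h3]
  rfl

theorem sum_Icc_sub_pred (v : ℕ → ℝ) (n : ℕ) :
    ∑ k ∈ Finset.Icc 1 n, (v k - v (k - 1)) = v n - v 0 := by
  induction n with
  | zero => simp
  | succ n ih => rw [Finset.sum_Icc_succ_top (by omega), ih]; simp

section kernel

variable {T α : ℝ} {N : ℕ} {t : ℕ → ℝ}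

theorem l1Kernel_lower (ht : IsTimeMesh T N t) (h0 : 0 < α) (h1 : α < 1) {k n : ℕ} (hk : 1 ≤ k)
    (hkn : k ≤ n) (hn : n ≤ N) : omegaKernel (1 - α) (t n - t (k - 1)) ≤ l1Kernel α t n k := by
  have hτ := ht.stepSize_pos hk (hkn.trans hn)
  unfold l1Kernel
  rw [le_div_iff₀ hτ, stepSize]
  have hlt := ht.pred_lt hk (hkn.trans hn)
  have hkn' := ht.le hkn hn
  have h := intervalIntegral.integral_mono_on_of_le_Ioo (f := fun _ =>
      omegaKernel (1 - α) (t n - t (k - 1))) (μ := volume) hlt.le (by simp)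
    (omegaKernel_sub_intervalIntegrable (show 0 < 1 - α by linarith) (t (k - 1)) (t k) (t n))
    (fun s hs => omegaKernel_antitone (by linarith) (by linarith) (by linarith [hs.2])
      (by linarith [hs.1]))
  rw [intervalIntegral.integral_const, smul_eq_mul] at h
  linarith

theorem l1Kernel_pos (ht : IsTimeMesh T N t) (h0 : 0 < α) (h1 : α < 1) {k n : ℕ} (hk : 1 ≤ k)
    (hkn : k ≤ n) (hn : n ≤ N) : 0 < l1Kernel α t n k :=
  (omegaKernel_pos (by linarith) (sub_pos.2 (ht.lt (by omega) hn))).trans_le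
    (l1Kernel_lower ht h0 h1 hk hkn hn)

theorem l1Kernel_upper (ht : IsTimeMesh T N t) (h0 : 0 < α) (h1 : α < 1) {k n : ℕ} (hk : 1 ≤ k)
    (hkn : k < n) (hn : n ≤ N) : l1Kernel α t n k ≤
      (omegaKernel (1 - α) (t n - t (k - 1)) + omegaKernel (1 - α) (t n - t k)) / 2 := by
  have hτ := ht.stepSize_pos hk (hkn.le.trans hn)
  unfold l1Kernel
  rw [div_le_iff₀ hτ, stepSize, mul_comm]
  exact integral_omegaKernel_sub_le (by linarith) (by linarith) (ht.pred_lt hk (by omega))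
    (ht.lt hkn hn)

/-- The oscillation of the kernel over one step is controlled by the increment of the L1
coefficients; this uses the convexity of the kernel. -/
theorem omegaKernel_sub_le_l1Kernel_sub (ht : IsTimeMesh T N t) (h0 : 0 < α) (h1 : α < 1)
    {k n : ℕ} (hk : 1 ≤ k) (hkn : k < n) (hn : n ≤ N) :
    omegaKernel (1 - α) (t n - t k) - omegaKernel (1 - α) (t n - t (k - 1))
      ≤ 2 * (l1Kernel α t n (k + 1) - l1Kernel α t n k) := by
  have h2 := l1Kernel_upper ht h0 h1 hk hkn hn
  have h3 := l1Kernel_lower ht h0 h1 (k := k + 1) (by omega) hkn hn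
  rw [Nat.add_sub_cancel] at h3
  linarith

theorem l1Kernel_mono (ht : IsTimeMesh T N t) (h0 : 0 < α) (h1 : α < 1)
    {k n : ℕ} (hk : 1 ≤ k) (hkn : k < n) (hn : n ≤ N) :
    l1Kernel α t n k ≤ l1Kernel α t n (k + 1) := by
  have h2 := omegaKernel_sub_le_l1Kernel_sub ht h0 h1 hk hkn hn
  have h3 := omegaKernel_antitone (β := 1 - α) (by linarith) (by linarith)
    (sub_pos.2 (ht.lt hkn hn)) (sub_le_sub_left (ht.pred_lt hk (by omega)).le (t n))
  linarith

theorem l1Kernel_self (ht : IsTimeMesh T N t) (h1 : α < 1) {n : ℕ} (hn1 : 1 ≤ n)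
    (hn : n ≤ N) : l1Kernel α t n n = stepSize t n ^ (-α) / Real.Gamma (2 - α) := by
  have hτ := ht.stepSize_pos hn1 hn
  unfold l1Kernel
  rw [integral_omegaKernel_sub (by linarith)]
  change omegaKernel (1 - α + 1) (stepSize t n) / _ = _
  unfold omegaKernel
  rw [show 1 - α + 1 - 1 = 1 + -α by ring, Real.rpow_add hτ, Real.rpow_one,
    show 1 - α + 1 = 2 - α by ring]
  field_simp

end kernel

/-! ### Complementary kernels -/

/-- `p` is the discrete complementary convolution kernel, at time level `n`, of the lower triangular
array `A`: the weights `p j` turn the discrete derivative `∑ k, A j k (v k - v (k-1))` back into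
`v n - v 0`. -/
structure IsComplementary (A : ℕ → ℕ → ℝ) (n : ℕ) (p : ℕ → ℝ) : Prop where
  nonneg : ∀ j, 1 ≤ j → j ≤ n → 0 ≤ p j
  sum_eq_one : ∀ k, 1 ≤ k → k ≤ n → ∑ j ∈ Finset.Icc k n, p j * A j k = 1

/-- The complementary kernel exists, and is nonnegative, when the rows of `A` increase towards a
positive diagonal. -/
theorem exists_isComplementary {A : ℕ → ℕ → ℝ} {n : ℕ}
    (hpos : ∀ k, 1 ≤ k → k ≤ n → 0 < A k k)
    (hmono : ∀ j k, 1 ≤ k → k < j → j ≤ n → A j k ≤ A j (k + 1)) :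
    ∃ p, IsComplementary A n p := by
  -- `p` is constructed by descending recursion from `p n = 1 / A n n`
  have key : ∀ m, m ≤ n → ∃ p : ℕ → ℝ, (∀ j, n - m < j → j ≤ n → 0 ≤ p j) ∧
      ∀ k, n - m < k → k ≤ n → ∑ j ∈ Finset.Icc k n, p j * A j k = 1 := by
    intro m
    induction m with
    | zero => exact fun _ => ⟨0, fun j h1 h2 => by omega, fun k h1 h2 => by omega⟩
    | succ m ih =>
      intro hm
      obtain ⟨p, hp, hs⟩ := ih (by omega)
      set k₀ := n - m with hk₀
      have hk1 : 1 ≤ k₀ := by omega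
      have hkn : k₀ ≤ n := by omega
      set S := ∑ j ∈ Finset.Icc (k₀ + 1) n, p j * A j k₀
      have hS : S ≤ 1 := by
        rcases hkn.eq_or_lt with h | h
        · have : S = 0 := Finset.sum_eq_zero fun j hj => by
            rw [Finset.mem_Icc] at hj; omega
          linarith
        · rw [← hs (k₀ + 1) (by omega) (by omega)]
          apply Finset.sum_le_sum
          intro j hj
          rw [Finset.mem_Icc] at hj
          exact mul_le_mul_of_nonneg_left (hmono j k₀ hk1 (by omega) hj.2) (hp j (by omega) hj.2)
      have hsum : ∀ k, k₀ < k → ∑ j ∈ Finset.Icc k n,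
          Function.update p k₀ ((1 - S) / A k₀ k₀) j * A j k
            = ∑ j ∈ Finset.Icc k n, p j * A j k := by
        intro k hk
        apply Finset.sum_congr rfl
        intro j hj
        rw [Finset.mem_Icc] at hj
        rw [Function.update_of_ne (by omega)]
      refine ⟨Function.update p k₀ ((1 - S) / A k₀ k₀), fun j h1 h2 => ?_, fun k h1 h2 => ?_⟩
      · rcases eq_or_ne j k₀ with rfl | hne
        · rw [Function.update_self]
          exact div_nonneg (by linarith) (hpos _ hk1 hkn).le
        · rw [Function.update_of_ne hne]
          exact hp j (by omega) h2
      · rcases eq_or_ne k k₀ with hkk | hne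
        · rw [hkk, ← Finset.add_sum_Ioc_eq_sum_Icc hkn, Function.update_self]
          have : ∑ j ∈ Finset.Ioc k₀ n,
              Function.update p k₀ ((1 - S) / A k₀ k₀) j * A j k₀ = S := by
            refine Finset.sum_congr (by ext; simp) fun j hj => ?_
            rw [Finset.mem_Icc] at hj
            rw [Function.update_of_ne (by omega)]
          rw [this, div_mul_cancel₀ _ (hpos _ hk1 hkn).ne']
          ring
        · rw [hsum k (by omega)]
          exact hs k (by omega) h2
  obtain ⟨p, hp, hs⟩ := key n le_rfl
  exact ⟨p, fun j h => hp j (by omega), fun k h => hs k (by omega)⟩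

theorem sum_Icc_triangle (F : ℕ → ℕ → ℝ) (m : ℕ) :
    ∑ j ∈ Finset.Icc 1 m, ∑ k ∈ Finset.Icc 1 j, F j k
      = ∑ k ∈ Finset.Icc 1 m, ∑ j ∈ Finset.Icc k m, F j k := by
  apply Finset.sum_comm'
  intro j k
  simp only [Finset.mem_Icc]
  omega

namespace IsComplementary

variable {A : ℕ → ℕ → ℝ} {n : ℕ} {p : ℕ → ℝ}

theorem sum_mul_sum (hp : IsComplementary A n p) (d : ℕ → ℝ) :
    ∑ j ∈ Finset.Icc 1 n, p j * ∑ k ∈ Finset.Icc 1 j, A j k * d k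
      = ∑ k ∈ Finset.Icc 1 n, d k := by
  simp_rw [Finset.mul_sum]
  rw [sum_Icc_triangle (fun j k => p j * (A j k * d k))]
  apply Finset.sum_congr rfl
  intro k hk
  rw [Finset.mem_Icc] at hk
  simp_rw [← mul_assoc]
  rw [← Finset.sum_mul, hp.sum_eq_one k hk.1 hk.2, one_mul]

theorem mul_diag_le (hp : IsComplementary A n p)
    (hA : ∀ j k, 1 ≤ k → k ≤ j → j ≤ n → 0 ≤ A j k) {k : ℕ} (h1 : 1 ≤ k) (hk : k ≤ n) :
    p k * A k k ≤ 1 := by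
  rw [← hp.sum_eq_one k h1 hk]
  apply Finset.single_le_sum (f := fun j => p j * A j k)
  · intro j hj
    rw [Finset.mem_Icc] at hj
    exact mul_nonneg (hp.nonneg j (by omega) hj.2) (hA j k h1 hj.1 hj.2)
  · exact Finset.mem_Icc.2 ⟨le_rfl, hk⟩

/-- The truncated sums over `j ≤ m < n` remain bounded for nonnegative increments. -/
theorem sum_mul_sum_le (hp : IsComplementary A n p)
    (hA : ∀ j k, 1 ≤ k → k ≤ j → j ≤ n → 0 ≤ A j k) {m : ℕ} (hm : m ≤ n) {d : ℕ → ℝ}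
    (hd : ∀ k, 1 ≤ k → k ≤ m → 0 ≤ d k) :
    ∑ j ∈ Finset.Icc 1 m, p j * ∑ k ∈ Finset.Icc 1 j, A j k * d k
      ≤ ∑ k ∈ Finset.Icc 1 m, d k := by
  simp_rw [Finset.mul_sum]
  rw [sum_Icc_triangle (fun j k => p j * (A j k * d k))]
  apply Finset.sum_le_sum
  intro k hk
  rw [Finset.mem_Icc] at hk
  simp_rw [← mul_assoc]
  rw [← Finset.sum_mul]
  apply mul_le_of_le_one_left (hd k hk.1 hk.2)
  rw [← hp.sum_eq_one k hk.1 (hk.2.trans hm)]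
  apply Finset.sum_le_sum_of_subset_of_nonneg (Finset.Icc_subset_Icc_right hm)
  intro j hj _
  rw [Finset.mem_Icc] at hj
  exact mul_nonneg (hp.nonneg j (by omega) hj.2) (hA j k hk.1 hj.1 hj.2)

/-- Exchanging the order of summation, the sum over `j` of the weighted increments
`A j (k + 1) - A j k` collapses to the diagonal term `p k * A k k`. -/
theorem sum_mul_sum_sub (hp : IsComplementary A n p) (hn : 1 ≤ n) (g : ℕ → ℝ) :
    ∑ j ∈ Finset.Icc 1 n, p j * ∑ k ∈ Finset.Ico 1 j, (A j (k + 1) - A j k) * g k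
      = (∑ k ∈ Finset.Icc 1 n, p k * A k k * g k) - p n * A n n * g n := by
  have h : ∀ k, 1 ≤ k → k < n →
      ∑ j ∈ Finset.Ioc k n, p j * (A j (k + 1) - A j k) = p k * A k k := by
    intro k h1 hk
    have e1 := hp.sum_eq_one (k + 1) (by omega) hk
    have e2 := hp.sum_eq_one k h1 hk.le
    rw [← Finset.add_sum_Ioc_eq_sum_Icc hk.le] at e2
    have e3 : Finset.Icc (k + 1) n = Finset.Ioc k n := by ext; simp
    rw [e3] at e1
    simp_rw [mul_sub]
    rw [Finset.sum_sub_distrib, e1]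
    linarith
  simp_rw [Finset.mul_sum]
  have e : ∑ j ∈ Finset.Icc 1 n, ∑ k ∈ Finset.Ico 1 j, p j * ((A j (k + 1) - A j k) * g k)
      = ∑ k ∈ Finset.Ico 1 n, ∑ j ∈ Finset.Ioc k n, p j * ((A j (k + 1) - A j k) * g k) := by
    apply Finset.sum_comm'
    intro j k
    simp only [Finset.mem_Icc, Finset.mem_Ico, Finset.mem_Ioc]
    omega
  rw [e]
  rw [← Finset.sum_Ico_add_eq_sum_Icc hn, add_sub_cancel_right]
  apply Finset.sum_congr rfl
  intro k hk
  rw [Finset.mem_Ico] at hk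
  simp_rw [← mul_assoc]
  rw [← Finset.sum_mul, h k hk.1 hk.2]

end IsComplementary

/-! ### Fractional Grönwall inequality -/

section complementary

variable {T α ρ : ℝ} {N : ℕ} {t : ℕ → ℝ}

theorem IsTimeMesh.l1Kernel_nonneg (ht : IsTimeMesh T N t) (h0 : 0 < α) (h1 : α < 1) {n : ℕ}
    (hn : n ≤ N) : ∀ j k, 1 ≤ k → k ≤ j → j ≤ n → 0 ≤ l1Kernel α t j k :=
  fun _ _ h2 h3 h4 => (l1Kernel_pos ht h0 h1 h2 h3 (h4.trans hn)).le

theorem IsTimeMesh.exists_complementary (ht : IsTimeMesh T N t) (h0 : 0 < α) (h1 : α < 1) {n : ℕ}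
    (hn : n ≤ N) : ∃ p, IsComplementary (l1Kernel α t) n p :=
  exists_isComplementary (fun _ h2 h3 => l1Kernel_pos ht h0 h1 h2 le_rfl (h3.trans hn))
    (fun _ _ h2 h3 h4 => l1Kernel_mono ht h0 h1 h2 h3 (h4.trans hn))

/-- Integral of the convolution kernel over one step, as an L1 coefficient. -/
theorem integral_eq_l1Kernel_mul (ht : IsTimeMesh T N t) {k n : ℕ} (hk : 1 ≤ k) (hkN : k ≤ N) :
    ∫ s in (t (k - 1))..(t k), omegaKernel (1 - α) (t n - s)
      = l1Kernel α t n k * stepSize t k := by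
  unfold l1Kernel
  rw [div_mul_cancel₀ _ (ht.stepSize_pos hk hkN).ne']

theorem omegaKernel_convolution_intervalIntegrable (ht : IsTimeMesh T N t) (h1 : α < 1)
    {β : ℝ} (hβ : 0 < β) {k n : ℕ} (hk : 1 ≤ k) (hkn : k ≤ n) (hn : n ≤ N) :
    IntervalIntegrable (fun s => omegaKernel (1 - α) (t n - s) * omegaKernel β s) volume
      (t (k - 1)) (t k) := by
  have h := (intervalIntegrable_omegaKernel_mul_rpow (a := 1 - α) (by linarith) hβ
    (ht.pos (hk.trans hkn) hn)).div_const (Real.Gamma β)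
  have h2 : IntervalIntegrable (fun s => omegaKernel (1 - α) (t n - s) * omegaKernel β s) volume
      0 (t n) := h.congr fun s _ => by simp only [omegaKernel]; ring
  apply h2.mono_set
  rw [uIcc_of_le (ht.nonneg hn), uIcc_of_le (ht.pred_lt hk (hkn.trans hn)).le]
  exact Icc_subset_Icc (ht.nonneg (by omega)) (ht.le hkn hn)

theorem omegaKernel_eq_sum_integral (ht : IsTimeMesh T N t) (h1 : α < 1)
    {β : ℝ} (hβ : 0 < β) {n : ℕ} (hn1 : 1 ≤ n) (hn : n ≤ N) :
    omegaKernel (1 - α + β) (t n) = ∑ k ∈ Finset.Icc 1 n,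
      ∫ s in (t (k - 1))..(t k), omegaKernel (1 - α) (t n - s) * omegaKernel β s := by
  rw [sum_integral_mesh (fun k hk hkn =>
    omegaKernel_convolution_intervalIntegrable ht h1 hβ hk hkn hn), ht.zero,
    integral_omegaKernel_mul_omegaKernel (by linarith) hβ (ht.pos hn1 hn)]

theorem omegaKernel_zero {β : ℝ} (hβ : 0 < β) : omegaKernel (β + 1) 0 = 0 := by
  unfold omegaKernel
  rw [add_sub_cancel_right, Real.zero_rpow hβ.ne', zero_div]

/-- The L1 formula overestimates the Caputo derivative of the concave power `ω_{1+β}`. -/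
theorem omegaKernel_le_l1Caputo (ht : IsTimeMesh T N t) (h0 : 0 < α) (h1 : α < 1)
    {β : ℝ} (hβ : 0 < β) (hβ1 : β ≤ 1) {n : ℕ} (hn1 : 1 ≤ n) (hn : n ≤ N) :
    omegaKernel (1 - α + β) (t n) ≤ ∑ k ∈ Finset.Icc 1 n, l1Kernel α t n k *
      (omegaKernel (β + 1) (t k) - omegaKernel (β + 1) (t (k - 1))) := by
  rw [omegaKernel_eq_sum_integral ht h1 hβ hn1 hn]
  apply Finset.sum_le_sum
  intro k hk
  rw [Finset.mem_Icc] at hk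
  have hlt := ht.pred_lt hk.1 (hk.2.trans hn)
  have hkn := ht.le hk.2 hn
  have h0k := ht.nonneg (k := k - 1) (by omega)
  have h := integral_mul_le_of_monotoneOn_antitoneOn hlt
    (f := fun s => omegaKernel (1 - α) (t n - s)) (g := omegaKernel β)
    (fun x hx y hy hxy => omegaKernel_antitone (by linarith) (by linarith) (by linarith [hy.2])
      (by linarith))
    (fun x hx y hy hxy => omegaKernel_antitone hβ hβ1 (by linarith [hx.1]) hxy)
    (omegaKernel_sub_intervalIntegrable (by linarith) _ _ _)
    (omegaKernel_intervalIntegrable hβ _ _)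
    (omegaKernel_convolution_intervalIntegrable ht h1 hβ hk.1 hk.2 hn)
  rw [integral_omegaKernel hβ, integral_eq_l1Kernel_mul ht hk.1 (hk.2.trans hn)] at h
  have hτ := ht.stepSize_pos hk.1 (hk.2.trans hn)
  change stepSize t k * _ ≤ _ at h
  rw [mul_comm (l1Kernel α t n k), mul_assoc] at h
  exact le_of_mul_le_mul_left h hτ

/-- For the convex powers the Caputo derivative is bounded by the L1 formula applied to the
increments over the following steps, at the price of the step ratio. -/
theorem omegaKernel_le_shifted_l1Caputo (ht : IsTimeMesh T N t) (hρ : StepRatioBound N t ρ)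
    (h0 : 0 < α) (h1 : α < 1) {β : ℝ} (hβ : 1 ≤ β) {n : ℕ} (hn1 : 1 ≤ n) (hn : n + 1 ≤ N) :
    omegaKernel (1 - α + β) (t n) ≤ ∑ k ∈ Finset.Icc 1 n, l1Kernel α t n k *
      (ρ * (omegaKernel (β + 1) (t (k + 1)) - omegaKernel (β + 1) (t k))) := by
  have hβ0 : 0 < β := by linarith
  rw [omegaKernel_eq_sum_integral ht h1 hβ0 hn1 (by omega)]
  apply Finset.sum_le_sum
  intro k hk
  rw [Finset.mem_Icc] at hk
  have hlt := ht.pred_lt hk.1 (by omega : k ≤ N)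
  have hkn := ht.le hk.2 (by omega : n ≤ N)
  have h0k := ht.nonneg (k := k - 1) (by omega)
  have hk0 : 0 < t k := ht.pos hk.1 (by omega)
  have hA := l1Kernel_pos ht h0 h1 hk.1 hk.2 (by omega)
  have e1 : ∫ s in (t (k - 1))..(t k), omegaKernel (1 - α) (t n - s) * omegaKernel β s
      ≤ ∫ s in (t (k - 1))..(t k), omegaKernel (1 - α) (t n - s) * omegaKernel β (t k) := by
    apply intervalIntegral.integral_mono_on hlt.le
      (omegaKernel_convolution_intervalIntegrable ht h1 hβ0 hk.1 hk.2 (by omega))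
      ((omegaKernel_sub_intervalIntegrable (by linarith) _ _ _).mul_const _)
    intro s hs
    exact mul_le_mul_of_nonneg_left (omegaKernel_monotone hβ (by linarith [hs.1]) hs.2)
      (omegaKernel_nonneg (by linarith) (by linarith [hs.2]))
  rw [intervalIntegral.integral_mul_const, integral_eq_l1Kernel_mul ht hk.1 (by omega), mul_assoc]
    at e1
  refine e1.trans (mul_le_mul_of_nonneg_left ?_ hA.le)
  have hτ' := ht.stepSize_pos (k := k + 1) (by omega) (by omega)
  have e2 : stepSize t k ≤ ρ * stepSize t (k + 1) := by
    have := hρ k hk.1 (by omega)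
    rwa [div_le_iff₀ hτ'] at this
  have hlt' := ht.pred_lt (k := k + 1) (by omega) (by omega)
  rw [Nat.add_sub_cancel] at hlt'
  have e3 : stepSize t (k + 1) * omegaKernel β (t k)
      ≤ omegaKernel (β + 1) (t (k + 1)) - omegaKernel (β + 1) (t k) := by
    rw [← integral_omegaKernel hβ0]
    have := intervalIntegral.integral_mono_on (μ := volume) hlt'.le
      (f := fun _ => omegaKernel β (t k)) (by simp)
      (omegaKernel_intervalIntegrable hβ0 (t k) (t (k + 1)))
      (fun s hs => omegaKernel_monotone hβ hk0.le hs.1)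
    rwa [intervalIntegral.integral_const, smul_eq_mul] at this
  have hρ0 : 0 < ρ := by
    have := ht.stepSize_pos hk.1 (by omega : k ≤ N)
    by_contra hc
    nlinarith
  calc stepSize t k * omegaKernel β (t k) ≤ ρ * stepSize t (k + 1) * omegaKernel β (t k) :=
        mul_le_mul_of_nonneg_right e2 (omegaKernel_nonneg hβ0 hk0.le)
    _ ≤ _ := by rw [mul_assoc]; exact mul_le_mul_of_nonneg_left e3 hρ0.le

/-- The complementary kernel acts on `ω_{1-α+β}`, `β ≤ 1`, like the fractional integral. -/
theorem IsComplementary.sum_omegaKernel_le {p : ℕ → ℝ} {n : ℕ} (ht : IsTimeMesh T N t)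
    (h0 : 0 < α) (h1 : α < 1) (hp : IsComplementary (l1Kernel α t) n p) (hn : n ≤ N)
    {β : ℝ} (hβ : 0 < β) (hβ1 : β ≤ 1) :
    ∑ j ∈ Finset.Icc 1 n, p j * omegaKernel (1 - α + β) (t j) ≤ omegaKernel (β + 1) (t n) := by
  have e := hp.sum_mul_sum (fun k => omegaKernel (β + 1) (t k) - omegaKernel (β + 1) (t (k - 1)))
  rw [sum_Icc_sub_pred (fun k => omegaKernel (β + 1) (t k)), ht.zero, omegaKernel_zero hβ,
    sub_zero] at e
  rw [← e]
  apply Finset.sum_le_sum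
  intro j hj
  rw [Finset.mem_Icc] at hj
  exact mul_le_mul_of_nonneg_left
    (omegaKernel_le_l1Caputo ht h0 h1 hβ hβ1 hj.1 (hj.2.trans hn)) (hp.nonneg j hj.1 hj.2)

/-- For all `β > 0` the complementary kernel, without its diagonal weight, acts on `ω_{1-α+β}` like
the fractional integral up to the factor `max 1 ρ`. For `β ≥ 1` the L1 formula need not dominate the
Caputo derivative of the convex power; shifting the increments by one step costs the ratio `ρ` and
is the reason for leaving out `j = n`. -/
theorem IsComplementary.sum_Icc_pred_omegaKernel_le {p : ℕ → ℝ} {n : ℕ} (ht : IsTimeMesh T N t)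
    (hρ : StepRatioBound N t ρ) (hρ0 : 0 < ρ) (h0 : 0 < α) (h1 : α < 1)
    (hp : IsComplementary (l1Kernel α t) n p) (hn1 : 1 ≤ n) (hn : n ≤ N) {β : ℝ} (hβ : 0 < β) :
    ∑ j ∈ Finset.Icc 1 (n - 1), p j * omegaKernel (1 - α + β) (t j)
      ≤ max 1 ρ * omegaKernel (β + 1) (t n) := by
  have hA := ht.l1Kernel_nonneg h0 h1 hn
  have hpos : 0 ≤ omegaKernel (β + 1) (t n) := omegaKernel_nonneg (by linarith) (ht.nonneg hn)
  rcases le_total β 1 with hβ1 | hβ1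
  · have h := hp.sum_omegaKernel_le ht h0 h1 hn hβ hβ1
    have h2 : ∑ j ∈ Finset.Icc 1 (n - 1), p j * omegaKernel (1 - α + β) (t j)
        ≤ ∑ j ∈ Finset.Icc 1 n, p j * omegaKernel (1 - α + β) (t j) := by
      apply Finset.sum_le_sum_of_subset_of_nonneg (Finset.Icc_subset_Icc_right (by omega))
      intro j hj _
      rw [Finset.mem_Icc] at hj
      exact mul_nonneg (hp.nonneg j hj.1 hj.2)
        (omegaKernel_nonneg (by linarith) (ht.nonneg (hj.2.trans hn)))
    exact h2.trans (h.trans (le_mul_of_one_le_left hpos (le_max_left _ _)))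
  · set d : ℕ → ℝ := fun k => ρ * (omegaKernel (β + 1) (t (k + 1)) - omegaKernel (β + 1) (t k))
    have hd : ∀ k, 1 ≤ k → k ≤ n - 1 → 0 ≤ d k := fun k hk hkn =>
      mul_nonneg hρ0.le (sub_nonneg.2 (omegaKernel_monotone (by linarith)
        (ht.nonneg (by omega)) (ht.le (by omega) (by omega))))
    have h := hp.sum_mul_sum_le hA (m := n - 1) (by omega) hd
    have h2 : ∑ k ∈ Finset.Icc 1 (n - 1), d k
        = ρ * (omegaKernel (β + 1) (t n) - omegaKernel (β + 1) (t 1)) := by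
      have h3 := sum_Icc_sub_pred (fun k => ρ * omegaKernel (β + 1) (t (k + 1))) (n - 1)
      rw [Nat.sub_add_cancel hn1] at h3
      rw [mul_sub, ← h3]
      apply Finset.sum_congr rfl
      intro k hk
      rw [Finset.mem_Icc] at hk
      simp only [d, Nat.sub_add_cancel hk.1]
      ring
    have h4 : 0 ≤ omegaKernel (β + 1) (t 1) :=
      omegaKernel_nonneg (by linarith) (ht.nonneg (by omega))
    calc ∑ j ∈ Finset.Icc 1 (n - 1), p j * omegaKernel (1 - α + β) (t j)
        ≤ ∑ j ∈ Finset.Icc 1 (n - 1), p j * ∑ k ∈ Finset.Icc 1 j, l1Kernel α t j k * d k := by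
          apply Finset.sum_le_sum
          intro j hj
          rw [Finset.mem_Icc] at hj
          exact mul_le_mul_of_nonneg_left
            (omegaKernel_le_shifted_l1Caputo ht hρ h0 h1 hβ1 hj.1 (by omega))
            (hp.nonneg j hj.1 (by omega))
      _ ≤ ∑ k ∈ Finset.Icc 1 (n - 1), d k := h
      _ ≤ ρ * omegaKernel (β + 1) (t n) := by rw [h2]; nlinarith
      _ ≤ _ := mul_le_mul_of_nonneg_right (le_max_right _ _) hpos

/-- The Mittag-Leffler function is a supersolution of the discrete Volterra inequality: each term of
its series is mapped below the next one. -/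
theorem IsComplementary.sum_mittagLeffler_le {p : ℕ → ℝ} {n : ℕ} (ht : IsTimeMesh T N t)
    (hρ : StepRatioBound N t ρ) (hρ0 : 0 < ρ) (h0 : 0 < α) (h1 : α < 1)
    (hp : IsComplementary (l1Kernel α t) n p) (hn1 : 1 ≤ n) (hn : n ≤ N) {l : ℝ} (hl : 0 ≤ l) :
    2 * l * ∑ j ∈ Finset.Icc 1 (n - 1), p j * mittagLeffler α (2 * max 1 ρ * l * t j ^ α)
      ≤ mittagLeffler α (2 * max 1 ρ * l * t n ^ α) - 1 := by
  set Λ := 2 * max 1 ρ * l with hΛdef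
  have hmax : 0 < max 1 ρ := lt_max_of_lt_left one_pos
  have hΛ : 0 ≤ Λ := by positivity
  have e1 : ∀ j ∈ Finset.Icc 1 (n - 1), p j * mittagLeffler α (Λ * t j ^ α)
      = ∑' k : ℕ, p j * (Λ ^ k * omegaKernel (1 + (k : ℝ) * α) (t j)) := by
    intro j hj
    rw [Finset.mem_Icc] at hj
    rw [mittagLeffler_eq_tsum (ht.nonneg (by omega)), tsum_mul_left]
  have hs : ∀ j ∈ Finset.Icc 1 (n - 1),
      Summable fun k : ℕ => p j * (Λ ^ k * omegaKernel (1 + (k : ℝ) * α) (t j)) := by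
    intro j hj
    rw [Finset.mem_Icc] at hj
    exact (summable_omegaKernel h0 hΛ (ht.nonneg (by omega))).mul_left _
  have hsn := summable_omegaKernel h0 hΛ (ht.nonneg hn)
  have e0 : Λ ^ 0 * omegaKernel (1 + ((0 : ℕ) : ℝ) * α) (t n) = 1 := by
    simp [omegaKernel]
  rw [Finset.sum_congr rfl e1, ← Summable.tsum_finsetSum hs, ← tsum_mul_left,
    mittagLeffler_eq_tsum (ht.nonneg hn), hsn.tsum_eq_zero_add, e0, add_sub_cancel_left]
  refine Summable.tsum_le_tsum (fun k => ?_) ((summable_sum hs).mul_left _)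
    ((summable_nat_add_iff 1).2 hsn)
  have h := hp.sum_Icc_pred_omegaKernel_le ht hρ hρ0 h0 h1 hn1 hn (β := α + k * α) (by positivity)
  rw [show 1 - α + (α + k * α) = 1 + k * α by ring] at h
  have e2 : ∑ j ∈ Finset.Icc 1 (n - 1), p j * (Λ ^ k * omegaKernel (1 + (k : ℝ) * α) (t j))
      = Λ ^ k * ∑ j ∈ Finset.Icc 1 (n - 1), p j * omegaKernel (1 + (k : ℝ) * α) (t j) := by
    rw [Finset.mul_sum]
    exact Finset.sum_congr rfl fun j _ => by ring
  rw [e2, show (1 : ℝ) + ((k + 1 : ℕ) : ℝ) * α = α + k * α + 1 by push_cast; ring, pow_succ]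
  calc 2 * l * (Λ ^ k * ∑ j ∈ Finset.Icc 1 (n - 1), p j * omegaKernel (1 + (k : ℝ) * α) (t j))
      = 2 * l * Λ ^ k * ∑ j ∈ Finset.Icc 1 (n - 1), p j * omegaKernel (1 + (k : ℝ) * α) (t j) := by
        ring
    _ ≤ 2 * l * Λ ^ k * (max 1 ρ * omegaKernel (α + k * α + 1) (t n)) :=
        mul_le_mul_of_nonneg_left h (by positivity)
    _ = _ := by rw [hΛdef]; ring

end complementary

/-- Discrete Grönwall inequality in abstract form: `E` is a supersolution of the Volterra inequality
defined by the complementary kernels. The right-hand side is quadratic in `v`, but the conclusion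
is linear: only levels at which `v` attains a new maximum larger than `S` matter, and there the
summed inequality may be divided by `v m`. -/
theorem discrete_fractional_gronwall {A : ℕ → ℕ → ℝ} {n : ℕ} {p : ℕ → ℕ → ℝ} {v ξ E : ℕ → ℝ}
    {l η S Ξ : ℝ}
    (hp : ∀ m, 1 ≤ m → m ≤ n → IsComplementary A m (p m))
    (hv : ∀ m, m ≤ n → 0 ≤ v m) (hv0 : v 0 = 0)
    (hl : 0 ≤ l) (hS : 0 ≤ S) (hΞ : 0 ≤ Ξ)
    (hineq : ∀ m, 1 ≤ m → m ≤ n → ∑ k ∈ Finset.Icc 1 m, A m k * (v k ^ 2 - v (k - 1) ^ 2)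
      ≤ l * v m ^ 2 + 2 * v m * ξ m + η ^ 2)
    (hξ : ∀ m, 1 ≤ m → m ≤ n → 0 ≤ ξ m)
    (hdiag : ∀ m, 1 ≤ m → m ≤ n → l * p m m ≤ 1 / 2)
    (hpξ : ∀ m, 1 ≤ m → m ≤ n → ∑ j ∈ Finset.Icc 1 m, p m j * ξ j ≤ Ξ)
    (hpη : ∀ m, 1 ≤ m → m ≤ n → (∑ j ∈ Finset.Icc 1 m, p m j) * η ^ 2 ≤ S ^ 2)
    (hE1 : ∀ m, 1 ≤ m → m ≤ n → 1 ≤ E m)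
    (hEmono : ∀ j m, 1 ≤ j → j ≤ m → m ≤ n → E j ≤ E m)
    (hE : ∀ m, 1 ≤ m → m ≤ n → 2 * l * ∑ j ∈ Finset.Icc 1 (m - 1), p m j * E j ≤ E m - 1) :
    ∀ m, 1 ≤ m → m ≤ n → v m ≤ E m * (4 * Ξ + 2 * S) := by
  intro m
  induction m using Nat.strong_induction_on with
  | _ m ih =>
  intro h1 hmn
  set q := 4 * Ξ + 2 * S with hq
  have hq0 : 0 ≤ q := by positivity
  have hEq : q ≤ E m * q := le_mul_of_one_le_left hq0 (hE1 m h1 hmn)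
  -- if `v m` is not a new maximum, or is at most `S`, the bound is inherited or trivial
  by_cases hex : ∃ j < m, v m ≤ v j
  · obtain ⟨j, hj, hvj⟩ := hex
    rcases Nat.eq_zero_or_pos j with rfl | hj0
    · linarith
    · exact hvj.trans ((ih j hj hj0 (by omega)).trans
        (mul_le_mul_of_nonneg_right (hEmono j m hj0 hj.le hmn) hq0))
  push Not at hex
  rcases le_or_gt (v m) S with hvS | hvS
  · linarith
  have hvm : 0 < v m := hS.trans_lt hvS
  have hpm := hp m h1 hmn
  -- the complementary kernel inverts the discrete derivative of `v ^ 2`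
  have hinv : v m ^ 2 ≤ ∑ j ∈ Finset.Icc 1 m, p m j * (l * v j ^ 2 + 2 * v j * ξ j + η ^ 2) := by
    have e := hpm.sum_mul_sum (fun k => v k ^ 2 - v (k - 1) ^ 2)
    rw [sum_Icc_sub_pred (fun k => v k ^ 2), hv0] at e
    have : v m ^ 2 = v m ^ 2 - 0 ^ 2 := by ring
    rw [this, ← e]
    apply Finset.sum_le_sum
    intro j hj
    rw [Finset.mem_Icc] at hj
    exact mul_le_mul_of_nonneg_left (hineq j hj.1 (hj.2.trans hmn)) (hpm.nonneg j hj.1 hj.2)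
  have hle : ∀ j, j ≤ m → v j ≤ v m := fun j hj => by
    rcases hj.eq_or_lt with rfl | h
    · exact le_rfl
    · exact (hex j h).le
  have hb1 : ∑ j ∈ Finset.Icc 1 m, p m j * (2 * v j * ξ j) ≤ 2 * v m * Ξ := by
    calc ∑ j ∈ Finset.Icc 1 m, p m j * (2 * v j * ξ j)
        ≤ ∑ j ∈ Finset.Icc 1 m, 2 * v m * (p m j * ξ j) := by
          apply Finset.sum_le_sum
          intro j hj
          rw [Finset.mem_Icc] at hj
          have := mul_le_mul_of_nonneg_left (hle j hj.2)
            (mul_nonneg (hpm.nonneg j hj.1 hj.2) (hξ j hj.1 (by omega)))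
          nlinarith
      _ ≤ _ := by
          rw [← Finset.mul_sum]
          exact mul_le_mul_of_nonneg_left (hpξ m h1 hmn) (by positivity)
  have hb2 : ∑ j ∈ Finset.Icc 1 m, p m j * η ^ 2 ≤ v m * S := by
    rw [← Finset.sum_mul]
    have := hpη m h1 hmn
    nlinarith
  have hb3 : ∑ j ∈ Finset.Icc 1 m, p m j * (l * v j ^ 2)
      ≤ v m * (l * ∑ j ∈ Finset.Icc 1 (m - 1), p m j * (E j * q)) + v m ^ 2 / 2 := by
    have hsplit : Finset.Icc 1 m = insert m (Finset.Icc 1 (m - 1)) := by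
      ext j; simp only [Finset.mem_insert, Finset.mem_Icc]; omega
    rw [hsplit, Finset.sum_insert (by simp; omega)]
    have e1 : p m m * (l * v m ^ 2) ≤ v m ^ 2 / 2 := by
      have := mul_le_mul_of_nonneg_right (hdiag m h1 hmn) (sq_nonneg (v m))
      linarith
    have e2 : ∑ j ∈ Finset.Icc 1 (m - 1), p m j * (l * v j ^ 2)
        ≤ v m * (l * ∑ j ∈ Finset.Icc 1 (m - 1), p m j * (E j * q)) := by
      rw [Finset.mul_sum, Finset.mul_sum]
      apply Finset.sum_le_sum
      intro j hj
      rw [Finset.mem_Icc] at hj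
      have a1 := ih j (by omega) hj.1 (by omega)
      have a2 := hle j (by omega)
      have a3 := hv j (by omega)
      have a4 := hpm.nonneg j hj.1 (by omega)
      have a5 : v j ^ 2 ≤ v m * (E j * q) := by
        rw [sq]; exact mul_le_mul a2 a1 a3 hvm.le
      calc p m j * (l * v j ^ 2) ≤ p m j * (l * (v m * (E j * q))) := by gcongr
        _ = _ := by ring
    linarith
  have hsum : v m ^ 2 ≤ v m * (l * ∑ j ∈ Finset.Icc 1 (m - 1), p m j * (E j * q)) + v m ^ 2 / 2
      + 2 * v m * Ξ + v m * S := by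
    simp only [mul_add, Finset.sum_add_distrib] at hinv
    linarith
  have hdiv : v m ≤ l * ∑ j ∈ Finset.Icc 1 (m - 1), p m j * (E j * q) + v m / 2 + 2 * Ξ + S := by
    apply le_of_mul_le_mul_left _ hvm
    linarith
  have hEm := mul_le_mul_of_nonneg_right (hE m h1 hmn) hq0
  have e3 : ∑ j ∈ Finset.Icc 1 (m - 1), p m j * (E j * q)
      = (∑ j ∈ Finset.Icc 1 (m - 1), p m j * E j) * q := by
    rw [Finset.sum_mul]; exact Finset.sum_congr rfl fun j _ => by ring
  rw [e3] at hdiv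
  linarith

/-! ### Truncation error of the L1 formula -/

/-- An antiderivative of `1 + s ^ (σ - 2)`, the admissible growth of the second derivative. -/
def growthPrimitive (σ s : ℝ) : ℝ := s + s ^ (σ - 1) / (σ - 1)

/-- `v` is continuous on `[0,T]` with a derivative `v'` on `(0,T)` that extends continuously to
`(0,T]` and oscillates no faster than an integral of `B (1 + s ^ (σ - 2))`. This is what the bound
`|v''(s)| ≤ B (1 + s ^ (σ - 2))` is used for. -/
structure WeaklySingular (T σ B : ℝ) (v v' : ℝ → ℝ) : Prop where
  continuousOn : ContinuousOn v (Icc 0 T)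
  hasDerivAt : ∀ s ∈ Ioo 0 T, HasDerivAt v (v' s) s
  continuousOn_deriv : ContinuousOn v' (Ioc 0 T)
  osc : ∀ s r, 0 < s → s ≤ r → r ≤ T →
    |v' r - v' s| ≤ B * (growthPrimitive σ r - growthPrimitive σ s)

/-- By Fubini, the quantity `2 ∫_a^b (s - a)(1 + s ^ (σ - 2)) ds`, which measures the error of
replacing a derivative on `(a,b)` by the difference quotient. The definition avoids the singularity
of `s ^ (σ - 2)` at `a = 0`. -/
def meanDefect (σ a b : ℝ) : ℝ := 2 * ∫ s in a..b, (growthPrimitive σ b - growthPrimitive σ s)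

section growth

variable {σ : ℝ}

theorem hasDerivAt_growthPrimitive (hσ1 : σ ≠ 1) {s : ℝ} (hs : 0 < s) :
    HasDerivAt (growthPrimitive σ) (1 + s ^ (σ - 2)) s := by
  have h := (hasDerivAt_id s).add ((Real.hasDerivAt_rpow_const (x := s) (p := σ - 1)
    (Or.inl hs.ne')).div_const (σ - 1))
  have hne : σ - 1 ≠ 0 := sub_ne_zero.2 hσ1
  convert! h using 1
  rw [show σ - 1 - 1 = σ - 2 by ring]
  field_simp

theorem growthPrimitive_mono (hσ1 : σ ≠ 1) {s r : ℝ} (hs : 0 < s) (hsr : s ≤ r) :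
    growthPrimitive σ s ≤ growthPrimitive σ r := by
  have h : MonotoneOn (growthPrimitive σ) (Ioi 0) := by
    apply monotoneOn_of_deriv_nonneg (convex_Ioi 0)
    · exact fun x hx => (hasDerivAt_growthPrimitive hσ1 hx).continuousAt.continuousWithinAt
    · rw [interior_Ioi]
      exact fun x hx =>
        (hasDerivAt_growthPrimitive hσ1 hx).differentiableAt.differentiableWithinAt
    · rw [interior_Ioi]
      intro x hx
      rw [(hasDerivAt_growthPrimitive hσ1 hx).deriv]
      have := Real.rpow_nonneg (le_of_lt hx) (σ - 2)
      linarith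
  exact h hs (hs.trans_le hsr) hsr

theorem growthPrimitive_intervalIntegrable (hσ : 0 < σ) (a b : ℝ) :
    IntervalIntegrable (growthPrimitive σ) volume a b :=
  (continuous_id.intervalIntegrable a b).add
    ((intervalIntegral.intervalIntegrable_rpow' (by linarith)).div_const _)

theorem growthPrimitive_sub_intervalIntegrable (hσ : 0 < σ) (a b c : ℝ) :
    IntervalIntegrable (fun s => growthPrimitive σ c - growthPrimitive σ s) volume a b :=
  intervalIntegrable_const.sub (growthPrimitive_intervalIntegrable hσ a b)

theorem meanDefect_nonneg (hσ1 : σ ≠ 1) {a b : ℝ} (ha : 0 ≤ a) (hab : a ≤ b) :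
    0 ≤ meanDefect σ a b := by
  unfold meanDefect
  rw [intervalIntegral.integral_of_le hab]
  apply mul_nonneg zero_le_two
  apply setIntegral_nonneg measurableSet_Ioc
  intro s hs
  exact sub_nonneg.2 (growthPrimitive_mono hσ1 (ha.trans_lt hs.1) hs.2)

theorem meanDefect_zero_left (hσ : 0 < σ) (hσ1 : σ ≠ 1) {b : ℝ} (hb : 0 < b) :
    meanDefect σ 0 b = b ^ 2 + 2 * (b ^ σ / σ) := by
  have hne : σ - 1 ≠ 0 := sub_ne_zero.2 hσ1
  have e : ∫ s in (0 : ℝ)..b, growthPrimitive σ s = b ^ 2 / 2 + b ^ σ / σ / (σ - 1) := by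
    unfold growthPrimitive
    rw [intervalIntegral.integral_add (intervalIntegral.intervalIntegrable_id)
      ((intervalIntegral.intervalIntegrable_rpow' (by linarith)).div_const _), integral_id,
      intervalIntegral.integral_div, integral_rpow (Or.inl (by linarith)), sub_add_cancel,
      Real.zero_rpow hσ.ne']
    ring
  unfold meanDefect
  rw [intervalIntegral.integral_sub intervalIntegrable_const
    (growthPrimitive_intervalIntegrable hσ 0 b), e, intervalIntegral.integral_const, smul_eq_mul]
  unfold growthPrimitive
  have hb' : b ^ σ = b ^ (σ - 1) * b := by
    rw [← Real.rpow_add_one hb.ne', sub_add_cancel]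
  rw [hb']
  field_simp
  ring

theorem meanDefect_le (hσ : 0 < σ) (hσ2 : σ < 2) (hσ1 : σ ≠ 1) {a b : ℝ} (ha : 0 < a)
    (hab : a < b) : meanDefect σ a b ≤ 2 * ((b - a) ^ 2 * (1 + a ^ (σ - 2))) := by
  unfold meanDefect
  have hpt : ∀ s ∈ Icc a b,
      growthPrimitive σ b - growthPrimitive σ s ≤ (b - a) * (1 + a ^ (σ - 2)) := by
    intro s hs
    have hpos : 0 ≤ 1 + a ^ (σ - 2) := by positivity
    have h := Convex.image_sub_le_mul_sub_of_deriv_le (convex_Icc a b)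
      (f := growthPrimitive σ) (C := 1 + a ^ (σ - 2))
      (fun x hx => (hasDerivAt_growthPrimitive hσ1
        (ha.trans_le hx.1)).continuousAt.continuousWithinAt)
      (by
        rw [interior_Icc]
        exact fun x hx => (hasDerivAt_growthPrimitive hσ1
          (ha.trans hx.1)).differentiableAt.differentiableWithinAt)
      (by
        rw [interior_Icc]
        intro x hx
        rw [(hasDerivAt_growthPrimitive hσ1 (ha.trans hx.1)).deriv]
        have := Real.rpow_le_rpow_of_nonpos ha hx.1.le (by linarith : σ - 2 ≤ 0)
        linarith)
      s hs b (right_mem_Icc.2 hab.le) hs.2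
    refine h.trans ?_
    rw [mul_comm]
    exact mul_le_mul_of_nonneg_right (by linarith [hs.1]) hpos
  have h := intervalIntegral.integral_mono_on hab.le
    (growthPrimitive_sub_intervalIntegrable hσ a b b) intervalIntegrable_const hpt
  rw [intervalIntegral.integral_const, smul_eq_mul] at h
  nlinarith

end growth

namespace WeaklySingular

variable {T σ B α : ℝ} {v v' : ℝ → ℝ}

theorem intervalIntegrable_kernel_growth (h1 : α < 1) (hσ : 0 < σ) {c : ℝ} (hc : 0 < c) (b : ℝ) :
    IntervalIntegrable (fun s => omegaKernel (1 - α) (c - s) *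
      (growthPrimitive σ b - growthPrimitive σ s)) volume 0 c := by
  have i1 := omegaKernel_sub_intervalIntegrable (β := 1 - α) (by linarith) 0 c c
  have i2 := intervalIntegrable_omegaKernel_mul_rpow (a := 1 - α) (by linarith) hσ hc
  have i3 := i1.mul_continuousOn (continuous_id.continuousOn (s := uIcc 0 c))
  refine (((i1.mul_const (growthPrimitive σ b)).sub i3).sub (i2.div_const (σ - 1))).congr ?_
  intro s _
  simp only [growthPrimitive, id]
  ring

theorem abs_deriv_le (h : WeaklySingular T σ B v v') {s r : ℝ} (hs : 0 < s) (hsr : s ≤ r)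
    (hr : r ≤ T) :
    |v' s| ≤ |v' r| + B * (growthPrimitive σ r - growthPrimitive σ s) := by
  have h1 := h.osc s r hs hsr hr
  have h2 := abs_sub_abs_le_abs_sub (v' s) (v' r)
  rw [abs_sub_comm] at h2
  linarith

theorem intervalIntegrable_deriv (h : WeaklySingular T σ B v v') (hσ : 0 < σ) {c : ℝ}
    (hc : 0 < c) (hcT : c ≤ T) : IntervalIntegrable v' volume 0 c := by
  have hm : AEStronglyMeasurable v' (volume.restrict (Ioc 0 c)) :=
    (h.continuousOn_deriv.mono (Ioc_subset_Ioc_right hcT)).aestronglyMeasurable measurableSet_Ioc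
  have hd : IntervalIntegrable (fun s => |v' c| +
      B * (growthPrimitive σ c - growthPrimitive σ s)) volume 0 c :=
    intervalIntegrable_const.add ((growthPrimitive_sub_intervalIntegrable hσ 0 c c).const_mul B)
  rw [intervalIntegrable_iff_integrableOn_Ioc_of_le hc.le] at hd ⊢
  refine Integrable.mono' hd hm ?_
  filter_upwards [ae_restrict_mem measurableSet_Ioc] with s hs
  exact h.abs_deriv_le hs.1 hs.2 hcT

theorem intervalIntegrable_kernel_deriv (h : WeaklySingular T σ B v v') (h1 : α < 1)
    (hσ : 0 < σ) {c : ℝ} (hc : 0 < c) (hcT : c ≤ T) :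
    IntervalIntegrable (fun s => omegaKernel (1 - α) (c - s) * v' s) volume 0 c := by
  have i1 := omegaKernel_sub_intervalIntegrable (β := 1 - α) (by linarith) 0 c c
  have hd : IntervalIntegrable (fun s => omegaKernel (1 - α) (c - s) * |v' c| +
      B * (omegaKernel (1 - α) (c - s) * (growthPrimitive σ c - growthPrimitive σ s)))
      volume 0 c :=
    (i1.mul_const _).add ((intervalIntegrable_kernel_growth h1 hσ hc c).const_mul B)
  rw [intervalIntegrable_iff_integrableOn_Ioc_of_le hc.le] at hd i1 ⊢
  refine Integrable.mono' hd (i1.aestronglyMeasurable.mul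
    ((h.continuousOn_deriv.mono (Ioc_subset_Ioc_right hcT)).aestronglyMeasurable
      measurableSet_Ioc)) ?_
  filter_upwards [ae_restrict_mem measurableSet_Ioc] with s hs
  have hω := omegaKernel_nonneg (β := 1 - α) (by linarith) (sub_nonneg.2 hs.2)
  rw [norm_mul, Real.norm_of_nonneg hω, Real.norm_eq_abs]
  have := mul_le_mul_of_nonneg_left (h.abs_deriv_le hs.1 hs.2 hcT) hω
  linarith

theorem caputo_eq (h : WeaklySingular T σ B v v') {c : ℝ}
    (hc : 0 < c) (hcT : c ≤ T) :
    caputo α v c = ∫ s in (0 : ℝ)..c, omegaKernel (1 - α) (c - s) * v' s := by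
  unfold caputo
  rw [intervalIntegral.integral_of_le hc.le, intervalIntegral.integral_of_le hc.le,
    integral_Ioc_eq_integral_Ioo, integral_Ioc_eq_integral_Ioo]
  apply setIntegral_congr_fun measurableSet_Ioo
  intro s hs
  simp only
  rw [(h.hasDerivAt s ⟨hs.1, hs.2.trans_le hcT⟩).deriv]

theorem integral_deriv (h : WeaklySingular T σ B v v') (hσ : 0 < σ) {a b : ℝ} (ha : 0 ≤ a)
    (hab : a < b) (hb : b ≤ T) : ∫ s in a..b, v' s = v b - v a := by
  apply intervalIntegral.integral_eq_sub_of_hasDerivAt_of_le hab.le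
    (h.continuousOn.mono (Icc_subset_Icc ha hb))
    (fun s hs => h.hasDerivAt s ⟨ha.trans_lt hs.1, hs.2.trans_le hb⟩)
  apply (h.intervalIntegrable_deriv hσ (ha.trans_lt hab) hb).mono_set
  rw [uIcc_of_le hab.le, uIcc_of_le (ha.trans hab.le)]
  exact Icc_subset_Icc_left ha

/-- The deviation of the derivative at the right end point from the mean slope. -/
theorem abs_deriv_sub_slope_le (h : WeaklySingular T σ B v v') (hσ : 0 < σ) {a b : ℝ}
    (ha : 0 ≤ a) (hab : a < b) (hb : b ≤ T) :
    |v' b - (v b - v a) / (b - a)| * (b - a) ≤ B * (meanDefect σ a b / 2) := by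
  have hba : 0 < b - a := sub_pos.2 hab
  have hsub : uIcc a b ⊆ uIcc 0 b := by
    rw [uIcc_of_le hab.le, uIcc_of_le (ha.trans hab.le)]; exact Icc_subset_Icc_left ha
  have i1 := (h.intervalIntegrable_deriv hσ (ha.trans_lt hab) hb).mono_set hsub
  have e : (v' b - (v b - v a) / (b - a)) * (b - a) = ∫ s in a..b, (v' b - v' s) := by
    rw [intervalIntegral.integral_sub intervalIntegrable_const i1, h.integral_deriv hσ ha hab hb,
      intervalIntegral.integral_const, smul_eq_mul]
    field_simp
  rw [← abs_of_pos hba, ← abs_mul, abs_of_pos hba, e, meanDefect,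
    mul_div_cancel_left₀ _ two_ne_zero,
    ← intervalIntegral.integral_const_mul, ← Real.norm_eq_abs]
  apply intervalIntegral.norm_integral_le_of_norm_le hab.le
  · filter_upwards with s hs
    exact h.osc s b (ha.trans_lt hs.1) hs.2 hb
  · exact (growthPrimitive_sub_intervalIntegrable hσ a b b).const_mul B

/-- Local truncation error over the last step, where the kernel is singular. The kernel increases
and the deviation of the derivative from its value at `b` decreases, so that Chebyshev's inequality
separates them. -/
theorem abs_integral_kernel_sub_le_last (h : WeaklySingular T σ B v v') (hB : 0 ≤ B)
    (h0 : 0 < α) (h1 : α < 1) (hσ : 0 < σ) (hσ1 : σ ≠ 1) {a b : ℝ} (ha : 0 ≤ a) (hab : a < b)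
    (hb : b ≤ T) :
    |(∫ s in a..b, omegaKernel (1 - α) (b - s) * v' s)
        - (∫ s in a..b, omegaKernel (1 - α) (b - s)) / (b - a) * (v b - v a)|
      ≤ (∫ s in a..b, omegaKernel (1 - α) (b - s)) / (b - a) * (B * meanDefect σ a b) := by
  have hba : 0 < b - a := sub_pos.2 hab
  have hb0 : 0 < b := ha.trans_lt hab
  have hsub : uIcc a b ⊆ uIcc 0 b := by
    rw [uIcc_of_le hab.le, uIcc_of_le (ha.trans hab.le)]; exact Icc_subset_Icc_left ha
  set w : ℝ → ℝ := fun s => omegaKernel (1 - α) (b - s)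
  set m := (v b - v a) / (b - a) with hm
  set δ := |v' b - m|
  have iw : IntervalIntegrable w volume a b :=
    omegaKernel_sub_intervalIntegrable (by linarith) a b b
  have iwv : IntervalIntegrable (fun s => w s * v' s) volume a b :=
    (h.intervalIntegrable_kernel_deriv h1 hσ hb0 hb).mono_set hsub
  have iwh : IntervalIntegrable (fun s => w s * (growthPrimitive σ b - growthPrimitive σ s))
      volume a b := (intervalIntegrable_kernel_growth h1 hσ hb0 b).mono_set hsub
  have e : (∫ s in a..b, w s * v' s) - (∫ s in a..b, w s) / (b - a) * (v b - v a)
      = ∫ s in a..b, (w s * v' s - w s * m) := by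
    rw [intervalIntegral.integral_sub iwv (iw.mul_const m), intervalIntegral.integral_mul_const, hm]
    ring
  have hcheb := integral_mul_le_of_monotoneOn_antitoneOn hab (f := w)
    (g := fun s => growthPrimitive σ b - growthPrimitive σ s)
    (fun x hx y hy hxy => omegaKernel_antitone (by linarith) (by linarith) (by linarith [hy.2])
      (by linarith))
    (fun x hx y hy hxy => sub_le_sub_left (growthPrimitive_mono hσ1 (ha.trans_lt hx.1) hxy) _)
    iw (growthPrimitive_sub_intervalIntegrable hσ a b b) iwh
  have hδ := h.abs_deriv_sub_slope_le hσ ha hab hb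
  have hw0 : 0 ≤ ∫ s in a..b, w s := by
    rw [intervalIntegral.integral_of_le hab.le]
    exact setIntegral_nonneg measurableSet_Ioc fun s hs =>
      omegaKernel_nonneg (by linarith) (by linarith [hs.2])
  have hnorm : |∫ s in a..b, (w s * v' s - w s * m)|
      ≤ ∫ s in a..b, (B * (w s * (growthPrimitive σ b - growthPrimitive σ s)) + w s * δ) := by
    rw [← Real.norm_eq_abs]
    apply intervalIntegral.norm_integral_le_of_norm_le hab.le
    · filter_upwards with s hs
      have hω : 0 ≤ w s := omegaKernel_nonneg (by linarith) (sub_nonneg.2 hs.2)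
      have h3 := h.osc s b (ha.trans_lt hs.1) hs.2 hb
      have h4 : |v' s - m| ≤ B * (growthPrimitive σ b - growthPrimitive σ s) + δ := by
        have := abs_sub_le (v' s) (v' b) m
        rw [abs_sub_comm (v' s) (v' b)] at this
        linarith
      rw [← mul_sub, norm_mul, Real.norm_of_nonneg hω, Real.norm_eq_abs]
      nlinarith
    · exact (iwh.const_mul B).add (iw.mul_const δ)
  rw [intervalIntegral.integral_add (iwh.const_mul B) (iw.mul_const δ),
    intervalIntegral.integral_const_mul, intervalIntegral.integral_mul_const] at hnorm
  rw [e]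
  refine hnorm.trans ?_
  rw [div_mul_eq_mul_div, le_div_iff₀ hba]
  have h5 := mul_le_mul_of_nonneg_left hcheb hB
  have h6 := mul_le_mul_of_nonneg_left hδ hw0
  have h7 : meanDefect σ a b
      = 2 * ∫ s in a..b, (growthPrimitive σ b - growthPrimitive σ s) := rfl
  rw [h7] at h6 ⊢
  linarith

/-- Local truncation error over an earlier step: constants may be subtracted from the kernel, so
that only its oscillation enters. -/
theorem abs_integral_kernel_sub_le (h : WeaklySingular T σ B v v')
    (h0 : 0 < α) (h1 : α < 1) (hσ : 0 < σ) {a b c : ℝ} (ha : 0 ≤ a)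
    (hab : a < b) (hbc : b < c) (hc : c ≤ T) :
    |(∫ s in a..b, omegaKernel (1 - α) (c - s) * v' s)
        - (∫ s in a..b, omegaKernel (1 - α) (c - s)) / (b - a) * (v b - v a)|
      ≤ (omegaKernel (1 - α) (c - b) - omegaKernel (1 - α) (c - a)) * (B * meanDefect σ a b) := by
  have hba : 0 < b - a := sub_pos.2 hab
  have hb0 : 0 < b := ha.trans_lt hab
  have hb : b ≤ T := hbc.le.trans hc
  have hsub : uIcc a b ⊆ uIcc 0 c := by
    rw [uIcc_of_le hab.le, uIcc_of_le (hb0.le.trans hbc.le)]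
    exact Icc_subset_Icc ha hbc.le
  have hsub' : uIcc a b ⊆ uIcc 0 b := by
    rw [uIcc_of_le hab.le, uIcc_of_le (ha.trans hab.le)]; exact Icc_subset_Icc_left ha
  set w : ℝ → ℝ := fun s => omegaKernel (1 - α) (c - s)
  set m := (v b - v a) / (b - a) with hm
  set δ := |v' b - m|
  have iw : IntervalIntegrable w volume a b :=
    omegaKernel_sub_intervalIntegrable (by linarith) a b c
  have iwv : IntervalIntegrable (fun s => w s * v' s) volume a b :=
    (h.intervalIntegrable_kernel_deriv h1 hσ (hb0.trans hbc) hc).mono_set hsub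
  have iv : IntervalIntegrable v' volume a b :=
    (h.intervalIntegrable_deriv hσ hb0 hb).mono_set hsub'
  have ih := growthPrimitive_sub_intervalIntegrable hσ a b b
  have e : (∫ s in a..b, w s * v' s) - (∫ s in a..b, w s) / (b - a) * (v b - v a)
      = ∫ s in a..b, (w s * v' s - w s * m - (w a * v' s - w a * m)) := by
    rw [intervalIntegral.integral_sub (iwv.sub (iw.mul_const m))
        ((iv.const_mul (w a)).sub intervalIntegrable_const),
      intervalIntegral.integral_sub iwv (iw.mul_const m), intervalIntegral.integral_mul_const,
      intervalIntegral.integral_sub (iv.const_mul (w a)) intervalIntegrable_const,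
      intervalIntegral.integral_const_mul, h.integral_deriv hσ ha hab hb,
      intervalIntegral.integral_const, smul_eq_mul, hm]
    field_simp
    ring
  have hδ := h.abs_deriv_sub_slope_le hσ ha hab hb
  have hosc : 0 ≤ w b - w a := sub_nonneg.2
    (omegaKernel_antitone (by linarith) (by linarith) (by linarith) (by linarith))
  have hnorm : |∫ s in a..b, (w s * v' s - w s * m - (w a * v' s - w a * m))|
      ≤ ∫ s in a..b, (w b - w a) * (B * (growthPrimitive σ b - growthPrimitive σ s) + δ) := by
    rw [← Real.norm_eq_abs]
    apply intervalIntegral.norm_integral_le_of_norm_le hab.le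
    · filter_upwards with s hs
      have hω : 0 ≤ w s - w a := sub_nonneg.2 (omegaKernel_antitone (by linarith) (by linarith)
        (by linarith [hs.2]) (by linarith [hs.1]))
      have hω2 : w s ≤ w b := omegaKernel_antitone (by linarith) (by linarith)
        (by linarith [hs.2]) (by linarith [hs.2])
      have h3 := h.osc s b (ha.trans_lt hs.1) hs.2 hb
      have h4 : |v' s - m| ≤ B * (growthPrimitive σ b - growthPrimitive σ s) + δ := by
        have := abs_sub_le (v' s) (v' b) m
        rw [abs_sub_comm (v' s) (v' b)] at this
        linarith
      rw [show w s * v' s - w s * m - (w a * v' s - w a * m) = (w s - w a) * (v' s - m) by ring,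
        norm_mul, Real.norm_of_nonneg hω, Real.norm_eq_abs]
      exact mul_le_mul (by linarith) h4 (abs_nonneg _) hosc
    · exact ((ih.const_mul B).add intervalIntegrable_const).const_mul _
  rw [intervalIntegral.integral_const_mul,
    intervalIntegral.integral_add (ih.const_mul B) intervalIntegrable_const,
    intervalIntegral.integral_const_mul, intervalIntegral.integral_const, smul_eq_mul] at hnorm
  rw [e]
  refine hnorm.trans (mul_le_mul_of_nonneg_left ?_ hosc)
  have h7 : meanDefect σ a b
      = 2 * ∫ s in a..b, (growthPrimitive σ b - growthPrimitive σ s) := rfl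
  rw [h7] at hδ ⊢
  linarith

end WeaklySingular

/-- Bound for the truncation error of the L1 formula at the time level `n`, for unit `B`. It is
written in the L1 coefficients themselves, so that it can be summed exactly against the
complementary kernel. -/
def truncationBound (α σ : ℝ) (t : ℕ → ℝ) (n : ℕ) : ℝ :=
  l1Kernel α t n n * meanDefect σ (t (n - 1)) (t n)
    + 2 * ∑ k ∈ Finset.Ico 1 n, (l1Kernel α t n (k + 1) - l1Kernel α t n k)
      * meanDefect σ (t (k - 1)) (t k)

section truncation

variable {T σ B α : ℝ} {v v' : ℝ → ℝ} {N : ℕ} {t : ℕ → ℝ}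

theorem truncationBound_nonneg (ht : IsTimeMesh T N t) (h0 : 0 < α) (h1 : α < 1) (hσ1 : σ ≠ 1)
    {n : ℕ} (hn1 : 1 ≤ n) (hn : n ≤ N) : 0 ≤ truncationBound α σ t n := by
  have hd : ∀ k, 1 ≤ k → k ≤ n → 0 ≤ meanDefect σ (t (k - 1)) (t k) := fun k h2 h3 =>
    meanDefect_nonneg hσ1 (ht.nonneg (by omega)) (ht.pred_lt h2 (h3.trans hn)).le
  unfold truncationBound
  apply add_nonneg (mul_nonneg (l1Kernel_pos ht h0 h1 hn1 le_rfl hn).le (hd n hn1 le_rfl))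
  refine mul_nonneg zero_le_two (Finset.sum_nonneg fun k hk => ?_)
  rw [Finset.mem_Ico] at hk
  exact mul_nonneg (sub_nonneg.2 (l1Kernel_mono ht h0 h1 hk.1 hk.2 hn)) (hd k hk.1 hk.2.le)

theorem WeaklySingular.abs_caputo_sub_l1Caputo_le (h : WeaklySingular T σ B v v') (hB : 0 ≤ B)
    (ht : IsTimeMesh T N t) (h0 : 0 < α) (h1 : α < 1) (hσ : 0 < σ) (hσ1 : σ ≠ 1)
    {n : ℕ} (hn1 : 1 ≤ n) (hn : n ≤ N) :
    |caputo α v (t n) - l1Caputo α t (fun k => v (t k)) n| ≤ B * truncationBound α σ t n := by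
  have htn := ht.pos hn1 hn
  have htT := ht.le_last hn
  have hint : ∀ k, 1 ≤ k → k ≤ n →
      IntervalIntegrable (fun s => omegaKernel (1 - α) (t n - s) * v' s) volume
        (t (k - 1)) (t k) := by
    intro k hk hkn
    apply (h.intervalIntegrable_kernel_deriv h1 hσ htn htT).mono_set
    rw [uIcc_of_le htn.le, uIcc_of_le (ht.pred_lt hk (hkn.trans hn)).le]
    exact Icc_subset_Icc (ht.nonneg (by omega)) (ht.le hkn hn)
  have e1 : caputo α v (t n) = ∑ k ∈ Finset.Icc 1 n,
      ∫ s in (t (k - 1))..(t k), omegaKernel (1 - α) (t n - s) * v' s := by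
    rw [sum_integral_mesh hint, ht.zero, h.caputo_eq htn htT]
  rw [e1, l1Caputo, ← Finset.sum_sub_distrib]
  refine (Finset.abs_sum_le_sum_abs _ _).trans ?_
  have hsplit : Finset.Icc 1 n = insert n (Finset.Ico 1 n) := by
    ext j; simp only [Finset.mem_insert, Finset.mem_Icc, Finset.mem_Ico]; omega
  rw [hsplit, Finset.sum_insert (by simp), truncationBound, mul_add]
  apply add_le_add
  · have := h.abs_integral_kernel_sub_le_last hB h0 h1 hσ hσ1 (ht.nonneg (k := n - 1) (by omega))
      (ht.pred_lt hn1 hn) htT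
    refine this.trans (le_of_eq ?_)
    rw [l1Kernel, stepSize]
    ring
  · rw [← mul_assoc, Finset.mul_sum]
    apply Finset.sum_le_sum
    intro k hk
    rw [Finset.mem_Ico] at hk
    have h2 := h.abs_integral_kernel_sub_le h0 h1 hσ (ht.nonneg (k := k - 1) (by omega))
      (ht.pred_lt hk.1 (by omega)) (ht.lt hk.2 hn) htT
    refine h2.trans ?_
    have h3 := omegaKernel_sub_le_l1Kernel_sub ht h0 h1 hk.1 hk.2 hn
    have h4 : 0 ≤ B * meanDefect σ (t (k - 1)) (t k) := mul_nonneg hB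
      (meanDefect_nonneg hσ1 (ht.nonneg (by omega)) (ht.pred_lt hk.1 (by omega)).le)
    have h5 := mul_le_mul_of_nonneg_right h3 h4
    linarith

/-- Summed against the complementary kernel, the history part of the truncation error reduces to
the local defects on the diagonal. -/
theorem IsComplementary.sum_truncationBound_le {p : ℕ → ℝ} {n : ℕ} (ht : IsTimeMesh T N t)
    (h0 : 0 < α) (h1 : α < 1) (hσ1 : σ ≠ 1) (hp : IsComplementary (l1Kernel α t) n p)
    (hn1 : 1 ≤ n) (hn : n ≤ N) :
    ∑ j ∈ Finset.Icc 1 n, p j * truncationBound α σ t j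
      ≤ 3 * ∑ k ∈ Finset.Icc 1 n, p k * l1Kernel α t k k * meanDefect σ (t (k - 1)) (t k) := by
  have e := hp.sum_mul_sum_sub hn1 (fun k => meanDefect σ (t (k - 1)) (t k))
  have hlast : 0 ≤ p n * l1Kernel α t n n * meanDefect σ (t (n - 1)) (t n) :=
    mul_nonneg (mul_nonneg (hp.nonneg n hn1 le_rfl) (l1Kernel_pos ht h0 h1 hn1 le_rfl hn).le)
      (meanDefect_nonneg hσ1 (ht.nonneg (by omega)) (ht.pred_lt hn1 hn).le)
  have e2 : ∑ j ∈ Finset.Icc 1 n, p j * truncationBound α σ t j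
      = ∑ k ∈ Finset.Icc 1 n, p k * l1Kernel α t k k * meanDefect σ (t (k - 1)) (t k)
        + 2 * ∑ j ∈ Finset.Icc 1 n, p j * ∑ k ∈ Finset.Ico 1 j,
          (l1Kernel α t j (k + 1) - l1Kernel α t j k) * meanDefect σ (t (k - 1)) (t k) := by
    rw [Finset.mul_sum, ← Finset.sum_add_distrib]
    apply Finset.sum_congr rfl
    intro j _
    rw [truncationBound]
    ring
  rw [e2, e]
  linarith

end truncation

/-! ### Global consistency on graded meshes -/

section globalConsistency

variable {T σ α γ Cγ : ℝ} {N : ℕ} {t : ℕ → ℝ}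

theorem rpow_le_max_one_rpow {x L p q : ℝ} (hx : 0 ≤ x) (hxL : x ≤ L) (hp : 0 ≤ p) (hpq : p ≤ q) :
    x ^ p ≤ max 1 L ^ q :=
  (Real.rpow_le_rpow hx (hxL.trans (le_max_right 1 L)) hp).trans
    (Real.rpow_le_rpow_of_exponent_le (le_max_left _ _) hpq)

theorem GradedMesh.stepSize_le (hg : GradedMesh N t γ Cγ) (ht : IsTimeMesh T N t) (hC : 0 < Cγ)
    {k : ℕ} (h1 : 1 ≤ k) (hk : k ≤ N) :
    stepSize t k ≤ Cγ * maxStep N t * t k ^ (1 - 1 / γ) :=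
  (hg.step_le k h1 hk).trans
    (mul_le_mul_of_nonneg_left (min_le_right _ _) (mul_pos hC ht.maxStep_pos).le)

/-- On a graded mesh the first step resolves the initial singularity. -/
theorem GradedMesh.first_node_rpow_le (hg : GradedMesh N t γ Cγ) (ht : IsTimeMesh T N t)
    (hγ : 1 ≤ γ) (hC : 0 < Cγ) (hσ : 0 < σ) (hσ2 : σ < 2) {β : ℝ} (hβγ : β ≤ γ * σ)
    (hβ : 0 ≤ β) :
    t 1 ^ σ ≤ max 1 Cγ ^ (2 * γ) * max 1 T ^ (2 * γ) * maxStep N t ^ β := by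
  have hγ0 : 0 < γ := by linarith
  have ht1 : 0 < t 1 := ht.pos le_rfl ht.one_le
  have hτ := ht.maxStep_pos
  have h := hg.stepSize_le ht hC le_rfl ht.one_le
  have h2 : stepSize t 1 = t 1 := by simp [stepSize, ht.zero]
  have h3 : t 1 ^ (1 / γ) ≤ Cγ * maxStep N t := by
    have e : t 1 ^ (1 / γ) * t 1 ^ (1 - 1 / γ) = t 1 := by
      rw [← Real.rpow_add ht1]; simp
    rw [h2] at h
    have hp : 0 < t 1 ^ (1 - 1 / γ) := Real.rpow_pos_of_pos ht1 _
    apply le_of_mul_le_mul_right _ hp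
    rw [e]; exact h
  have h4 : t 1 ^ σ = (t 1 ^ (1 / γ)) ^ (γ * σ) := by
    rw [← Real.rpow_mul ht1.le]; congr 1; field_simp
  have hγσ : γ * σ ≤ 2 * γ := by nlinarith
  have hγσ0 : 0 < γ * σ := by positivity
  calc t 1 ^ σ ≤ (Cγ * maxStep N t) ^ (γ * σ) := by
        rw [h4]
        exact Real.rpow_le_rpow (Real.rpow_nonneg ht1.le _) h3 hγσ0.le
    _ = Cγ ^ (γ * σ) * (maxStep N t ^ (γ * σ - β) * maxStep N t ^ β) := by
        rw [Real.mul_rpow hC.le hτ.le, ← Real.rpow_add hτ, sub_add_cancel]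
    _ ≤ max 1 Cγ ^ (2 * γ) * (max 1 T ^ (2 * γ) * maxStep N t ^ β) := by
        have b1 := rpow_le_max_one_rpow hC.le le_rfl hγσ0.le hγσ
        have b2 : maxStep N t ^ (γ * σ - β) ≤ max 1 T ^ (2 * γ) :=
          rpow_le_max_one_rpow hτ.le ht.maxStep_le (by linarith) (by linarith)
        have b3 : 0 ≤ maxStep N t ^ β := Real.rpow_nonneg hτ.le _
        gcongr
    _ = _ := by ring

/-- On a graded mesh the local steps balance the growth of the second derivative. -/
theorem GradedMesh.stepSize_rpow_le (hg : GradedMesh N t γ Cγ) (ht : IsTimeMesh T N t)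
    (hγ : 1 ≤ γ) (hC : 0 < Cγ) (h0 : 0 < α) (h1 : α < 1) (hσ2 : σ < 2) {β : ℝ}
    (hβγ : β ≤ γ * σ) (hβα : β ≤ 2 - α) (hβ : 0 ≤ β) {k : ℕ} (hk : 1 ≤ k) (hkN : k ≤ N) :
    stepSize t k ^ (2 - α) * t k ^ (σ - 2)
      ≤ max 1 Cγ ^ (2 : ℝ) * max 1 T ^ (2 : ℝ) * maxStep N t ^ β * t k ^ (-α) := by
  have hγ0 : 0 < γ := by linarith
  have htk : 0 < t k := ht.pos hk hkN
  have hτk := ht.stepSize_pos hk hkN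
  have hτ := ht.maxStep_pos
  have hle : stepSize t k ≤ t k := by
    have := ht.nonneg (k := k - 1) (by omega)
    simp only [stepSize]; linarith
  have h := hg.stepSize_le ht hC hk hkN
  have hβ' : β / γ ≤ σ := by rw [div_le_iff₀ hγ0]; linarith
  have hβ0 : 0 ≤ β / γ := by positivity
  calc stepSize t k ^ (2 - α) * t k ^ (σ - 2)
      = stepSize t k ^ β * stepSize t k ^ (2 - α - β) * t k ^ (σ - 2) := by
        rw [← Real.rpow_add hτk]; ring_nf
    _ ≤ (Cγ * maxStep N t * t k ^ (1 - 1 / γ)) ^ β * t k ^ (2 - α - β) * t k ^ (σ - 2) := by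
        gcongr
    _ = Cγ ^ β * maxStep N t ^ β * t k ^ (σ - β / γ) * t k ^ (-α) := by
        rw [Real.mul_rpow (by positivity) (by positivity), Real.mul_rpow hC.le hτ.le,
          ← Real.rpow_mul htk.le]
        have e : t k ^ ((1 - 1 / γ) * β) * t k ^ (2 - α - β) * t k ^ (σ - 2)
            = t k ^ (σ - β / γ) * t k ^ (-α) := by
          rw [← Real.rpow_add htk, ← Real.rpow_add htk, ← Real.rpow_add htk]
          congr 1
          field_simp
          ring
        linear_combination Cγ ^ β * maxStep N t ^ β * e
    _ ≤ max 1 Cγ ^ (2 : ℝ) * maxStep N t ^ β * max 1 T ^ (2 : ℝ) * t k ^ (-α) := by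
        have b1 := rpow_le_max_one_rpow hC.le le_rfl hβ (by linarith : β ≤ 2)
        have b2 : t k ^ (σ - β / γ) ≤ max 1 T ^ (2 : ℝ) :=
          rpow_le_max_one_rpow htk.le (ht.le_last hkN) (by linarith) (by linarith)
        gcongr
    _ = _ := by ring

/-- Away from the first step the defect is that of a smooth function, as `t_{k-1}` and `t_k` are
comparable. -/
theorem GradedMesh.meanDefect_le (hg : GradedMesh N t γ Cγ) (ht : IsTimeMesh T N t)
    (hσ : 0 < σ) (hσ2 : σ < 2) (hσ1 : σ ≠ 1) (hC : 0 < Cγ) {k : ℕ} (hk : 2 ≤ k) (hkN : k ≤ N) :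
    meanDefect σ (t (k - 1)) (t k)
      ≤ 2 * (max 1 T ^ (2 : ℝ) + max 1 Cγ ^ (2 : ℝ)) * (stepSize t k ^ 2 * t k ^ (σ - 2)) := by
  have htk : 0 < t k := ht.pos (by omega) hkN
  have htk1 : 0 < t (k - 1) := ht.pos (by omega) (by omega)
  have h := _root_.meanDefect_le hσ hσ2 hσ1 htk1 (ht.pred_lt (by omega) hkN)
  have e1 : 1 ≤ max 1 T ^ (2 : ℝ) * t k ^ (σ - 2) := by
    have b : t k ^ (2 - σ) ≤ max 1 T ^ (2 : ℝ) :=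
      rpow_le_max_one_rpow htk.le (ht.le_last hkN) (by linarith) (by linarith)
    calc (1 : ℝ) = t k ^ (2 - σ) * t k ^ (σ - 2) := by rw [← Real.rpow_add htk]; simp
      _ ≤ _ := by gcongr
  have e2 : t (k - 1) ^ (σ - 2) ≤ max 1 Cγ ^ (2 : ℝ) * t k ^ (σ - 2) := by
    have hn := hg.node_le k hk hkN
    have h3 : t k / Cγ ≤ t (k - 1) := by rw [div_le_iff₀ hC]; linarith
    calc t (k - 1) ^ (σ - 2) ≤ (t k / Cγ) ^ (σ - 2) :=
          Real.rpow_le_rpow_of_nonpos (by positivity) h3 (by linarith)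
      _ = Cγ ^ (2 - σ) * t k ^ (σ - 2) := by
          rw [Real.div_rpow htk.le hC.le, div_eq_mul_inv, ← Real.rpow_neg hC.le, neg_sub, mul_comm]
      _ ≤ _ := by
          have := rpow_le_max_one_rpow hC.le le_rfl (by linarith : 0 ≤ 2 - σ)
            (by linarith : 2 - σ ≤ 2)
          gcongr
  refine h.trans ?_
  change 2 * (stepSize t k ^ 2 * (1 + t (k - 1) ^ (σ - 2))) ≤ _
  have h5 : 0 ≤ 2 * stepSize t k ^ 2 := by positivity
  nlinarith [mul_le_mul_of_nonneg_left (add_le_add e1 e2) h5]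

/-- The constant in the global consistency estimate. -/
def consistencyConst (T γ Cγ : ℝ) : ℝ :=
  6 * (max 1 T ^ (2 : ℝ) + 1) * (max 1 Cγ ^ (2 * γ) * max 1 T ^ (2 * γ))
    + 12 * (max 1 T ^ (2 : ℝ) + max 1 Cγ ^ (2 : ℝ)) * (max 1 Cγ ^ (2 : ℝ) * max 1 T ^ (2 : ℝ))

theorem consistencyConst_pos (T γ Cγ : ℝ) : 0 < consistencyConst T γ Cγ := by
  have h1 : 0 < max 1 T := lt_max_of_lt_left one_pos
  have h2 : 0 < max 1 Cγ := lt_max_of_lt_left one_pos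
  unfold consistencyConst
  positivity

/-- The weights of the complementary kernel are summable against `ω_{1-α}`. -/
theorem IsComplementary.sum_omegaKernel_le_one {p : ℕ → ℝ} {n : ℕ} (ht : IsTimeMesh T N t)
    (h0 : 0 < α) (h1 : α < 1) (hp : IsComplementary (l1Kernel α t) n p) (hn1 : 1 ≤ n)
    (hn : n ≤ N) : ∑ j ∈ Finset.Icc 1 n, p j * omegaKernel (1 - α) (t j) ≤ 1 := by
  refine le_trans (Finset.sum_le_sum ?_) (hp.sum_eq_one 1 le_rfl hn1).le
  intro j hj
  rw [Finset.mem_Icc] at hj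
  have h := l1Kernel_lower ht h0 h1 le_rfl hj.1 (hj.2.trans hn)
  rw [Nat.sub_self, ht.zero, sub_zero] at h
  exact mul_le_mul_of_nonneg_left h (hp.nonneg j hj.1 hj.2)

/-- Global consistency of the L1 formula on graded meshes. The first step is estimated by
`p_1 A_{11} ≤ 1` and causes the factor `1 / σ`; on the later steps `p_k A_{kk}` is traded for
`p_k ω_{1-α}(t_k)`, whose sum is at most one, at the price of `Γ(1-α) / Γ(2-α) = 1 / (1-α)`. -/
theorem IsComplementary.sum_truncationBound_le_rpow {p : ℕ → ℝ} {n : ℕ} (ht : IsTimeMesh T N t)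
    (hg : GradedMesh N t γ Cγ) (hγ : 1 ≤ γ) (hC : 0 < Cγ) (h0 : 0 < α) (h1 : α < 1)
    (hσ : 0 < σ) (hσ2 : σ < 2) (hσ1 : σ ≠ 1) (hp : IsComplementary (l1Kernel α t) n p)
    (hn1 : 1 ≤ n) (hn : n ≤ N) :
    ∑ j ∈ Finset.Icc 1 n, p j * truncationBound α σ t j
      ≤ consistencyConst T γ Cγ / (σ * (1 - α)) * maxStep N t ^ min (2 - α) (γ * σ) := by
  set β := min (2 - α) (γ * σ)
  have hβα : β ≤ 2 - α := min_le_left _ _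
  have hβγ : β ≤ γ * σ := min_le_right _ _
  have hβ : 0 ≤ β := le_min (by linarith) (by positivity)
  have hτ := ht.maxStep_pos
  set L := max 1 T
  set c := max 1 Cγ
  have hL1 : 1 ≤ L := le_max_left _ _
  have hL : 0 < L := by linarith
  have hc : 0 < c := lt_max_of_lt_left one_pos
  set τβ := maxStep N t ^ β
  have hτβ : 0 < τβ := Real.rpow_pos_of_pos hτ _
  have h1α : 0 < 1 - α := by linarith
  have ht1 : 0 < t 1 := ht.pos le_rfl ht.one_le
  have hfirst : p 1 * l1Kernel α t 1 1 * meanDefect σ (t (1 - 1)) (t 1)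
      ≤ 2 * (L ^ (2 : ℝ) + 1) * (c ^ (2 * γ) * L ^ (2 * γ)) * τβ / σ := by
    have hd := hp.mul_diag_le (ht.l1Kernel_nonneg h0 h1 hn) le_rfl hn1
    have hm : 0 ≤ meanDefect σ (t (1 - 1)) (t 1) :=
      meanDefect_nonneg hσ1 (ht.nonneg (by omega)) (ht.pred_lt le_rfl ht.one_le).le
    refine (mul_le_of_le_one_left hm hd).trans ?_
    rw [Nat.sub_self, ht.zero, meanDefect_zero_left hσ hσ1 ht1]
    have b1 := hg.first_node_rpow_le ht hγ hC hσ hσ2 hβγ hβ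
    have b2 : t 1 ^ 2 ≤ t 1 ^ σ * L ^ (2 : ℝ) := by
      have : t 1 ^ (2 - σ) ≤ L ^ (2 : ℝ) :=
        rpow_le_max_one_rpow ht1.le (ht.le_last ht.one_le) (by linarith) (by linarith)
      calc t 1 ^ 2 = t 1 ^ σ * t 1 ^ (2 - σ) := by
            rw [← Real.rpow_add ht1, add_sub_cancel, Real.rpow_two]
        _ ≤ _ := by gcongr
    have hp1 : 0 < t 1 ^ σ := Real.rpow_pos_of_pos ht1 _
    have hL2 : 0 < L ^ (2 : ℝ) := Real.rpow_pos_of_pos hL _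
    calc t 1 ^ 2 + 2 * (t 1 ^ σ / σ) ≤ 2 * (L ^ (2 : ℝ) + 1) * t 1 ^ σ / σ := by
          rw [le_div_iff₀ hσ]
          have : 2 * (t 1 ^ σ / σ) * σ = 2 * t 1 ^ σ := by field_simp
          nlinarith [mul_pos hp1 hL2]
      _ ≤ 2 * (L ^ (2 : ℝ) + 1) * (c ^ (2 * γ) * L ^ (2 * γ) * τβ) / σ := by gcongr
      _ = _ := by ring
  have hlater : ∀ k, 2 ≤ k → k ≤ n →
      p k * l1Kernel α t k k * meanDefect σ (t (k - 1)) (t k)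
      ≤ 2 * (L ^ (2 : ℝ) + c ^ (2 : ℝ)) * (c ^ (2 : ℝ) * L ^ (2 : ℝ)) * τβ / (1 - α)
        * (p k * omegaKernel (1 - α) (t k)) := by
    intro k hk hkn
    have hkN := hkn.trans hn
    have hpk := hp.nonneg k (by omega) hkn
    have hτk := ht.stepSize_pos (k := k) (by omega) hkN
    have b1 := hg.meanDefect_le ht hσ hσ2 hσ1 hC hk hkN
    have b2 := hg.stepSize_rpow_le ht hγ hC h0 h1 hσ2 hβγ hβα hβ (k := k) (by omega) hkN
    have hΓ : 0 < Real.Gamma (1 - α) := Real.Gamma_pos_of_pos h1α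
    have hΓ2 : Real.Gamma (2 - α) = (1 - α) * Real.Gamma (1 - α) := by
      rw [← Real.Gamma_add_one h1α.ne']; congr 1; ring
    have e0 : stepSize t k ^ (-α) * stepSize t k ^ 2 = stepSize t k ^ (2 - α) := by
      rw [← Real.rpow_two, ← Real.rpow_add hτk]; congr 1; ring
    have hA : 0 < l1Kernel α t k k := l1Kernel_pos ht h0 h1 (by omega) le_rfl hkN
    calc p k * l1Kernel α t k k * meanDefect σ (t (k - 1)) (t k)
        ≤ p k * l1Kernel α t k k *
          (2 * (L ^ (2 : ℝ) + c ^ (2 : ℝ)) * (stepSize t k ^ 2 * t k ^ (σ - 2))) := by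
          gcongr
      _ = p k / Real.Gamma (2 - α) * (2 * (L ^ (2 : ℝ) + c ^ (2 : ℝ))) *
          (stepSize t k ^ (2 - α) * t k ^ (σ - 2)) := by
          rw [l1Kernel_self ht h1 (by omega) hkN, ← e0]; ring
      _ ≤ p k / Real.Gamma (2 - α) * (2 * (L ^ (2 : ℝ) + c ^ (2 : ℝ))) *
          (c ^ (2 : ℝ) * L ^ (2 : ℝ) * τβ * t k ^ (-α)) := by
          have : 0 ≤ p k / Real.Gamma (2 - α) :=
            div_nonneg hpk (Real.Gamma_pos_of_pos (by linarith)).le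
          gcongr
      _ = _ := by
          rw [hΓ2, omegaKernel, show 1 - α - 1 = -α by ring]
          field_simp
  set Q := 2 * (L ^ (2 : ℝ) + c ^ (2 : ℝ)) * (c ^ (2 : ℝ) * L ^ (2 : ℝ)) * τβ / (1 - α) with hQ
  have hQ0 : 0 ≤ Q := by positivity
  have hsum : ∑ k ∈ Finset.Icc 1 n, p k * l1Kernel α t k k * meanDefect σ (t (k - 1)) (t k)
      ≤ 2 * (L ^ (2 : ℝ) + 1) * (c ^ (2 * γ) * L ^ (2 * γ)) * τβ / σ + Q := by
    rw [← Finset.add_sum_Ioc_eq_sum_Icc hn1]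
    apply add_le_add hfirst
    calc ∑ k ∈ Finset.Ioc 1 n, p k * l1Kernel α t k k * meanDefect σ (t (k - 1)) (t k)
        ≤ ∑ k ∈ Finset.Ioc 1 n, Q * (p k * omegaKernel (1 - α) (t k)) := by
          apply Finset.sum_le_sum
          intro k hk
          rw [Finset.mem_Ioc] at hk
          exact hlater k hk.1 hk.2
      _ ≤ ∑ k ∈ Finset.Icc 1 n, Q * (p k * omegaKernel (1 - α) (t k)) := by
          apply Finset.sum_le_sum_of_subset_of_nonneg Finset.Ioc_subset_Icc_self
          intro j hj _
          rw [Finset.mem_Icc] at hj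
          exact mul_nonneg hQ0 (mul_nonneg (hp.nonneg j hj.1 hj.2)
            (omegaKernel_nonneg h1α (ht.nonneg (hj.2.trans hn))))
      _ ≤ Q := by
          rw [← Finset.mul_sum]
          exact mul_le_of_le_one_right hQ0 (hp.sum_omegaKernel_le_one ht h0 h1 hn1 hn)
  refine (hp.sum_truncationBound_le ht h0 h1 hσ1 hn1 hn).trans ?_
  refine (mul_le_mul_of_nonneg_left hsum (by norm_num)).trans ?_
  have f1 : 2 * (L ^ (2 : ℝ) + 1) * (c ^ (2 * γ) * L ^ (2 * γ)) * τβ / σ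
      ≤ 2 * (L ^ (2 : ℝ) + 1) * (c ^ (2 * γ) * L ^ (2 * γ)) * τβ / (σ * (1 - α)) := by
    apply div_le_div_of_nonneg_left (by positivity) (by positivity)
    nlinarith
  have f2 : Q ≤ 2 * (2 * (L ^ (2 : ℝ) + c ^ (2 : ℝ)) * (c ^ (2 : ℝ) * L ^ (2 : ℝ)) * τβ)
      / (σ * (1 - α)) := by
    rw [hQ, div_le_div_iff₀ h1α (by positivity)]
    have : 0 ≤ 2 * (L ^ (2 : ℝ) + c ^ (2 : ℝ)) * (c ^ (2 : ℝ) * L ^ (2 : ℝ)) * τβ * (1 - α) := by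
      positivity
    nlinarith
  calc 3 * (2 * (L ^ (2 : ℝ) + 1) * (c ^ (2 * γ) * L ^ (2 * γ)) * τβ / σ + Q)
      ≤ 3 * (2 * (L ^ (2 : ℝ) + 1) * (c ^ (2 * γ) * L ^ (2 * γ)) * τβ / (σ * (1 - α))
        + 2 * (2 * (L ^ (2 : ℝ) + c ^ (2 : ℝ)) * (c ^ (2 : ℝ) * L ^ (2 : ℝ)) * τβ)
      / (σ * (1 - α))) := by gcongr
    _ = _ := by unfold consistencyConst; ring

end globalConsistency

/-! ### Sobolev functions on an interval -/

section L2

variable {a b : ℝ}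

theorem L2Space.integrable (w : L2Space a b) : IntegrableOn w (Ioo a b) :=
  (Lp.memLp w).integrable (by norm_num)

theorem L2Space.intervalIntegrable (w : L2Space a b) {x y : ℝ} (hx : x ∈ Icc a b)
    (hy : y ∈ Icc a b) : IntervalIntegrable w volume x y := by
  have hab : a ≤ b := hx.1.trans hx.2
  have h : IntervalIntegrable w volume a b := by
    rw [intervalIntegrable_iff_integrableOn_Ioc_of_le hab, integrableOn_Ioc_iff_integrableOn_Ioo]
    exact w.integrable
  exact h.mono_set (by rw [uIcc_of_le hab]; exact uIcc_subset_Icc hx hy)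

theorem L2Space.intervalIntegrable_sq (w : L2Space a b) {x y : ℝ} (hx : x ∈ Icc a b)
    (hy : y ∈ Icc a b) : IntervalIntegrable (fun s => w s ^ 2) volume x y := by
  have hab : a ≤ b := hx.1.trans hx.2
  have h : IntervalIntegrable (fun s => w s ^ 2) volume a b := by
    rw [intervalIntegrable_iff_integrableOn_Ioc_of_le hab, integrableOn_Ioc_iff_integrableOn_Ioo]
    exact (Lp.memLp w).integrable_sq
  exact h.mono_set (by rw [uIcc_of_le hab]; exact uIcc_subset_Icc hx hy)

theorem L2Space.integral_sq (hab : a ≤ b) (w : L2Space a b) :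
    ∫ s in a..b, w s ^ 2 = ‖w‖ ^ 2 := by
  rw [intervalIntegral.integral_of_le hab, integral_Ioc_eq_integral_Ioo,
    ← real_inner_self_eq_norm_sq, L2.inner_def]
  apply integral_congr_ae
  filter_upwards with s
  simp [sq]

/-- Cauchy–Schwarz on a subinterval. -/
theorem L2Space.sq_integral_abs_le (w : L2Space a b) {x y : ℝ} (hx : x ∈ Icc a b)
    (hy : y ∈ Icc a b) (hxy : x ≤ y) :
    (∫ s in x..y, |w s|) ^ 2 ≤ (y - x) * ∫ s in x..y, w s ^ 2 := by
  have i1 := (w.intervalIntegrable hx hy).abs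
  have i2 := w.intervalIntegrable_sq hx hy
  set I := ∫ s in x..y, |w s|
  set J := ∫ s in x..y, w s ^ 2
  -- the quadratic polynomial `∫ (|w| - r)²` is nonnegative
  have key : ∀ r : ℝ, 0 ≤ J - 2 * r * I + r ^ 2 * (y - x) := by
    intro r
    have e : ∫ s in x..y, (w s ^ 2 - 2 * r * |w s| + r ^ 2) = J - 2 * r * I + r ^ 2 * (y - x) := by
      rw [intervalIntegral.integral_add (i2.sub (i1.const_mul _)) intervalIntegrable_const,
        intervalIntegral.integral_sub i2 (i1.const_mul _), intervalIntegral.integral_const_mul,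
        intervalIntegral.integral_const, smul_eq_mul]
      ring
    rw [← e]
    apply intervalIntegral.integral_nonneg hxy
    intro s _
    nlinarith [sq_nonneg (|w s| - r), sq_abs (w s)]
  rcases hxy.eq_or_lt with h | h
  · have : I = 0 := by simp only [I, h, intervalIntegral.integral_same]
    rw [this, h]; simp
  · have h1 := key (I / (y - x))
    have hyx : 0 < y - x := sub_pos.2 h
    have h2 : J - 2 * (I / (y - x)) * I + (I / (y - x)) ^ 2 * (y - x)
        = J - I ^ 2 / (y - x) := by field_simp; ring
    rw [h2, sub_nonneg, div_le_iff₀ hyx] at h1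
    linarith

theorem L2Space.integral_abs_le (w : L2Space a b) (hab : a ≤ b) :
    ∫ s in a..b, |w s| ≤ √(b - a) * ‖w‖ := by
  have h := w.sq_integral_abs_le (left_mem_Icc.2 hab) (right_mem_Icc.2 hab) hab
  rw [w.integral_sq hab] at h
  apply le_of_sq_le_sq _ (by positivity)
  rw [mul_pow, Real.sq_sqrt (by linarith)]
  exact h

theorem L2Space.abs_integral_le (w : L2Space a b) {x y : ℝ} (hx : x ∈ Icc a b)
    (hy : y ∈ Icc a b) : |∫ s in x..y, w s| ≤ √(b - a) * ‖w‖ := by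
  have hab : a ≤ b := hx.1.trans hx.2
  have hw := w.intervalIntegrable (left_mem_Icc.2 hab) (right_mem_Icc.2 hab)
  refine le_trans ?_ (w.integral_abs_le hab)
  rw [intervalIntegral.integral_of_le hab]
  rw [← Real.norm_eq_abs]
  refine intervalIntegral.norm_integral_le_integral_norm_uIoc.trans ?_
  rw [intervalIntegrable_iff_integrableOn_Ioc_of_le hab] at hw
  apply setIntegral_mono_set hw.norm
  · exact Filter.Eventually.of_forall fun s => abs_nonneg _
  · have h : uIoc x y ⊆ Ioc a b := by
      rw [← uIoc_of_le hab]
      exact uIoc_subset_uIoc_of_uIcc_subset_uIcc (by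
        rw [uIcc_of_le hab]; exact uIcc_subset_Icc hx hy)
    exact h.eventuallyLE

/-- Integration from `x` to `y` as a continuous linear functional on `L²(a,b)`; it has this meaning
for `a ≤ x ≤ y ≤ b`. -/
def integralCLM (a b x y : ℝ) : L2Space a b →L[ℝ] ℝ :=
  innerSL ℝ (indicatorConstLp 2 (measurableSet_Ioc : MeasurableSet (Ioc x y))
    (ne_of_lt (lt_of_le_of_lt (Measure.restrict_apply_le _ _) measure_Ioc_lt_top)) (1 : ℝ))

theorem integralCLM_apply (w : L2Space a b) {x y : ℝ} (hx : a ≤ x) (hxy : x ≤ y) (hy : y ≤ b) :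
    integralCLM a b x y w = ∫ s in x..y, w s := by
  unfold integralCLM
  rw [innerSL_apply_apply, L2.inner_indicatorConstLp_one,
    Measure.restrict_restrict measurableSet_Ioc,
    intervalIntegral.integral_of_le hxy]
  apply setIntegral_congr_set
  have h : (Ioc x y ∩ Ioc a b : Set ℝ) = Ioc x y :=
    inter_eq_left.2 (Ioc_subset_Ioc hx hy)
  have h2 : (Ioc x y ∩ Ioo a b : Set ℝ) =ᵐ[volume] (Ioc x y ∩ Ioc a b : Set ℝ) :=
    (Filter.EventuallyEq.rfl).inter Ioo_ae_eq_Ioc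
  rwa [h] at h2

/-- A smooth function with integral zero and compact support in `(a,b)` is the derivative of a
test function. -/
theorem exists_test_antiderivative {θ : ℝ → ℝ} (hθ : ContDiff ℝ ∞ θ) {c d : ℝ} (hac : a < c)
    (hcd : c ≤ d) (hdb : d < b) (hsupp : ∀ x, x ∉ Icc c d → θ x = 0)
    (hint : ∫ x in Ioo a b, θ x = 0) :
    ∃ φ : ℝ → ℝ, ContDiff ℝ ∞ φ ∧ HasCompactSupport φ ∧ tsupport φ ⊆ Ioo a b ∧ deriv φ = θ := by
  set φ : ℝ → ℝ := fun x => ∫ s in a..x, θ s with hφ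
  have hii : ∀ x y, IntervalIntegrable θ volume x y := fun x y =>
    hθ.continuous.intervalIntegrable x y
  have hd : ∀ x, HasDerivAt φ (θ x) x := fun x =>
    intervalIntegral.integral_hasDerivAt_right (hii a x)
      hθ.continuous.aestronglyMeasurable.stronglyMeasurableAtFilter hθ.continuous.continuousAt
  have hderiv : deriv φ = θ := funext fun x => (hd x).deriv
  have hz : ∀ x, x ∉ Icc c d → φ x = 0 := by
    intro x hx
    rcases lt_or_ge x c with h | h
    · have : φ x = ∫ s in a..x, (0 : ℝ) := by
        apply intervalIntegral.integral_congr
        intro s hs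
        exact hsupp s fun hs' => by
          have := hs.2
          rcases le_total a x with h' | h'
          · rw [uIcc_of_le h'] at hs; linarith [hs.2, hs'.1]
          · rw [uIcc_of_ge h'] at hs; linarith [hs.2, hs'.1]
      rw [this]; simp
    · have hxd : d < x := by
        by_contra hc; exact hx ⟨h, not_lt.1 hc⟩
      have e1 : ∫ s in a..b, θ s = 0 := by
        rw [intervalIntegral.integral_of_le (by linarith), integral_Ioc_eq_integral_Ioo]
        exact hint
      have e2 : φ x = (∫ s in a..b, θ s) + ∫ s in b..x, θ s :=
        (intervalIntegral.integral_add_adjacent_intervals (hii a b) (hii b x)).symm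
      have e3 : ∫ s in b..x, θ s = ∫ s in b..x, (0 : ℝ) := by
        apply intervalIntegral.integral_congr
        intro s hs
        exact hsupp s fun hs' => by
          rcases le_total b x with h' | h'
          · rw [uIcc_of_le h'] at hs; linarith [hs.1, hs'.2]
          · rw [uIcc_of_ge h'] at hs; linarith [hs.1, hs'.2]
      rw [e2, e1, e3]; simp
  have hts : tsupport φ ⊆ Icc c d := by
    apply closure_minimal _ isClosed_Icc
    intro x hx
    by_contra hc
    exact hx (hz x hc)
  refine ⟨φ, ?_, ?_, hts.trans fun x hx => ⟨hac.trans_le hx.1, hx.2.trans_lt hdb⟩, hderiv⟩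
  · rw [contDiff_infty_iff_deriv]
    exact ⟨fun x => (hd x).differentiableAt, by rw [hderiv]; exact hθ⟩
  · exact HasCompactSupport.of_support_subset_isCompact isCompact_Icc
      ((subset_tsupport φ).trans hts)

/-- The du Bois-Reymond lemma: a function with vanishing weak derivative is constant. Every test
function is the derivative of a test function plus a multiple of a fixed bump function. -/
theorem ae_eq_const_of_forall_integral_deriv_eq_zero (hab : a < b) {D : ℝ → ℝ}
    (hD : IntegrableOn D (Ioo a b))
    (h : ∀ φ : ℝ → ℝ, ContDiff ℝ ∞ φ → HasCompactSupport φ → tsupport φ ⊆ Ioo a b →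
      ∫ x in Ioo a b, D x * deriv φ x = 0) :
    ∃ c : ℝ, ∀ᵐ x ∂volume.restrict (Ioo a b), D x = c := by
  -- a reference bump function of integral one
  let f : ContDiffBump ((a + b) / 2 : ℝ) := ⟨(b - a) / 8, (b - a) / 4, by linarith, by linarith⟩
  set ψ₀ : ℝ → ℝ := f.normed volume
  have hψ₀ : ContDiff ℝ ∞ ψ₀ := f.contDiff_normed
  have hψ₀s : tsupport ψ₀ = Metric.closedBall ((a + b) / 2) ((b - a) / 4) := f.tsupport_normed_eq
  have hψ₀ab : tsupport ψ₀ ⊆ Ioo a b := by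
    rw [hψ₀s, Real.closedBall_eq_Icc]
    intro x hx
    constructor <;> linarith [hx.1, hx.2]
  have hint₀ : ∫ x in Ioo a b, ψ₀ x = 1 := by
    rw [setIntegral_eq_integral_of_forall_compl_eq_zero
      (fun x hx => image_eq_zero_of_notMem_tsupport fun h' => hx (hψ₀ab h'))]
    exact f.integral_normed
  have hmul : ∀ ψ : ℝ → ℝ, Continuous ψ → HasCompactSupport ψ →
      IntegrableOn (fun x => D x * ψ x) (Ioo a b) := by
    intro ψ hψ hc
    obtain ⟨C, hC⟩ := hc.exists_bound_of_continuous hψ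
    exact Integrable.mul_bdd hD hψ.aestronglyMeasurable (Filter.Eventually.of_forall hC)
  set c₀ := ∫ x in Ioo a b, D x * ψ₀ x
  refine ⟨c₀, ?_⟩
  have hli : LocallyIntegrableOn (fun x => D x - c₀) (Ioo a b) :=
    (hD.sub (integrableOn_const (measure_Ioo_lt_top.ne))).locallyIntegrableOn
  have h0 : ∀ᵐ x ∂volume, x ∈ Ioo a b → D x - c₀ = 0 := by
    apply isOpen_Ioo.ae_eq_zero_of_integral_contDiff_smul_eq_zero hli
    intro ψ hψ hψc hψab
    have hK : IsCompact (tsupport ψ ∪ tsupport ψ₀) := IsCompact.union hψc f.hasCompactSupport_normed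
    have hne : (tsupport ψ ∪ tsupport ψ₀).Nonempty := by
      refine ⟨(a + b) / 2, Or.inr ?_⟩
      rw [hψ₀s]
      exact Metric.mem_closedBall_self (by linarith)
    have hKab : tsupport ψ ∪ tsupport ψ₀ ⊆ Ioo a b := union_subset hψab hψ₀ab
    set r := ∫ x in Ioo a b, ψ x
    have hψi : IntegrableOn ψ (Ioo a b) :=
      (hψ.continuous.integrable_of_hasCompactSupport hψc).integrableOn
    have hψ₀i : IntegrableOn ψ₀ (Ioo a b) :=
      (hψ₀.continuous.integrable_of_hasCompactSupport f.hasCompactSupport_normed).integrableOn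
    obtain ⟨φ, h1, h2, h3, h4⟩ := exists_test_antiderivative (a := a) (b := b)
      (θ := fun x => ψ x - r * ψ₀ x) (hψ.sub (contDiff_const.mul hψ₀))
      (hKab (hK.sInf_mem hne)).1 (Real.sInf_le_sSup _ hK.bddBelow hK.bddAbove)
      (hKab (hK.sSup_mem hne)).2
      (fun x hx => by
        have : x ∉ tsupport ψ ∪ tsupport ψ₀ := fun h' =>
          hx ⟨csInf_le hK.bddBelow h', le_csSup hK.bddAbove h'⟩
        rw [mem_union, not_or] at this
        rw [image_eq_zero_of_notMem_tsupport this.1, image_eq_zero_of_notMem_tsupport this.2]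
        ring)
      (by rw [integral_sub hψi (hψ₀i.const_mul r), integral_const_mul, hint₀, mul_one, sub_self])
    have h5 := h φ h1 h2 h3
    rw [h4] at h5
    have i1 := hmul ψ hψ.continuous hψc
    have i2 := hmul ψ₀ hψ₀.continuous f.hasCompactSupport_normed
    have e1 : ∫ x in Ioo a b, D x * (ψ x - r * ψ₀ x)
        = (∫ x in Ioo a b, D x * ψ x) - r * c₀ := by
      rw [← integral_const_mul, ← integral_sub i1 (i2.const_mul r)]
      congr 1; funext x; ring
    rw [e1] at h5
    rw [← setIntegral_eq_integral_of_forall_compl_eq_zero (s := Ioo a b)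
      (fun x hx => by
        rw [image_eq_zero_of_notMem_tsupport fun h' => hx (hψab h'), zero_smul])]
    have e2 : ∫ x in Ioo a b, ψ x • (D x - c₀) = (∫ x in Ioo a b, D x * ψ x) - c₀ * r := by
      rw [← integral_const_mul, ← integral_sub i1 (hψi.const_mul c₀)]
      congr 1; funext x; simp only [smul_eq_mul]; ring
    rw [e2]
    linarith
  rw [ae_restrict_iff' measurableSet_Ioo]
  filter_upwards [h0] with x hx hx'
  linarith [hx hx']

/-- A function with a weak derivative in `L²` is a primitive of it. -/
theorem IsWeakDeriv.exists_ae_eq (hab : a < b) {v w : L2Space a b} (h : IsWeakDeriv a b v w) :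
    ∃ c : ℝ, ∀ᵐ x ∂volume.restrict (Ioo a b), v x = c + ∫ s in a..x, w s := by
  have hw : IntervalIntegrable w volume a b :=
    w.intervalIntegrable (left_mem_Icc.2 hab.le) (right_mem_Icc.2 hab.le)
  set g : ℝ → ℝ := fun x => ∫ s in a..x, w s with hg
  have hac : AbsolutelyContinuousOnInterval g a b :=
    hw.absolutelyContinuousOnInterval_intervalIntegral left_mem_uIcc
  have hgc : ContinuousOn g (Icc a b) := by
    have := hac.continuousOn
    rwa [uIcc_of_le hab.le] at this
  have hgi : IntegrableOn g (Ioo a b) :=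
    (hgc.integrableOn_Icc).mono_set Ioo_subset_Icc_self
  obtain ⟨c, hc⟩ := ae_eq_const_of_forall_integral_deriv_eq_zero hab (D := fun x => v x - g x)
    (v.integrable.sub hgi) (by
      intro φ h1 h2 h3
      have hφd : Continuous (deriv φ) := h1.continuous_deriv (by simp)
      have hg2 : ∫ x in Ioo a b, g x * deriv φ x = - ∫ x in Ioo a b, w x * φ x := by
        have hφac : AbsolutelyContinuousOnInterval φ a b :=
          (h1.contDiffOn.of_le (by simp)).absolutelyContinuousOnInterval
        have e := hac.integral_mul_deriv_eq_deriv_mul hφac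
        have ha0 : φ a = 0 := image_eq_zero_of_notMem_tsupport fun h' => (lt_irrefl a (h3 h').1)
        have hb0 : φ b = 0 := image_eq_zero_of_notMem_tsupport fun h' => (lt_irrefl b (h3 h').2)
        have e2 : ∫ x in a..b, deriv g x * φ x = ∫ x in a..b, w x * φ x := by
          apply intervalIntegral.integral_congr_ae
          filter_upwards [hw.ae_hasDerivAt_integral] with x hx hx'
          rw [(hx (uIoc_subset_uIcc hx') a left_mem_uIcc).deriv]
        rw [ha0, hb0, e2, intervalIntegral.integral_of_le hab.le,
          intervalIntegral.integral_of_le hab.le, integral_Ioc_eq_integral_Ioo,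
          integral_Ioc_eq_integral_Ioo] at e
        rw [e]; ring
      have i1 := integrable_L2_mul_test a b v (deriv φ) hφd h2.deriv
      have i2 : IntegrableOn (fun x => g x * deriv φ x) (Ioo a b) :=
        ((hgc.mul hφd.continuousOn).integrableOn_Icc).mono_set Ioo_subset_Icc_self
      simp_rw [sub_mul]
      rw [integral_sub i1 i2, h φ h1 h2 h3, hg2, sub_self])
  exact ⟨c, by filter_upwards [hc] with x hx; linarith⟩

end L2

section Sobolev

variable {a b : ℝ} {m : ℕ}

/-- The weak derivative of order `j`, as a continuous linear map on `H^m`. -/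
def SobolevH.weakDeriv (j : Fin (m + 1)) : SobolevH a b m →L[ℝ] L2Space a b :=
  (PiLp.proj 2 (fun _ : Fin (m + 1) => L2Space a b) j).comp (SobolevH a b m).subtypeL

theorem SobolevH.norm_weakDeriv_le (V : SobolevH a b m) (j : Fin (m + 1)) :
    ‖SobolevH.weakDeriv j V‖ ≤ ‖V‖ :=
  PiLp.norm_apply_le (V : PiLp 2 (fun _ : Fin (m + 1) => L2Space a b)) j

theorem SobolevH.isWeakDeriv (V : SobolevH a b m) (j : Fin m) :
    IsWeakDeriv a b (SobolevH.weakDeriv j.castSucc V) (SobolevH.weakDeriv j.succ V) :=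
  V.2 j

/-- `p` is the continuous representative of `v`, and a primitive of `w`. -/
structure IsPrimitive (v w : L2Space a b) (p : ℝ → ℝ) : Prop where
  ae_eq : v =ᵐ[volume.restrict (Ioo a b)] p
  sub_eq : ∀ x ∈ Icc a b, ∀ y ∈ Icc a b, p y - p x = ∫ s in x..y, w s

theorem continuousOn_const_add_integral (hab : a ≤ b) (w : L2Space a b) (c : ℝ) :
    ContinuousOn (fun x => c + ∫ s in a..x, w s) (Icc a b) := by
  have hw : IntervalIntegrable w volume a b :=
    w.intervalIntegrable (left_mem_Icc.2 hab) (right_mem_Icc.2 hab)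
  have h := (hw.absolutelyContinuousOnInterval_intervalIntegral left_mem_uIcc).continuousOn
  rw [uIcc_of_le hab] at h
  exact continuousOn_const.add h

theorem IsPrimitive.continuousOn {v w : L2Space a b} {p : ℝ → ℝ} (h : IsPrimitive v w p)
    (hab : a ≤ b) : ContinuousOn p (Icc a b) :=
  (continuousOn_const_add_integral hab w (p a)).congr fun x hx => by
    have := h.sub_eq a (left_mem_Icc.2 hab) x hx
    simp only
    linarith

theorem isPrimitive_const_add {v w : L2Space a b} {c : ℝ} (hab : a ≤ b)
    (h : ∀ᵐ x ∂volume.restrict (Ioo a b), v x = c + ∫ s in a..x, w s) :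
    IsPrimitive v w (fun x => c + ∫ s in a..x, w s) := by
  refine ⟨h, fun x hx y hy => ?_⟩
  have := intervalIntegral.integral_add_adjacent_intervals
    (w.intervalIntegrable (left_mem_Icc.2 hab) hx) (w.intervalIntegrable hx hy)
  linarith

theorem IsWeakDeriv.exists_isPrimitive (hab : a < b) {v w : L2Space a b}
    (h : IsWeakDeriv a b v w) : ∃ p, IsPrimitive v w p := by
  obtain ⟨c, hc⟩ := h.exists_ae_eq hab
  exact ⟨_, isPrimitive_const_add hab.le hc⟩

theorem Represents.isPrimitive (hab : a < b) {V : SobolevH a b (m + 1)} {v : ℝ → ℝ}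
    (h : Represents V v) :
    IsPrimitive (SobolevH.weakDeriv 0 V) (SobolevH.weakDeriv 1 V) v := by
  obtain ⟨c, hc⟩ := (SobolevH.isWeakDeriv V 0).exists_ae_eq hab
  have h2 : v =ᵐ[volume.restrict (Icc a b)]
      fun x => c + ∫ s in a..x, SobolevH.weakDeriv (Fin.succ 0) V s := by
    rw [← restrict_Ioo_eq_restrict_Icc]
    filter_upwards [hc, h.2] with x h3 h4
    rw [← h4]
    exact h3
  have h3 := Measure.eqOn_Icc_of_ae_eq volume hab.ne h2 h.1
    (continuousOn_const_add_integral hab.le _ c)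
  refine ⟨h.2, fun x hx y hy => ?_⟩
  rw [h3 hx, h3 hy]
  exact (isPrimitive_const_add hab.le hc).sub_eq x hx y hy

/-- The constant of the embedding of `H¹(a,b)` into the bounded functions. -/
def supConst (a b : ℝ) : ℝ := √(b - a) / (b - a) + √(b - a)

theorem supConst_nonneg (hab : a ≤ b) : 0 ≤ supConst a b := by
  have : 0 ≤ b - a := sub_nonneg.2 hab
  unfold supConst
  positivity

theorem IsPrimitive.abs_le {v w : L2Space a b} {p : ℝ → ℝ} (h : IsPrimitive v w p)
    (hab : a < b) {R : ℝ} (hv : ‖v‖ ≤ R) (hw : ‖w‖ ≤ R) {x : ℝ} (hx : x ∈ Icc a b) :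
    |p x| ≤ supConst a b * R := by
  have hba : 0 < b - a := sub_pos.2 hab
  have hl := left_mem_Icc.2 hab.le
  have hr := right_mem_Icc.2 hab.le
  have iv := (v.intervalIntegrable hl hr).abs
  have h1 : ∫ _ in a..b, |p x| ≤ ∫ y in a..b, (|v y| + √(b - a) * ‖w‖) := by
    rw [intervalIntegral.integral_of_le hab.le, intervalIntegral.integral_of_le hab.le,
      integral_Ioc_eq_integral_Ioo, integral_Ioc_eq_integral_Ioo]
    have i2 : IntegrableOn (fun y => |v y| + √(b - a) * ‖w‖) (Ioo a b) :=
      (v.integrable.abs).add (integrableOn_const measure_Ioo_lt_top.ne)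
    have i1 : IntegrableOn (fun _ : ℝ => |p x|) (Ioo a b) :=
      integrableOn_const measure_Ioo_lt_top.ne
    apply integral_mono_ae i1 i2
    filter_upwards [h.ae_eq, ae_restrict_mem measurableSet_Ioo] with y hy hy'
    have e := h.sub_eq y (Ioo_subset_Icc_self hy') x hx
    have e2 := w.abs_integral_le (Ioo_subset_Icc_self hy') hx
    rw [← e] at e2
    have e3 := abs_sub_abs_le_abs_sub (p x) (p y)
    rw [hy]
    linarith
  rw [intervalIntegral.integral_const, smul_eq_mul,
    intervalIntegral.integral_add iv intervalIntegrable_const, intervalIntegral.integral_const,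
    smul_eq_mul] at h1
  have h2 := v.integral_abs_le hab.le
  have hs : 0 ≤ √(b - a) := Real.sqrt_nonneg _
  have h3 : (b - a) * |p x| ≤ √(b - a) * R + (b - a) * (√(b - a) * R) := by
    have := mul_le_mul_of_nonneg_left hv hs
    have := mul_le_mul_of_nonneg_left (mul_le_mul_of_nonneg_left hw hs) hba.le
    linarith
  apply le_of_mul_le_mul_left _ hba
  refine h3.trans (le_of_eq ?_)
  unfold supConst
  field_simp

theorem IsPrimitive.hasDerivAt {v w : L2Space a b} {p q : ℝ → ℝ} (h : IsPrimitive v w p)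
    (hab : a < b) (hq : ContinuousOn q (Icc a b)) (hwq : w =ᵐ[volume.restrict (Ioo a b)] q)
    {x : ℝ} (hx : x ∈ Ioo a b) : HasDerivAt p (q x) x := by
  have hqo := hq.mono Ioo_subset_Icc_self
  have hqi : IntervalIntegrable q volume a x := by
    apply ContinuousOn.intervalIntegrable
    rw [uIcc_of_le hx.1.le]
    exact hq.mono (Icc_subset_Icc_right hx.2.le)
  have hd : HasDerivAt (fun y => p a + ∫ s in a..y, q s) (q x) x :=
    (intervalIntegral.integral_hasDerivAt_right hqi
      (hqo.stronglyMeasurableAtFilter isOpen_Ioo x hx)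
      (hqo.continuousAt (isOpen_Ioo.mem_nhds hx))).const_add _
  apply hd.congr_of_eventuallyEq
  filter_upwards [isOpen_Ioo.mem_nhds hx] with y hy
  have e := h.sub_eq a (left_mem_Icc.2 hab.le) y (Ioo_subset_Icc_self hy)
  have e2 : ∫ s in a..y, w s = ∫ s in a..y, q s := by
    rw [intervalIntegral.integral_of_le hy.1.le, intervalIntegral.integral_of_le hy.1.le]
    apply integral_congr_ae
    exact ae_restrict_of_ae_restrict_of_subset
      (fun s hs => ⟨hs.1, hs.2.trans_lt hy.2⟩ : Ioc a y ⊆ Ioo a b) hwq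
  rw [← e2]
  linarith

theorem Represents.sub {V W : SobolevH a b m} {v w : ℝ → ℝ} (hV : Represents V v)
    (hW : Represents W w) : Represents (V - W) (fun x => v x - w x) := by
  refine ⟨hV.1.sub hW.1, ?_⟩
  have h := Lp.coeFn_sub ((V : PiLp 2 (fun _ : Fin (m + 1) => L2Space a b)) 0)
    ((W : PiLp 2 (fun _ : Fin (m + 1) => L2Space a b)) 0)
  filter_upwards [h, hV.2, hW.2] with x h1 h2 h3
  rw [← h2, ← h3]
  exact h1

theorem Represents.abs_le (hab : a < b) {V : SobolevH a b (m + 1)} {v : ℝ → ℝ}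
    (h : Represents V v) {x : ℝ} (hx : x ∈ Icc a b) : |v x| ≤ supConst a b * ‖V‖ :=
  (h.isPrimitive hab).abs_le hab (SobolevH.norm_weakDeriv_le V _)
    (SobolevH.norm_weakDeriv_le V _) hx

/-- The representative of an `H⁴` function is three times differentiable with bounded derivatives,
and its third derivative is a primitive of the fourth weak derivative. -/
theorem Represents.exists_derivs (hab : a < b) {V : SobolevH a b 4} {v : ℝ → ℝ}
    (h : Represents V v) : ∃ v₁ v₂ v₃ : ℝ → ℝ,
      (∀ x ∈ Ioo a b, HasDerivAt v (v₁ x) x) ∧ (∀ x ∈ Ioo a b, HasDerivAt v₁ (v₂ x) x) ∧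
      (∀ x ∈ Ioo a b, HasDerivAt v₂ (v₃ x) x) ∧ ContinuousOn v₁ (Icc a b) ∧
      ContinuousOn v₂ (Icc a b) ∧
      (∀ x ∈ Icc a b, ∀ y ∈ Icc a b, v₃ y - v₃ x = ∫ s in x..y, SobolevH.weakDeriv 4 V s) ∧
      (∀ x ∈ Icc a b, |v₁ x| ≤ supConst a b * ‖V‖) ∧
      (∀ x ∈ Icc a b, |v₂ x| ≤ supConst a b * ‖V‖) ∧
      (∀ x ∈ Icc a b, |v₃ x| ≤ supConst a b * ‖V‖) := by
  obtain ⟨v₁, h1⟩ := (SobolevH.isWeakDeriv V 1).exists_isPrimitive hab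
  obtain ⟨v₂, h2⟩ := (SobolevH.isWeakDeriv V 2).exists_isPrimitive hab
  obtain ⟨v₃, h3⟩ := (SobolevH.isWeakDeriv V 3).exists_isPrimitive hab
  refine ⟨v₁, v₂, v₃, fun x hx => ?_, fun x hx => ?_, fun x hx => ?_, h1.continuousOn hab.le,
    h2.continuousOn hab.le, h3.sub_eq, fun x hx => ?_, fun x hx => ?_, fun x hx => ?_⟩
  · exact (h.isPrimitive hab).hasDerivAt hab (h1.continuousOn hab.le) h1.ae_eq hx
  · exact h1.hasDerivAt hab (h2.continuousOn hab.le) h2.ae_eq hx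
  · exact h2.hasDerivAt hab (h3.continuousOn hab.le) h3.ae_eq hx
  · exact h1.abs_le hab (SobolevH.norm_weakDeriv_le V _) (SobolevH.norm_weakDeriv_le V _) hx
  · exact h2.abs_le hab (SobolevH.norm_weakDeriv_le V _) (SobolevH.norm_weakDeriv_le V _) hx
  · exact h3.abs_le hab (SobolevH.norm_weakDeriv_le V _) (SobolevH.norm_weakDeriv_le V _) hx

end Sobolev

/-! ### Linear functionals of the solution -/

theorem abs_sub_le_growthPrimitive {T σ B : ℝ} (hσ1 : σ ≠ 1) {f f' : ℝ → ℝ}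
    (hf : ContinuousOn f (Ioc 0 T)) (hd : ∀ s ∈ Ioo 0 T, HasDerivAt f (f' s) s)
    (hb : ∀ s ∈ Ioo 0 T, |f' s| ≤ B * (1 + s ^ (σ - 2))) {s r : ℝ} (hs : 0 < s) (hsr : s ≤ r)
    (hr : r ≤ T) : |f r - f s| ≤ B * (growthPrimitive σ r - growthPrimitive σ s) := by
  have hsub : Icc s r ⊆ Ioc 0 T := fun x hx => ⟨hs.trans_le hx.1, hx.2.trans hr⟩
  have hsub' : Ioo s r ⊆ Ioo 0 T := fun x hx => ⟨hs.trans hx.1, hx.2.trans_le hr⟩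
  have hG : ContinuousOn (fun x => B * growthPrimitive σ x) (Icc s r) := fun x hx =>
    ((hasDerivAt_growthPrimitive hσ1 (hsub hx).1).const_mul B).continuousAt.continuousWithinAt
  have key : ∀ ε : ℝ, |ε| = 1 → ε * f s + B * growthPrimitive σ s
      ≤ ε * f r + B * growthPrimitive σ r := by
    intro ε hε
    have hd2 : ∀ x ∈ Ioo s r, HasDerivAt (fun x => ε * f x + B * growthPrimitive σ x)
        (ε * f' x + B * (1 + x ^ (σ - 2))) x := fun x hx =>
      ((hd x (hsub' hx)).const_mul ε).add
        ((hasDerivAt_growthPrimitive hσ1 (hsub' hx).1).const_mul B)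
    have hc : ContinuousOn (fun x => ε * f x + B * growthPrimitive σ x) (Icc s r) :=
      (continuousOn_const.mul (hf.mono hsub)).add hG
    have hm : MonotoneOn (fun x => ε * f x + B * growthPrimitive σ x) (Icc s r) := by
      apply monotoneOn_of_deriv_nonneg (convex_Icc s r) hc
      · rw [interior_Icc]
        exact fun x hx => (hd2 x hx).differentiableAt.differentiableWithinAt
      · rw [interior_Icc]
        intro x hx
        rw [(hd2 x hx).deriv]
        have h1 := hb x (hsub' hx)
        have h2 := neg_abs_le (ε * f' x)
        rw [abs_mul, hε, one_mul] at h2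
        linarith
    exact hm (left_mem_Icc.2 hsr) (right_mem_Icc.2 hsr) hsr
  have h1 := key 1 (by simp)
  have h2 := key (-1) (by simp)
  rw [abs_le]
  constructor <;> linarith

/-- A bounded linear functional of a weakly singular `H¹`-valued function is weakly singular. -/
theorem weaklySingular_of_clm {a b T σ C K : ℝ} {m : ℕ} (hσ1 : σ ≠ 1) {U : ℝ → SobolevH a b m}
    (hUc : ContinuousOn U (Icc 0 T)) (hU : ContDiffOn ℝ 2 U (Ioc 0 T))
    (hbd : ∀ t ∈ Ioc 0 T, ‖iteratedDerivWithin 2 U (Ioc 0 T) t‖ ≤ K * (1 + t ^ (σ - 2)))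
    (l : SobolevH a b m →L[ℝ] ℝ) (hC : 0 ≤ C) (hl : ∀ V, |l V| ≤ C * ‖V‖) :
    WeaklySingular T σ (C * K) (fun s => l (U s)) (fun s => l (derivWithin U (Ioc 0 T) s)) := by
  have hS : UniqueDiffOn ℝ (Ioc 0 T) := uniqueDiffOn_Ioc 0 T
  have hnhds : ∀ s ∈ Ioo 0 T, Ioc 0 T ∈ nhds s := fun s hs => Ioc_mem_nhds hs.1 hs.2
  have h1 : ContDiffOn ℝ 1 (derivWithin U (Ioc 0 T)) (Ioc 0 T) :=
    hU.derivWithin hS (by norm_num)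
  have hl1 : ContinuousOn (fun s => l (derivWithin U (Ioc 0 T) s)) (Ioc 0 T) :=
    l.continuous.comp_continuousOn h1.continuousOn
  refine ⟨l.continuous.comp_continuousOn hUc, fun s hs => ?_, hl1, fun s r hs hsr hr => ?_⟩
  · have hd := ((hU.differentiableOn (by norm_num)) s
        (Ioo_subset_Ioc_self hs)).hasDerivWithinAt.hasDerivAt
      (hnhds s hs)
    exact l.hasFDerivAt.comp_hasDerivAt s hd
  · refine abs_sub_le_growthPrimitive hσ1 hl1
      (f' := fun s => l (derivWithin (derivWithin U (Ioc 0 T)) (Ioc 0 T) s)) (fun s hs => ?_)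
      (fun s hs => ?_) hs hsr hr
    · have hd := ((h1.differentiableOn (by norm_num)) s
        (Ioo_subset_Ioc_self hs)).hasDerivWithinAt.hasDerivAt
        (hnhds s hs)
      exact l.hasFDerivAt.comp_hasDerivAt s hd
    · have h2 := hbd s (Ioo_subset_Ioc_self hs)
      rw [iteratedDerivWithin_succ, iteratedDerivWithin_one] at h2
      refine (hl _).trans ?_
      rw [mul_assoc]
      exact mul_le_mul_of_nonneg_left h2 hC

/-! ### The space grid -/

section grid

variable {xl xr μ₀ μ₁ : ℝ} {μ : ℝ → ℝ} {M : ℕ}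

theorem meshWidth_pos (hx : xl < xr) (hM : 1 ≤ M) : 0 < meshWidth xl xr M :=
  div_pos (sub_pos.2 hx) (by exact_mod_cast hM)

theorem natCast_mul_meshWidth (hM : 1 ≤ M) : (M : ℝ) * meshWidth xl xr M = xr - xl := by
  have : (M : ℝ) ≠ 0 := by exact_mod_cast (by omega : M ≠ 0)
  unfold meshWidth
  field_simp

theorem gridPoint_succ (i : ℕ) :
    gridPoint xl xr M (i + 1) = gridPoint xl xr M i + meshWidth xl xr M := by
  unfold gridPoint; push_cast; ring

theorem gridPoint_zero : gridPoint xl xr M 0 = xl := by simp [gridPoint]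

theorem gridPoint_last (hM : 1 ≤ M) : gridPoint xl xr M M = xr := by
  unfold gridPoint
  rw [natCast_mul_meshWidth hM]
  ring

theorem gridPoint_mem_Icc (hx : xl < xr) (hM : 1 ≤ M) {i : ℕ} (hi : i ≤ M) :
    gridPoint xl xr M i ∈ Icc xl xr := by
  have hh := meshWidth_pos hx hM
  have e := natCast_mul_meshWidth (xl := xl) (xr := xr) hM
  have hi' : (i : ℝ) ≤ M := by exact_mod_cast hi
  have : (i : ℝ) * meshWidth xl xr M ≤ M * meshWidth xl xr M :=
    mul_le_mul_of_nonneg_right hi' hh.le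
  unfold gridPoint
  constructor
  · have : 0 ≤ (i : ℝ) * meshWidth xl xr M := by positivity
    linarith
  · linarith

theorem gridPoint_mem_Ioo (hx : xl < xr) (hM : 1 ≤ M) {i : ℕ} (h0 : 0 < i) (hi : i < M) :
    gridPoint xl xr M i ∈ Ioo xl xr := by
  have hh := meshWidth_pos hx hM
  have h1 := gridPoint_mem_Icc hx hM (i := i - 1) (by omega)
  have h2 := gridPoint_mem_Icc hx hM (i := i + 1) (by omega)
  have e1 := gridPoint_succ (xl := xl) (xr := xr) (M := M) (i - 1)
  have e2 := gridPoint_succ (xl := xl) (xr := xr) (M := M) i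
  rw [Nat.sub_add_cancel h0] at e1
  exact ⟨by linarith [h1.1], by linarith [h2.2]⟩

theorem gridPoint_add_half_mem_Icc (hx : xl < xr) (hM : 1 ≤ M) {i : ℕ} (hi : i < M) :
    gridPoint xl xr M i + meshWidth xl xr M / 2 ∈ Icc xl xr := by
  have hh := meshWidth_pos hx hM
  have h1 := gridPoint_mem_Icc hx hM (i := i) (by omega)
  have h2 := gridPoint_mem_Icc hx hM (i := i + 1) (by omega)
  rw [gridPoint_succ] at h2
  exact ⟨by linarith [h1.1], by linarith [h2.2]⟩

theorem sum_integral_grid (hx : xl < xr) (hM : 1 ≤ M) {f : ℝ → ℝ}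
    (hf : ∀ x ∈ Icc xl xr, ∀ y ∈ Icc xl xr, IntervalIntegrable f volume x y) :
    ∑ i ∈ Finset.range M, ∫ s in (gridPoint xl xr M i)..(gridPoint xl xr M (i + 1)), f s
      = ∫ s in xl..xr, f s := by
  rw [intervalIntegral.sum_integral_adjacent_intervals (fun k hk =>
    hf _ (gridPoint_mem_Icc hx hM (by omega)) _ (gridPoint_mem_Icc hx hM (by omega))),
    gridPoint_zero, gridPoint_last hM]

/-- The bilinear form `∑ μ(x_{i+1/2}) δv δw h` of the difference operator. -/
def gridForm (xl xr : ℝ) (μ : ℝ → ℝ) (M : ℕ) (v w : ℕ → ℝ) : ℝ :=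
  ∑ i ∈ Finset.range M, μ (gridPoint xl xr M i + meshWidth xl xr M / 2) / meshWidth xl xr M *
    ((v (i + 1) - v i) * (w (i + 1) - w i))

theorem sum_Ioo_mul_sub (v F : ℕ → ℝ) (hM : 1 ≤ M) :
    ∑ i ∈ Finset.Ioo 0 M, v i * (F i - F (i - 1))
      = v M * F (M - 1) - v 0 * F 0 - ∑ i ∈ Finset.range M, F i * (v (i + 1) - v i) := by
  induction M, hM using Nat.le_induction with
  | base =>
    have e : Finset.Ioo 0 1 = ∅ := rfl
    rw [e]
    simp
    ring
  | succ n hn ih =>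
    have e : Finset.Ioo 0 (n + 1) = insert n (Finset.Ioo 0 n) := by
      ext j; simp only [Finset.mem_insert, Finset.mem_Ioo]; omega
    rw [e, Finset.sum_insert (by simp), ih, Finset.sum_range_succ, Nat.add_sub_cancel]
    ring

/-- Summation by parts. -/
theorem gridInner_discreteOp (hx : xl < xr) (hM : 1 ≤ M) {v w : ℕ → ℝ} (h0 : v 0 = 0)
    (h1 : v M = 0) :
    gridInner xl xr M v (discreteOp xl xr μ M w) = gridForm xl xr μ M v w := by
  have hh := (meshWidth_pos hx hM).ne'
  set h := meshWidth xl xr M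
  set F : ℕ → ℝ := fun i => μ (gridPoint xl xr M i + h / 2) * ((w (i + 1) - w i) / h)
  have e := sum_Ioo_mul_sub v F hM
  rw [h0, h1, zero_mul, zero_mul, sub_zero, zero_sub] at e
  have e1 : gridForm xl xr μ M v w = ∑ i ∈ Finset.range M, F i * (v (i + 1) - v i) := by
    apply Finset.sum_congr rfl
    intro i _
    simp only [F]
    ring
  rw [e1, ← neg_eq_iff_eq_neg.2 e, gridInner, Finset.mul_sum, ← Finset.sum_neg_distrib]
  apply Finset.sum_congr rfl
  intro i hi
  rw [Finset.mem_Ioo] at hi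
  have e2 : gridPoint xl xr M i - h / 2 = gridPoint xl xr M (i - 1) + h / 2 := by
    have := gridPoint_succ (xl := xl) (xr := xr) (M := M) (i - 1)
    rw [Nat.sub_add_cancel hi.1] at this
    rw [this]
    ring
  simp only [discreteOp, F]
  rw [show meshWidth xl xr M = h from rfl, e2, Nat.sub_add_cancel hi.1]
  field_simp

theorem gridForm_self_nonneg (hx : xl < xr) (hM : 1 ≤ M) (hμ : ∀ x ∈ Icc xl xr, 0 ≤ μ x)
    (v : ℕ → ℝ) : 0 ≤ gridForm xl xr μ M v v := by
  apply Finset.sum_nonneg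
  intro i hi
  rw [Finset.mem_range] at hi
  exact mul_nonneg (div_nonneg (hμ _ (gridPoint_add_half_mem_Icc hx hM hi))
    (meshWidth_pos hx hM).le) (mul_self_nonneg _)

theorem gridH1_sq (hx : xl < xr) (hM : 1 ≤ M) (hμ : ∀ x ∈ Icc xl xr, 0 ≤ μ x) {v : ℕ → ℝ}
    (h0 : v 0 = 0) (h1 : v M = 0) : gridH1 xl xr μ M v ^ 2 = gridForm xl xr μ M v v := by
  unfold gridH1
  rw [gridInner_discreteOp hx hM h0 h1, Real.sq_sqrt (gridForm_self_nonneg hx hM hμ v)]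

theorem gridInner_self_nonneg (hx : xl < xr) (hM : 1 ≤ M) (v : ℕ → ℝ) :
    0 ≤ gridInner xl xr M v v :=
  mul_nonneg (meshWidth_pos hx hM).le (Finset.sum_nonneg fun _ _ => mul_self_nonneg _)

theorem gridL2_sq (hx : xl < xr) (hM : 1 ≤ M) (v : ℕ → ℝ) :
    gridL2 xl xr M v ^ 2 = gridInner xl xr M v v :=
  Real.sq_sqrt (gridInner_self_nonneg hx hM v)

theorem gridForm_le_half (hx : xl < xr) (hM : 1 ≤ M) (hμ : ∀ x ∈ Icc xl xr, 0 ≤ μ x)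
    (v w : ℕ → ℝ) :
    gridForm xl xr μ M v w ≤ (gridForm xl xr μ M v v + gridForm xl xr μ M w w) / 2 := by
  unfold gridForm
  rw [← Finset.sum_add_distrib, Finset.sum_div]
  apply Finset.sum_le_sum
  intro i hi
  rw [Finset.mem_range] at hi
  have hc := div_nonneg (hμ _ (gridPoint_add_half_mem_Icc hx hM hi)) (meshWidth_pos hx hM).le
  have := mul_nonneg hc (sq_nonneg ((v (i + 1) - v i) - (w (i + 1) - w i)))
  linarith

/-- The discrete Poincaré inequality. -/
theorem embeddingConstant_of_bounds (hx : xl < xr) (hμ₀ : 0 < μ₀)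
    (hμ : ∀ x ∈ Icc xl xr, μ₀ ≤ μ x) : EmbeddingConstant xl xr μ ((xr - xl) ^ 2 / μ₀) := by
  intro M hM v h0 h1
  have hh := meshWidth_pos hx hM
  rw [gridL2_sq hx hM, gridH1_sq hx hM (fun x hx => hμ₀.le.trans (hμ x hx)) h0 h1]
  set h := meshWidth xl xr M
  set S := ∑ j ∈ Finset.range M, (v (j + 1) - v j) ^ 2
  have hS : 0 ≤ S := Finset.sum_nonneg fun _ _ => sq_nonneg _
  have hM0 : (0 : ℝ) ≤ M := Nat.cast_nonneg M
  have hv : ∀ i ∈ Finset.Ioo 0 M, v i * v i ≤ M * S := by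
    intro i hi
    rw [Finset.mem_Ioo] at hi
    have e := Finset.sum_range_sub v i
    rw [h0, sub_zero] at e
    have h2 := sq_sum_le_card_mul_sum_sq (s := Finset.range i) (f := fun j => v (j + 1) - v j)
    rw [e, Finset.card_range] at h2
    have h3 : ∑ j ∈ Finset.range i, (v (j + 1) - v j) ^ 2 ≤ S :=
      Finset.sum_le_sum_of_subset_of_nonneg (Finset.range_subset_range.2 hi.2.le)
        (fun _ _ _ => sq_nonneg _)
    have h4 : (i : ℝ) ≤ M := by exact_mod_cast hi.2.le
    have h5 : 0 ≤ ∑ j ∈ Finset.range i, (v (j + 1) - v j) ^ 2 :=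
      Finset.sum_nonneg fun _ _ => sq_nonneg _
    calc v i * v i = v i ^ 2 := by ring
      _ ≤ _ := h2
      _ ≤ M * S := mul_le_mul h4 h3 h5 hM0
  have hL : gridInner xl xr M v v ≤ h * (M * (M * S)) := by
    apply mul_le_mul_of_nonneg_left _ hh.le
    refine (Finset.sum_le_card_nsmul _ _ _ hv).trans ?_
    rw [nsmul_eq_mul]
    apply mul_le_mul_of_nonneg_right _ (by positivity)
    exact_mod_cast (by simp : (Finset.Ioo 0 M).card ≤ M)
  have hF : μ₀ / h * S ≤ gridForm xl xr μ M v v := by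
    unfold gridForm
    rw [Finset.mul_sum]
    apply Finset.sum_le_sum
    intro i hi
    rw [Finset.mem_range] at hi
    rw [← sq]
    apply mul_le_mul_of_nonneg_right _ (sq_nonneg _)
    exact div_le_div_of_nonneg_right (hμ _ (gridPoint_add_half_mem_Icc hx hM hi)) hh.le
  have e := natCast_mul_meshWidth (xl := xl) (xr := xr) hM
  calc gridInner xl xr M v v ≤ h * (M * (M * S)) := hL
    _ = (xr - xl) ^ 2 / μ₀ * (μ₀ / h * S) := by
        rw [← e]
        change h * (M * (M * S)) = (M * h) ^ 2 / μ₀ * (μ₀ / h * S)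
        field_simp
    _ ≤ _ := by gcongr

/-- The functional `V ↦ ∑ (μ(x_{i+1/2}) / h) (V(x_{i+1}) - V(x_i)) (e_{i+1} - e_i)` on `H¹`. -/
def gridFunctional (xl xr : ℝ) (μ : ℝ → ℝ) (M : ℕ) (e : ℕ → ℝ) : SobolevH xl xr 1 →L[ℝ] ℝ :=
  ∑ i ∈ Finset.range M, (μ (gridPoint xl xr M i + meshWidth xl xr M / 2) / meshWidth xl xr M *
    (e (i + 1) - e i)) •
    (integralCLM xl xr (gridPoint xl xr M i) (gridPoint xl xr M (i + 1))).comp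
      (SobolevH.weakDeriv 1)

theorem gridFunctional_apply (hx : xl < xr) (hM : 1 ≤ M) (e : ℕ → ℝ) (V : SobolevH xl xr 1) :
    gridFunctional xl xr μ M e V = ∑ i ∈ Finset.range M,
      (μ (gridPoint xl xr M i + meshWidth xl xr M / 2) / meshWidth xl xr M * (e (i + 1) - e i)) *
      ∫ s in (gridPoint xl xr M i)..(gridPoint xl xr M (i + 1)), SobolevH.weakDeriv 1 V s := by
  unfold gridFunctional
  rw [sum_apply]
  apply Finset.sum_congr rfl
  intro i hi
  rw [Finset.mem_range] at hi
  have h1 := gridPoint_mem_Icc hx hM (i := i) (by omega)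
  have h2 := gridPoint_mem_Icc hx hM (i := i + 1) (by omega)
  have h3 := gridPoint_succ (xl := xl) (xr := xr) (M := M) i
  have := meshWidth_pos hx hM
  rw [smul_apply, ContinuousLinearMap.comp_apply,
    integralCLM_apply _ h1.1 (by linarith) h2.2, smul_eq_mul]

theorem abs_gridFunctional_le (hx : xl < xr) (hM : 1 ≤ M)
    (hμ : ∀ x ∈ Icc xl xr, 0 ≤ μ x ∧ μ x ≤ μ₁) (e : ℕ → ℝ) (V : SobolevH xl xr 1) :
    |gridFunctional xl xr μ M e V| ≤ √μ₁ * √(gridForm xl xr μ M e e) * ‖V‖ := by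
  have hh := meshWidth_pos hx hM
  have hμ₁ : 0 ≤ μ₁ := (hμ xl (left_mem_Icc.2 hx.le)).1.trans (hμ xl (left_mem_Icc.2 hx.le)).2
  have hF := gridForm_self_nonneg hx hM (fun x hx => (hμ x hx).1) e
  rw [gridFunctional_apply hx hM]
  set h := meshWidth xl xr M
  set W := SobolevH.weakDeriv 1 V
  have hW : ‖W‖ ≤ ‖V‖ := SobolevH.norm_weakDeriv_le V _
  apply abs_le_of_sq_le_sq _ (by positivity)
  refine (Finset.sum_mul_sq_le_sq_mul_sq _ _ _).trans ?_
  rw [mul_pow, mul_pow, Real.sq_sqrt hμ₁, Real.sq_sqrt hF]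
  have h1 : ∑ i ∈ Finset.range M,
      (μ (gridPoint xl xr M i + h / 2) / h * (e (i + 1) - e i)) ^ 2
      ≤ μ₁ * gridForm xl xr μ M e e / h := by
    unfold gridForm
    rw [Finset.mul_sum, Finset.sum_div]
    apply Finset.sum_le_sum
    intro i hi
    rw [Finset.mem_range] at hi
    obtain ⟨a1, a2⟩ := hμ _ (gridPoint_add_half_mem_Icc hx hM hi)
    change _ ≤ μ₁ * (μ (gridPoint xl xr M i + h / 2) / h * _) / h
    set m := μ (gridPoint xl xr M i + h / 2)
    have : (m / h * (e (i + 1) - e i)) ^ 2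
        = m * (m / h * ((e (i + 1) - e i) * (e (i + 1) - e i))) / h := by
      field_simp
    rw [this]
    apply div_le_div_of_nonneg_right _ hh.le
    exact mul_le_mul_of_nonneg_right a2 (mul_nonneg (div_nonneg a1 hh.le) (mul_self_nonneg _))
  have h2 : ∑ i ∈ Finset.range M,
      (∫ s in (gridPoint xl xr M i)..(gridPoint xl xr M (i + 1)), W s) ^ 2 ≤ h * ‖V‖ ^ 2 := by
    have h3 : ∑ i ∈ Finset.range M,
        (∫ s in (gridPoint xl xr M i)..(gridPoint xl xr M (i + 1)), W s) ^ 2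
        ≤ ∑ i ∈ Finset.range M,
          h * ∫ s in (gridPoint xl xr M i)..(gridPoint xl xr M (i + 1)), W s ^ 2 := by
      apply Finset.sum_le_sum
      intro i hi
      rw [Finset.mem_range] at hi
      have e1 := gridPoint_succ (xl := xl) (xr := xr) (M := M) i
      have h4 := W.sq_integral_abs_le (gridPoint_mem_Icc hx hM (i := i) (by omega))
        (gridPoint_mem_Icc hx hM (i := i + 1) (by omega)) (by linarith)
      have e2 : gridPoint xl xr M (i + 1) - gridPoint xl xr M i = h := by linarith
      rw [e2] at h4
      refine le_trans ?_ h4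
      rw [← sq_abs]
      exact pow_le_pow_left₀ (abs_nonneg _)
        (intervalIntegral.abs_integral_le_integral_abs (by linarith)) 2
    refine h3.trans ?_
    rw [← Finset.mul_sum, sum_integral_grid hx hM (fun x hx y hy => W.intervalIntegrable_sq hx hy),
      W.integral_sq hx.le]
    gcongr
  calc _ ≤ (μ₁ * gridForm xl xr μ M e e / h) * (h * ‖V‖ ^ 2) :=
        mul_le_mul h1 h2 (Finset.sum_nonneg fun _ _ => sq_nonneg _) (by positivity)
    _ = _ := by field_simp

end grid

/-! ### Consistency of the difference operator -/

section taylor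

variable {a b d η x : ℝ} {f f₁ f₂ f₃ : ℝ → ℝ}

theorem abs_sub_le_of_hasDerivAt {C y : ℝ} (hc : ContinuousOn f (Icc a b))
    (hd : ∀ z ∈ Ioo a b, HasDerivAt f (f₁ z) z) (hx : x ∈ Icc a b) (hy : y ∈ Icc a b)
    (hyd : |y - x| ≤ d) (hC : 0 ≤ C) (hb : ∀ z ∈ Ioo a b, |z - x| ≤ d → |f₁ z| ≤ C) :
    |f y - f x| ≤ C * d := by
  have key : ∀ p q, p ∈ Icc a b → q ∈ Icc a b → p < q →
      ∃ z ∈ Ioo p q, f q - f p = f₁ z * (q - p) := by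
    intro p q hp hq hpq
    obtain ⟨z, hz, he⟩ := exists_hasDerivAt_eq_slope f f₁ hpq
      (hc.mono (Icc_subset_Icc hp.1 hq.2))
      (fun z hz => hd z ⟨hp.1.trans_lt hz.1, hz.2.trans_le hq.2⟩)
    refine ⟨z, hz, ?_⟩
    rw [he, div_mul_cancel₀ _ (sub_pos.2 hpq).ne']
  rcases lt_trichotomy x y with h | h | h
  · obtain ⟨z, hz, he⟩ := key x y hx hy h
    rw [abs_of_pos (sub_pos.2 h)] at hyd
    have hz2 := hb z ⟨hx.1.trans_lt hz.1, hz.2.trans_le hy.2⟩ (by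
      rw [abs_of_pos (sub_pos.2 hz.1)]; linarith [hz.2])
    rw [he, abs_mul, abs_of_pos (sub_pos.2 h)]
    exact mul_le_mul hz2 hyd (sub_pos.2 h).le hC
  · subst h
    simp only [sub_self, abs_zero] at hyd ⊢
    positivity
  · obtain ⟨z, hz, he⟩ := key y x hy hx h
    rw [abs_sub_comm, abs_of_pos (sub_pos.2 h)] at hyd
    have hz2 := hb z ⟨hy.1.trans_lt hz.1, hz.2.trans_le hx.2⟩ (by
      rw [abs_sub_comm, abs_of_pos (sub_pos.2 hz.2)]; linarith [hz.1])
    rw [abs_sub_comm, he, abs_mul, abs_of_pos (sub_pos.2 h)]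
    exact mul_le_mul hz2 hyd (sub_pos.2 h).le hC

/-- First order Taylor expansion with a bound on the oscillation of the derivative. -/
theorem abs_sub_taylor_one_le {y : ℝ} (hc : ContinuousOn f (Icc a b))
    (hd : ∀ z ∈ Ioo a b, HasDerivAt f (f₁ z) z) (hx : x ∈ Icc a b) (hy : y ∈ Icc a b)
    (hyd : |y - x| ≤ d) (hη : 0 ≤ η)
    (hb : ∀ z ∈ Ioo a b, |z - x| ≤ d → |f₁ z - f₁ x| ≤ η) :
    |f y - (f x + f₁ x * (y - x))| ≤ η * d := by
  have h := abs_sub_le_of_hasDerivAt (f := fun z => f z - f₁ x * (z - x))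
    (f₁ := fun z => f₁ z - f₁ x * 1)
    (hc.sub (by fun_prop)) (fun z hz => (hd z hz).sub
      (((hasDerivAt_id z).sub_const x).const_mul (f₁ x))) hx hy hyd hη
    (by simpa using hb)
  have e : f y - (f x + f₁ x * (y - x)) = f y - f₁ x * (y - x) - (f x - f₁ x * (x - x)) := by ring
  rw [e]
  exact h

theorem abs_sub_taylor_two_le {y : ℝ} (hc : ContinuousOn f (Icc a b))
    (hc₁ : ContinuousOn f₁ (Icc a b))
    (hd : ∀ z ∈ Ioo a b, HasDerivAt f (f₁ z) z) (hd₁ : ∀ z ∈ Ioo a b, HasDerivAt f₁ (f₂ z) z)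
    (hx : x ∈ Icc a b) (hy : y ∈ Icc a b)
    (hyd : |y - x| ≤ d) (hη : 0 ≤ η)
    (hb : ∀ z ∈ Ioo a b, |z - x| ≤ d → |f₂ z - f₂ x| ≤ η) :
    |f y - (f x + f₁ x * (y - x) + f₂ x / 2 * (y - x) ^ 2)| ≤ η * d ^ 2 := by
  have hd0 : 0 ≤ d := (abs_nonneg _).trans hyd
  have h := abs_sub_le_of_hasDerivAt
    (f := fun z => f z - (f₁ x * (z - x) + f₂ x / 2 * (z - x) ^ 2))
    (f₁ := fun z => f₁ z - (f₁ x + f₂ x * (z - x)))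
    (hc.sub (by fun_prop)) (fun z hz => (hd z hz).sub (by
      have := (((hasDerivAt_id z).sub_const x).const_mul (f₁ x)).add
        ((((hasDerivAt_id z).sub_const x).pow 2).const_mul (f₂ x / 2))
      convert! this using 1
      simp only [id, Nat.cast_ofNat]
      ring)) hx hy hyd (mul_nonneg hη hd0)
    (fun z hz hzd =>
      abs_sub_taylor_one_le hc₁ hd₁ hx (Ioo_subset_Icc_self hz) hzd hη hb)
  have e : f y - (f x + f₁ x * (y - x) + f₂ x / 2 * (y - x) ^ 2)
      = f y - (f₁ x * (y - x) + f₂ x / 2 * (y - x) ^ 2)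
        - (f x - (f₁ x * (x - x) + f₂ x / 2 * (x - x) ^ 2)) := by ring
  rw [e]
  refine h.trans (le_of_eq (by ring))

theorem abs_sub_taylor_three_le {y : ℝ} (hc : ContinuousOn f (Icc a b))
    (hc₁ : ContinuousOn f₁ (Icc a b)) (hc₂ : ContinuousOn f₂ (Icc a b))
    (hd : ∀ z ∈ Ioo a b, HasDerivAt f (f₁ z) z) (hd₁ : ∀ z ∈ Ioo a b, HasDerivAt f₁ (f₂ z) z)
    (hd₂ : ∀ z ∈ Ioo a b, HasDerivAt f₂ (f₃ z) z)
    (hx : x ∈ Icc a b) (hy : y ∈ Icc a b)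
    (hyd : |y - x| ≤ d) (hη : 0 ≤ η)
    (hb : ∀ z ∈ Ioo a b, |z - x| ≤ d → |f₃ z - f₃ x| ≤ η) :
    |f y - (f x + f₁ x * (y - x) + f₂ x / 2 * (y - x) ^ 2 + f₃ x / 6 * (y - x) ^ 3)|
      ≤ η * d ^ 3 := by
  have hd0 : 0 ≤ d := (abs_nonneg _).trans hyd
  have h := abs_sub_le_of_hasDerivAt
    (f := fun z => f z - (f₁ x * (z - x) + f₂ x / 2 * (z - x) ^ 2 + f₃ x / 6 * (z - x) ^ 3))
    (f₁ := fun z => f₁ z - (f₁ x + f₂ x * (z - x) + f₃ x / 2 * (z - x) ^ 2))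
    (hc.sub (by fun_prop)) (fun z hz => (hd z hz).sub (by
      have := ((((hasDerivAt_id z).sub_const x).const_mul (f₁ x)).add
        ((((hasDerivAt_id z).sub_const x).pow 2).const_mul (f₂ x / 2))).add
        ((((hasDerivAt_id z).sub_const x).pow 3).const_mul (f₃ x / 6))
      convert! this using 1
      simp only [id, Nat.cast_ofNat]
      ring)) hx hy hyd (mul_nonneg hη (pow_nonneg hd0 2))
    (fun z hz hzd =>
      abs_sub_taylor_two_le hc₁ hc₂ hd₁ hd₂ hx (Ioo_subset_Icc_self hz) hzd hη hb)
  have e : f y - (f x + f₁ x * (y - x) + f₂ x / 2 * (y - x) ^ 2 + f₃ x / 6 * (y - x) ^ 3)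
      = f y - (f₁ x * (y - x) + f₂ x / 2 * (y - x) ^ 2 + f₃ x / 6 * (y - x) ^ 3)
        - (f x - (f₁ x * (x - x) + f₂ x / 2 * (x - x) ^ 2 + f₃ x / 6 * (x - x) ^ 3)) := by ring
  rw [e]
  refine h.trans (le_of_eq (by ring))

end taylor

/-- The remainder in the difference quotient of the flux, in terms of the Taylor coefficients:
`m, m₁, m₂` belong to `μ`, `p₁, p₂, p₃` to `v`, while `dp, dm` and `ep, em` are the Taylor
remainders of `μ` at `± h / 2` and of `v` at `± h`. -/
theorem abs_flux_remainder_le {h ℓ η P A μ₁ m m₁ m₂ p₁ p₂ p₃ v dp dm ep em : ℝ} (hh : 0 < h)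
    (hℓ : h ≤ ℓ) (hA : 0 ≤ A) (hP : 0 ≤ P)
    (hm₁ : |m₁| ≤ A) (hm₂ : |m₂| ≤ A) (hp₁ : |p₁| ≤ P) (hp₂ : |p₂| ≤ P) (hp₃ : |p₃| ≤ P)
    (hdp : |dp| ≤ A * h ^ 3) (hdm : |dm| ≤ A * h ^ 3)
    (hep : |ep| ≤ η * h ^ 3) (hem : |em| ≤ η * h ^ 3) {μp μm vp vm : ℝ}
    (hμp : μp = m + m₁ * (h / 2) + m₂ / 2 * (h / 2) ^ 2 + dp)
    (hμm : μm = m + m₁ * (-(h / 2)) + m₂ / 2 * (-(h / 2)) ^ 2 + dm)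
    (hvp : vp = v + p₁ * h + p₂ / 2 * h ^ 2 + p₃ / 6 * h ^ 3 + ep)
    (hvm : vm = v + p₁ * (-h) + p₂ / 2 * (-h) ^ 2 + p₃ / 6 * (-h) ^ 3 + em)
    (hμp1 : |μp| ≤ μ₁) (hμm1 : |μm| ≤ μ₁) :
    |(μp * ((vp - v) / h) - μm * ((v - vm) / h)) / h - (m₁ * p₁ + m * p₂)|
      ≤ 4 * A * (1 + ℓ) ^ 2 * P * h ^ 2 + 2 * μ₁ * η * h := by
  have e : (μp * ((vp - v) / h) - μm * ((v - vm) / h)) / h - (m₁ * p₁ + m * p₂)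
      = m₁ * p₃ * h ^ 2 / 6 + (dp - dm) / h * p₁ + (dp - dm) / h * p₃ * h ^ 2 / 6
        + m₂ * p₂ * h ^ 2 / 8 + (dp + dm) * p₂ / 2 + (μp * ep + μm * em) / h ^ 2 := by
    have e1 : (vp - v) / h = p₁ + p₂ / 2 * h + p₃ / 6 * h ^ 2 + ep / h := by
      rw [hvp]; field_simp; ring
    have e2 : (v - vm) / h = p₁ - p₂ / 2 * h + p₃ / 6 * h ^ 2 - em / h := by
      rw [hvm]; field_simp; ring
    have e3 : (μp * ep + μm * em) / h ^ 2 = (μp * (ep / h) + μm * (em / h)) / h := by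
      field_simp
    rw [e1, e2, e3]
    have e4 : (μp * (p₁ + p₂ / 2 * h + p₃ / 6 * h ^ 2 + ep / h)
        - μm * (p₁ - p₂ / 2 * h + p₃ / 6 * h ^ 2 - em / h)) / h
        = (μp - μm) / h * (p₁ + p₃ / 6 * h ^ 2) + (μp + μm) * (p₂ / 2)
          + (μp * (ep / h) + μm * (em / h)) / h := by
      field_simp; ring
    have e5 : (μp - μm) / h = m₁ + (dp - dm) / h := by
      rw [hμp, hμm]; field_simp; ring
    have e6 : μp + μm = 2 * m + m₂ * h ^ 2 / 4 + (dp + dm) := by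
      rw [hμp, hμm]; ring
    rw [e4, e5, e6]
    ring
  have hdd : |(dp - dm) / h| ≤ 2 * A * h ^ 2 := by
    rw [abs_div, abs_of_pos hh, div_le_iff₀ hh]
    have := abs_sub dp dm
    calc |dp - dm| ≤ |dp| + |dm| := this
      _ ≤ 2 * A * h ^ 2 * h := by linarith [hdp, hdm, (by ring : h ^ 3 = h ^ 2 * h)]
  have hds : |dp + dm| ≤ 2 * A * h ^ 3 := (abs_add_le _ _).trans (by linarith)
  have hμ₁ : 0 ≤ μ₁ := (abs_nonneg _).trans hμp1
  have b1 : |m₁ * p₃ * h ^ 2 / 6| ≤ A * P * h ^ 2 / 6 := by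
    rw [abs_div, abs_mul, abs_mul, abs_of_pos (by positivity : 0 < h ^ 2),
      abs_of_pos (by norm_num : (0 : ℝ) < 6)]
    gcongr
  have b2 : |(dp - dm) / h * p₁| ≤ 2 * A * h ^ 2 * P := by
    rw [abs_mul]; gcongr
  have b3 : |(dp - dm) / h * p₃ * h ^ 2 / 6| ≤ 2 * A * h ^ 2 * P * h ^ 2 / 6 := by
    rw [abs_div, abs_mul, abs_mul, abs_of_pos (by positivity : 0 < h ^ 2),
      abs_of_pos (by norm_num : (0 : ℝ) < 6)]
    gcongr
  have b4 : |m₂ * p₂ * h ^ 2 / 8| ≤ A * P * h ^ 2 / 8 := by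
    rw [abs_div, abs_mul, abs_mul, abs_of_pos (by positivity : 0 < h ^ 2),
      abs_of_pos (by norm_num : (0 : ℝ) < 8)]
    gcongr
  have b5 : |(dp + dm) * p₂ / 2| ≤ 2 * A * h ^ 3 * P / 2 := by
    rw [abs_div, abs_mul, abs_of_pos (by norm_num : (0 : ℝ) < 2)]
    gcongr
  have b6 : |(μp * ep + μm * em) / h ^ 2| ≤ 2 * μ₁ * η * h := by
    rw [abs_div, abs_of_pos (by positivity : 0 < h ^ 2), div_le_iff₀ (by positivity)]
    refine (abs_add_le _ _).trans ?_
    rw [abs_mul, abs_mul]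
    have c1 := mul_le_mul hμp1 hep (abs_nonneg _) hμ₁
    have c2 := mul_le_mul hμm1 hem (abs_nonneg _) hμ₁
    linarith [(by ring : 2 * μ₁ * η * h * h ^ 2 = 2 * (μ₁ * (η * h ^ 3)))]
  rw [e]
  have hAP : 0 ≤ A * P * h ^ 2 := by positivity
  have g1 : A * P * h ^ 2 * h ≤ A * P * h ^ 2 * ℓ := mul_le_mul_of_nonneg_left hℓ hAP
  have g2 : A * P * h ^ 2 * h ^ 2 ≤ A * P * h ^ 2 * ℓ ^ 2 :=
    mul_le_mul_of_nonneg_left (pow_le_pow_left₀ hh.le hℓ 2) hAP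
  have hℓ0 : 0 < ℓ := hh.trans_le hℓ
  have g3 : 0 ≤ A * P * h ^ 2 * ℓ := by positivity
  have g4 : 0 ≤ A * P * h ^ 2 * ℓ ^ 2 := by positivity
  refine (abs_add_le _ _).trans (add_le_add ?_ b6)
  refine (abs_add_le _ _).trans ?_
  refine (add_le_add_left (abs_add_le _ _) _).trans ?_
  refine (add_le_add_left (add_le_add_left (abs_add_le _ _) _) _).trans ?_
  refine (add_le_add_left (add_le_add_left (add_le_add_left (abs_add_le _ _) _) _) _).trans ?_
  have e7 : 4 * A * (1 + ℓ) ^ 2 * P * h ^ 2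
      = 4 * (A * P * h ^ 2) + 8 * (A * P * h ^ 2 * ℓ) + 4 * (A * P * h ^ 2 * ℓ ^ 2) := by ring
  rw [e7]
  linarith

/-- `m₁` and `m₂` are the first two derivatives of the coefficient `μ`, which is bounded by `μ₁`;
the constant `A` bounds them and the Lipschitz constant of `m₂`. -/
structure CoefficientBound (xl xr μ₁ A : ℝ) (μ m₁ m₂ : ℝ → ℝ) : Prop where
  abs_le : ∀ x ∈ Icc xl xr, |μ x| ≤ μ₁
  continuousOn : ContinuousOn μ (Icc xl xr)
  continuousOn₁ : ContinuousOn m₁ (Icc xl xr)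
  hasDerivAt : ∀ x ∈ Ioo xl xr, HasDerivAt μ (m₁ x) x
  hasDerivAt₁ : ∀ x ∈ Ioo xl xr, HasDerivAt m₁ (m₂ x) x
  nonneg : 0 ≤ A
  abs_le₁ : ∀ x ∈ Icc xl xr, |m₁ x| ≤ A
  abs_le₂ : ∀ x ∈ Icc xl xr, |m₂ x| ≤ A
  lipschitz : ∀ x ∈ Icc xl xr, ∀ y ∈ Icc xl xr, |m₂ y - m₂ x| ≤ A * |y - x|

theorem exists_coefficientBound {xl xr μ₁ : ℝ} {μ : ℝ → ℝ} (hx : xl < xr)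
    (hμ : ContDiffOn ℝ 3 μ (Icc xl xr)) (hb : ∀ x ∈ Icc xl xr, |μ x| ≤ μ₁) :
    ∃ A m₁ m₂, CoefficientBound xl xr μ₁ A μ m₁ m₂ := by
  set S := Icc xl xr with hS
  have hu : UniqueDiffOn ℝ S := uniqueDiffOn_Icc hx
  set m₁ := derivWithin μ S
  set m₂ := derivWithin m₁ S
  set m₃ := derivWithin m₂ S
  have h1 : ContDiffOn ℝ 2 m₁ S := hμ.derivWithin hu (by norm_num)
  have h2 : ContDiffOn ℝ 1 m₂ S := h1.derivWithin hu (by norm_num)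
  have h3 : ContDiffOn ℝ 0 m₃ S := h2.derivWithin hu (by norm_num)
  have hnhds : ∀ x ∈ Ioo xl xr, S ∈ nhds x := fun x hx => Icc_mem_nhds hx.1 hx.2
  obtain ⟨A₁, hA₁⟩ := isCompact_Icc.exists_bound_of_continuousOn h1.continuousOn
  obtain ⟨A₂, hA₂⟩ := isCompact_Icc.exists_bound_of_continuousOn h2.continuousOn
  obtain ⟨A₃, hA₃⟩ := isCompact_Icc.exists_bound_of_continuousOn h3.continuousOn
  have hl : xl ∈ S := left_mem_Icc.2 hx.le
  have hA₁0 := (norm_nonneg _).trans (hA₁ xl hl)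
  have hA₂0 := (norm_nonneg _).trans (hA₂ xl hl)
  have hA₃0 := (norm_nonneg _).trans (hA₃ xl hl)
  refine ⟨A₁ + A₂ + A₃, m₁, m₂, hb, hμ.continuousOn, h1.continuousOn, fun x hx' => ?_,
    fun x hx' => ?_, by positivity, fun x hx' => ?_, fun x hx' => ?_, fun x hx' y hy' => ?_⟩
  · exact ((hμ.differentiableOn (by norm_num)) x
      (Ioo_subset_Icc_self hx')).hasDerivWithinAt.hasDerivAt (hnhds x hx')
  · exact ((h1.differentiableOn (by norm_num)) x
      (Ioo_subset_Icc_self hx')).hasDerivWithinAt.hasDerivAt (hnhds x hx')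
  · have := hA₁ x hx'
    rw [Real.norm_eq_abs] at this
    linarith
  · have := hA₂ x hx'
    rw [Real.norm_eq_abs] at this
    linarith
  · have h := abs_sub_le_of_hasDerivAt (f₁ := m₃) (d := |y - x|) (C := A₃) h2.continuousOn
      (fun z hz => ((h2.differentiableOn (by norm_num)) z
        (Ioo_subset_Icc_self hz)).hasDerivWithinAt.hasDerivAt (hnhds z hz)) hx' hy' le_rfl hA₃0
      (fun z hz _ => hA₃ z (Ioo_subset_Icc_self hz))
    have := abs_nonneg (y - x)
    nlinarith

/-- The constant in the consistency estimate of the difference operator. -/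
def spatialConst (xl xr μ₁ A : ℝ) : ℝ :=
  2 * (4 * A * (1 + (xr - xl)) ^ 2 * supConst xl xr) ^ 2 * (xr - xl) + 32 * μ₁ ^ 2

theorem spatialConst_nonneg {xl xr μ₁ A : ℝ} (hx : xl < xr) : 0 ≤ spatialConst xl xr μ₁ A := by
  have : 0 < xr - xl := sub_pos.2 hx
  unfold spatialConst
  positivity

/-- Second order consistency, in the discrete `L²` norm, for `H⁴` functions. The third derivative is
only known to oscillate by `η i = ∫ |v⁗|` around `x_i`; pointwise this costs half an order, which
Cauchy–Schwarz recovers in the sum over the grid. -/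
theorem gridInner_consistency_le {xl xr μ₁ A K : ℝ} {μ m₁ m₂ : ℝ → ℝ} {M : ℕ} (hx : xl < xr)
    (hM : 1 ≤ M) (hμ : CoefficientBound xl xr μ₁ A μ m₁ m₂) {V : SobolevH xl xr 4} {v : ℝ → ℝ}
    (hV : Represents V v) (hK : ‖V‖ ≤ K) {R : ℕ → ℝ}
    (hR : ∀ i, 0 < i → i < M → R i =
      discreteOp xl xr μ M (fun i => v (gridPoint xl xr M i)) i
        - ellipticOp μ v (gridPoint xl xr M i)) :
    gridInner xl xr M R R ≤ spatialConst xl xr μ₁ A * K ^ 2 * meshWidth xl xr M ^ 4 := by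
  obtain ⟨v₁, v₂, v₃, d0, d1, d2, c1, c2, hprim, s1, s2, s3⟩ := hV.exists_derivs hx
  have hh := meshWidth_pos hx hM
  have hx0 : 0 < xr - xl := sub_pos.2 hx
  have hK0 : 0 ≤ K := (norm_nonneg V).trans hK
  set h := meshWidth xl xr M with hhdef
  set W := SobolevH.weakDeriv 4 V
  set P := supConst xl xr * K with hPdef
  have hsup := supConst_nonneg hx.le
  have hP0 : 0 ≤ P := by positivity
  have hPle : supConst xl xr * ‖V‖ ≤ P := mul_le_mul_of_nonneg_left hK hsup
  have hW : ‖W‖ ≤ K := (SobolevH.norm_weakDeriv_le V _).trans hK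
  set B := 4 * A * (1 + (xr - xl)) ^ 2 * P with hB
  have hA0 := hμ.nonneg
  set η : ℕ → ℝ := fun i =>
    ∫ s in (gridPoint xl xr M (i - 1))..(gridPoint xl xr M (i + 1)), |W s| with hηdef
  have hpt : ∀ i, 0 < i → i < M → |R i| ≤ B * h ^ 2 + 2 * μ₁ * η i * h := by
    intro i hi hiM
    have ei : gridPoint xl xr M (i - 1) = gridPoint xl xr M i - h := by
      have := gridPoint_succ (xl := xl) (xr := xr) (M := M) (i - 1)
      rw [Nat.sub_add_cancel hi] at this
      linarith
    have ei' : gridPoint xl xr M (i + 1) = gridPoint xl xr M i + h := gridPoint_succ i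
    have hxm := gridPoint_mem_Icc hx hM (i := i - 1) (by omega)
    have hxp := gridPoint_mem_Icc hx hM (i := i + 1) (by omega)
    have hxi := gridPoint_mem_Ioo hx hM hi hiM
    have hη0 : 0 ≤ η i := by
      apply intervalIntegral.integral_nonneg
      · rw [ei, ei']; linarith
      · exact fun _ _ => abs_nonneg _
    have hosc : ∀ z ∈ Ioo xl xr, |z - gridPoint xl xr M i| ≤ h →
        |v₃ z - v₃ (gridPoint xl xr M i)| ≤ η i := by
      intro z hz hzh
      rw [hprim _ (Ioo_subset_Icc_self hxi) z (Ioo_subset_Icc_self hz)]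
      rw [abs_le] at hzh
      have hi1 : IntervalIntegrable (fun s => |W s|) volume (gridPoint xl xr M (i - 1))
          (gridPoint xl xr M (i + 1)) := (W.intervalIntegrable hxm hxp).abs
      have hle : gridPoint xl xr M (i - 1) ≤ gridPoint xl xr M (i + 1) := by
        rw [ei, ei']; linarith
      rw [← Real.norm_eq_abs]
      refine intervalIntegral.norm_integral_le_integral_norm_uIoc.trans ?_
      rw [hηdef]
      simp only
      rw [intervalIntegral.integral_of_le hle]
      rw [intervalIntegrable_iff_integrableOn_Ioc_of_le hle] at hi1
      apply setIntegral_mono_set hi1 (Filter.Eventually.of_forall fun _ => abs_nonneg _)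
      have hsub : uIoc (gridPoint xl xr M i) z
          ⊆ Ioc (gridPoint xl xr M (i - 1)) (gridPoint xl xr M (i + 1)) := by
        rw [ei, ei', uIoc]
        apply Ioc_subset_Ioc
        · exact le_min (by linarith) (by linarith)
        · exact max_le (by linarith) (by linarith)
      exact hsub.eventuallyLE
    set x := gridPoint xl xr M i
    rw [ei] at hxm
    rw [ei'] at hxp
    have hxI := Ioo_subset_Icc_self hxi
    have hhl : h ≤ xr - xl := by linarith [hxm.1, hxp.2]
    -- Taylor expansions of `v` and of `μ`
    have tp := abs_sub_taylor_three_le (y := x + h) (d := h) hV.1 c1 c2 d0 d1 d2 hxI hxp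
      (by rw [add_sub_cancel_left, abs_of_pos hh]) hη0 hosc
    have tm := abs_sub_taylor_three_le (y := x - h) (d := h) hV.1 c1 c2 d0 d1 d2 hxI hxm
      (by rw [sub_sub_cancel_left, abs_neg, abs_of_pos hh]) hη0 hosc
    have hμlip : ∀ z ∈ Ioo xl xr, |z - x| ≤ h → |m₂ z - m₂ x| ≤ A * h := fun z hz hzh =>
      (hμ.lipschitz x hxI z (Ioo_subset_Icc_self hz)).trans (mul_le_mul_of_nonneg_left hzh hA0)
    have hxp2 : x + h / 2 ∈ Icc xl xr := ⟨by linarith [hxI.1], by linarith [hxp.2]⟩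
    have hxm2 : x - h / 2 ∈ Icc xl xr := ⟨by linarith [hxm.1], by linarith [hxI.2]⟩
    have up := abs_sub_taylor_two_le (y := x + h / 2) (d := h) hμ.continuousOn hμ.continuousOn₁
      hμ.hasDerivAt hμ.hasDerivAt₁ hxI hxp2
      (by rw [add_sub_cancel_left, abs_of_pos (by positivity)]; linarith) (by positivity) hμlip
    have um := abs_sub_taylor_two_le (y := x - h / 2) (d := h) hμ.continuousOn hμ.continuousOn₁
      hμ.hasDerivAt hμ.hasDerivAt₁ hxI hxm2
      (by rw [sub_sub_cancel_left, abs_neg, abs_of_pos (by positivity)]; linarith)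
      (by positivity) hμlip
    rw [add_sub_cancel_left] at tp up
    rw [sub_sub_cancel_left] at tm um
    have hell : ellipticOp μ v x = -(m₁ x * v₁ x + μ x * v₂ x) := by
      unfold ellipticOp
      have hd : HasDerivAt (fun y => μ y * deriv v y) (m₁ x * v₁ x + μ x * v₂ x) x := by
        have := (hμ.hasDerivAt x hxi).mul (d1 x hxi)
        apply this.congr_of_eventuallyEq
        filter_upwards [isOpen_Ioo.mem_nhds hxi] with y hy
        rw [(d0 y hy).deriv]
        rfl
      rw [hd.deriv]
    have hdis : discreteOp xl xr μ M (fun i => v (gridPoint xl xr M i)) i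
        = -((μ (x + h / 2) * ((v (x + h) - v x) / h) - μ (x - h / 2) * ((v x - v (x - h)) / h))
          / h) := by
      simp only [discreteOp]
      rw [ei, ei']
    have hmain := abs_flux_remainder_le (h := h) (ℓ := xr - xl) (η := η i) (P := P) (A := A)
      (μ₁ := μ₁) (m := μ x) (m₁ := m₁ x) (m₂ := m₂ x) (p₁ := v₁ x) (p₂ := v₂ x) (p₃ := v₃ x)
      (v := v x) hh hhl hA0 hP0 (hμ.abs_le₁ x hxI) (hμ.abs_le₂ x hxI) ((s1 x hxI).trans hPle)
      ((s2 x hxI).trans hPle) ((s3 x hxI).trans hPle)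
      (up.trans (le_of_eq (by ring))) (um.trans (le_of_eq (by ring))) tp tm
      (add_sub_cancel _ _).symm (add_sub_cancel _ _).symm (add_sub_cancel _ _).symm
      (add_sub_cancel _ _).symm
      (hμ.abs_le _ hxp2) (hμ.abs_le _ hxm2)
    rw [hR i hi hiM, hell, hdis, neg_sub_neg, abs_sub_comm]
    exact hmain
  have hμ₁0 : 0 ≤ μ₁ := (abs_nonneg _).trans (hμ.abs_le xl (left_mem_Icc.2 hx.le))
  have hη2 : ∀ i, 0 < i → i < M → η i ^ 2 ≤ 2 * h *
      ((∫ s in (gridPoint xl xr M (i - 1))..(gridPoint xl xr M (i - 1 + 1)), W s ^ 2)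
        + ∫ s in (gridPoint xl xr M i)..(gridPoint xl xr M (i + 1)), W s ^ 2) := by
    intro i hi hiM
    have ei : gridPoint xl xr M i = gridPoint xl xr M (i - 1) + h := by
      have := gridPoint_succ (xl := xl) (xr := xr) (M := M) (i - 1)
      rwa [Nat.sub_add_cancel hi] at this
    have ei' : gridPoint xl xr M (i + 1) = gridPoint xl xr M i + h := gridPoint_succ i
    have hxm := gridPoint_mem_Icc hx hM (i := i - 1) (by omega)
    have hxi := gridPoint_mem_Icc hx hM (i := i) (by omega)
    have hxp := gridPoint_mem_Icc hx hM (i := i + 1) (by omega)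
    rw [Nat.sub_add_cancel hi, intervalIntegral.integral_add_adjacent_intervals
      (W.intervalIntegrable_sq hxm hxi) (W.intervalIntegrable_sq hxi hxp)]
    refine (W.sq_integral_abs_le hxm hxp (by linarith)).trans (le_of_eq ?_)
    rw [ei', ei]
    ring
  set J : ℕ → ℝ := fun i =>
    ∫ s in (gridPoint xl xr M i)..(gridPoint xl xr M (i + 1)), W s ^ 2 with hJ
  have hJ0 : ∀ i, 0 ≤ J i := by
    intro i
    apply intervalIntegral.integral_nonneg
    · rw [gridPoint_succ]; linarith
    · exact fun _ _ => sq_nonneg _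
  have hJsum : ∑ i ∈ Finset.range M, J i ≤ K ^ 2 := by
    rw [hJ, sum_integral_grid hx hM (fun x hx y hy => W.intervalIntegrable_sq hx hy),
      W.integral_sq hx.le]
    exact pow_le_pow_left₀ (norm_nonneg _) hW 2
  have hJ1 : ∑ i ∈ Finset.Ioo 0 M, J i ≤ K ^ 2 := by
    refine le_trans (Finset.sum_le_sum_of_subset_of_nonneg ?_ fun _ _ _ => hJ0 _) hJsum
    intro i hi
    rw [Finset.mem_Ioo] at hi
    exact Finset.mem_range.2 hi.2
  have hJ2 : ∑ i ∈ Finset.Ioo 0 M, J (i - 1) ≤ K ^ 2 := by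
    have e : ∑ i ∈ Finset.Ioo 0 M, J (i - 1) = ∑ i ∈ Finset.range (M - 1), J i := by
      apply Finset.sum_nbij' (fun i => i - 1) (fun i => i + 1)
      all_goals intro i hi
      all_goals simp only [Finset.mem_Ioo, Finset.mem_range] at hi ⊢
      all_goals omega
    rw [e]
    exact le_trans (Finset.sum_le_sum_of_subset_of_nonneg
      (Finset.range_subset_range.2 (by omega)) fun _ _ _ => hJ0 _) hJsum
  have hsq : ∀ i ∈ Finset.Ioo 0 M, R i * R i
      ≤ 2 * B ^ 2 * h ^ 4 + 16 * μ₁ ^ 2 * h ^ 3 * (J (i - 1) + J i) := by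
    intro i hi
    rw [Finset.mem_Ioo] at hi
    have h1 := hpt i hi.1 hi.2
    have h2 : 2 * μ₁ * η i * h * (2 * μ₁ * η i * h) ≤ 8 * μ₁ ^ 2 * h ^ 3 * (J (i - 1) + J i) := by
      have := mul_le_mul_of_nonneg_left (hη2 i hi.1 hi.2)
        (by positivity : 0 ≤ 4 * μ₁ ^ 2 * h ^ 2)
      linarith
    have h3 : R i * R i ≤ (B * h ^ 2 + 2 * μ₁ * η i * h) ^ 2 := by
      rw [← abs_mul_abs_self, ← sq]
      exact pow_le_pow_left₀ (abs_nonneg _) h1 2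
    linarith [sq_nonneg (B * h ^ 2 - 2 * μ₁ * η i * h)]
  have hcard : ((Finset.Ioo 0 M).card : ℝ) * h ≤ xr - xl := by
    rw [← natCast_mul_meshWidth (xl := xl) (xr := xr) hM]
    apply mul_le_mul_of_nonneg_right _ hh.le
    exact_mod_cast (by simp : (Finset.Ioo 0 M).card ≤ M)
  have hsum := Finset.sum_le_sum hsq
  rw [Finset.sum_add_distrib, Finset.sum_const, nsmul_eq_mul, ← Finset.mul_sum,
    Finset.sum_add_distrib] at hsum
  have hfin := mul_le_mul_of_nonneg_left hsum hh.le
  have q1 := mul_le_mul_of_nonneg_right hcard (by positivity : 0 ≤ 2 * B ^ 2 * h ^ 4)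
  have q2 := mul_le_mul_of_nonneg_left (add_le_add hJ2 hJ1)
    (by positivity : 0 ≤ 16 * μ₁ ^ 2 * h ^ 4)
  have e : spatialConst xl xr μ₁ A * K ^ 2 * h ^ 4
      = (xr - xl) * (2 * B ^ 2 * h ^ 4) + 16 * μ₁ ^ 2 * h ^ 4 * (K ^ 2 + K ^ 2) := by
    rw [hB, hPdef, spatialConst]; ring
  rw [e]
  unfold gridInner
  linarith

/-! ### The temporal consistency error on the grid -/

section temporal

variable {xl xr T σ α μ₁ K : ℝ} {μ : ℝ → ℝ} {M N n : ℕ} {t : ℕ → ℝ} {u : ℝ → ℝ → ℝ}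
  {U : ℝ → SobolevH xl xr 1}

theorem continuousOn_time_of_represents {m : ℕ} {U : ℝ → SobolevH xl xr (m + 1)} (hx : xl < xr)
    (hR : ∀ s ∈ Icc 0 T, Represents (U s) (fun x => u x s)) (hUc : ContinuousOn U (Icc 0 T))
    {x : ℝ} (hxI : x ∈ Icc xl xr) : ContinuousOn (fun s => u x s) (Icc 0 T) := by
  intro s hs
  have h1 : Filter.Tendsto (fun r => supConst xl xr * ‖U r - U s‖) (nhdsWithin s (Icc 0 T))
      (nhds 0) := by
    have h2 : ContinuousWithinAt (fun r => supConst xl xr * ‖U r - U s‖) (Icc 0 T) s :=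
      ((hUc s hs).sub continuousWithinAt_const).norm.const_mul _
    simpa [ContinuousWithinAt] using h2
  refine tendsto_iff_norm_sub_tendsto_zero.2 (squeeze_zero' (Filter.Eventually.of_forall
    fun _ => norm_nonneg _) ?_ h1)
  filter_upwards [self_mem_nhdsWithin] with r hr
  exact ((hR r hr).sub (hR s hs)).abs_le hx hxI

theorem eq_initial_of_const (hx : xl < xr) (hT : 0 < T)
    (hR : ∀ s ∈ Icc 0 T, Represents (U s) (fun x => u x s)) (hUc : ContinuousOn U (Icc 0 T))
    {x : ℝ} (hxI : x ∈ Icc xl xr)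
    (hc : ∀ s ∈ Ioc 0 T, ∀ r ∈ Ioc 0 T, u x s = u x r) {s : ℝ} (hs : s ∈ Icc 0 T) :
    u x s = u x 0 := by
  have h : EqOn (fun s => u x s) (fun _ => u x T) (Icc 0 T) :=
    EqOn.of_subset_closure (s := Ioc 0 T) (fun r hr => hc r hr T (right_mem_Ioc.2 hT))
      (continuousOn_time_of_represents hx hR hUc hxI) continuousOn_const Ioc_subset_Icc_self
      (closure_Ioc hT.ne).ge
  exact (h hs).trans (h (left_mem_Icc.2 hT.le)).symm

/-- The error of the L1 formula for the scalar function `l ∘ U`. -/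
def functionalDefect (α T : ℝ) (t : ℕ → ℝ) (n : ℕ) (U : ℝ → SobolevH xl xr 1)
    (l : SobolevH xl xr 1 →L[ℝ] ℝ) : ℝ :=
  (∫ s in (0 : ℝ)..t n, omegaKernel (1 - α) (t n - s) * l (derivWithin U (Ioc 0 T) s))
    - l1Caputo α t (fun k => l (U (t k))) n

theorem functionalDefect_sum {s : Finset ℕ} {c : ℕ → ℝ} {l : ℕ → SobolevH xl xr 1 →L[ℝ] ℝ}
    (hi : ∀ l : SobolevH xl xr 1 →L[ℝ] ℝ, IntervalIntegrable
      (fun s => omegaKernel (1 - α) (t n - s) * l (derivWithin U (Ioc 0 T) s)) volume 0 (t n)) :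
    functionalDefect α T t n U (∑ i ∈ s, c i • l i)
      = ∑ i ∈ s, c i * functionalDefect α T t n U (l i) := by
  have e1 : (∫ r in (0 : ℝ)..t n, omegaKernel (1 - α) (t n - r) *
        (∑ i ∈ s, c i • l i) (derivWithin U (Ioc 0 T) r))
      = ∑ i ∈ s, c i * ∫ r in (0 : ℝ)..t n,
        omegaKernel (1 - α) (t n - r) * l i (derivWithin U (Ioc 0 T) r) := by
    simp_rw [← intervalIntegral.integral_const_mul]
    rw [← intervalIntegral.integral_finsetSum fun i _ => (hi (l i)).const_mul (c i)]
    apply intervalIntegral.integral_congr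
    intro r _
    simp only [sum_apply, smul_apply, smul_eq_mul, Finset.mul_sum]
    exact Finset.sum_congr rfl fun i _ => by ring
  have e2 : l1Caputo α t (fun k => (∑ i ∈ s, c i • l i) (U (t k))) n
      = ∑ i ∈ s, c i * l1Caputo α t (fun k => l i (U (t k))) n := by
    simp only [l1Caputo, Finset.mul_sum]
    rw [Finset.sum_comm]
    apply Finset.sum_congr rfl
    intro k _
    simp only [sum_apply, smul_apply, smul_eq_mul]
    rw [← Finset.sum_sub_distrib, Finset.mul_sum]
    exact Finset.sum_congr rfl fun i _ => by ring
  unfold functionalDefect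
  rw [e1, e2, ← Finset.sum_sub_distrib]
  exact Finset.sum_congr rfl fun i _ => by ring

/-- If the boundary values do not depend on time, the value at a grid point is, up to a constant in
time, a linear functional of the spatial derivative. Hence the L1 error at the grid points, tested
in the energy form with a grid function `e`, is the L1 error of a single scalar function, obtained
from a functional on `H¹` of norm at most `√μ₁ |e|₁`. -/
theorem abs_gridForm_l1_defect_le (hx : xl < xr) (hM : 1 ≤ M)
    (hμ : ∀ x ∈ Icc xl xr, 0 ≤ μ x ∧ μ x ≤ μ₁) (hT : 0 < T) (hK : 0 ≤ K)
    (hR : ∀ s ∈ Icc 0 T, Represents (U s) (fun x => u x s)) (hUc : ContinuousOn U (Icc 0 T))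
    (hU : ContDiffOn ℝ 2 U (Ioc 0 T))
    (hbd : ∀ s ∈ Ioc 0 T, ‖iteratedDerivWithin 2 U (Ioc 0 T) s‖ ≤ K * (1 + s ^ (σ - 2)))
    (hl : ∀ s ∈ Ioc 0 T, ∀ r ∈ Ioc 0 T, u xl s = u xl r)
    (hr : ∀ s ∈ Ioc 0 T, ∀ r ∈ Ioc 0 T, u xr s = u xr r)
    (h0 : 0 < α) (h1 : α < 1) (hσ : 0 < σ) (hσ1 : σ ≠ 1)
    (ht : IsTimeMesh T N t) (hn1 : 1 ≤ n) (hn : n ≤ N) {w : ℕ → ℝ}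
    (hw : ∀ i, w i = caputo α (fun s => u (gridPoint xl xr M i) s) (t n)
      - l1Caputo α t (fun k => u (gridPoint xl xr M i) (t k)) n) :
    w 0 = 0 ∧ w M = 0 ∧ ∀ e : ℕ → ℝ, |gridForm xl xr μ M w e|
      ≤ √(gridForm xl xr μ M e e) * (√μ₁ * K * truncationBound α σ t n) := by
  have htn := ht.pos hn1 hn
  have htT := ht.le_last hn
  have hmem : ∀ k, k ≤ n → t k ∈ Icc 0 T := fun k hk =>
    ⟨ht.nonneg (hk.trans hn), ht.le_last (hk.trans hn)⟩
  have hWS : ∀ (l : SobolevH xl xr 1 →L[ℝ] ℝ) (C : ℝ), 0 ≤ C → (∀ V, |l V| ≤ C * ‖V‖) →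
      WeaklySingular T σ (C * K) (fun s => l (U s)) (fun s => l (derivWithin U (Ioc 0 T) s)) :=
    fun l C hC hlC => weaklySingular_of_clm hσ1 hUc hU hbd l hC hlC
  have hWS' : ∀ l : SobolevH xl xr 1 →L[ℝ] ℝ,
      WeaklySingular T σ (‖l‖ * K) (fun s => l (U s)) (fun s => l (derivWithin U (Ioc 0 T) s)) :=
    fun l => hWS l ‖l‖ (norm_nonneg l) fun V => l.le_opNorm V
  have hint := fun l => (hWS' l).intervalIntegrable_kernel_deriv h1 hσ htn htT
  let l : ℕ → SobolevH xl xr 1 →L[ℝ] ℝ := fun i =>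
    (integralCLM xl xr xl (gridPoint xl xr M i)).comp (SobolevH.weakDeriv 1)
  have hval : ∀ i, i ≤ M → ∀ s ∈ Icc 0 T, u (gridPoint xl xr M i) s = u xl 0 + l i (U s) := by
    intro i hi s hs
    have hp := gridPoint_mem_Icc hx hM hi
    have e := ((hR s hs).isPrimitive hx).sub_eq xl (left_mem_Icc.2 hx.le) _ hp
    rw [← eq_initial_of_const hx hT hR hUc (left_mem_Icc.2 hx.le) hl hs]
    simp only [l, ContinuousLinearMap.comp_apply]
    rw [integralCLM_apply _ le_rfl hp.1 hp.2, ← e]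
    ring
  have hwl : ∀ i, i ≤ M → w i = functionalDefect α T t n U (l i) := by
    intro i hi
    rw [hw, functionalDefect]
    congr 1
    · unfold caputo
      rw [intervalIntegral.integral_of_le htn.le, intervalIntegral.integral_of_le htn.le,
        integral_Ioc_eq_integral_Ioo, integral_Ioc_eq_integral_Ioo]
      apply setIntegral_congr_fun measurableSet_Ioo
      intro s hs
      have hs' : s ∈ Ioo 0 T := ⟨hs.1, hs.2.trans_le htT⟩
      have hd := ((hWS' (l i)).hasDerivAt s hs').const_add (u xl 0)
      have hd2 : HasDerivAt (fun s => u (gridPoint xl xr M i) s)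
          (l i (derivWithin U (Ioc 0 T) s)) s := by
        apply hd.congr_of_eventuallyEq
        filter_upwards [isOpen_Ioo.mem_nhds hs'] with r hr
        exact hval i hi r (Ioo_subset_Icc_self hr)
      simp only
      rw [hd2.deriv]
    · unfold l1Caputo
      apply Finset.sum_congr rfl
      intro k hk
      rw [Finset.mem_Icc] at hk
      beta_reduce
      rw [hval i hi _ (hmem k hk.2), hval i hi _ (hmem (k - 1) (by omega))]
      ring
  -- the values at an end point do not vary in time, so both derivatives vanish there
  have hend : ∀ x ∈ Icc xl xr, (∀ s ∈ Ioc 0 T, ∀ r ∈ Ioc 0 T, u x s = u x r) →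
      caputo α (fun s => u x s) (t n) - l1Caputo α t (fun k => u x (t k)) n = 0 := by
    intro x hxI hc
    have hc0 := fun s (hs : s ∈ Icc 0 T) => eq_initial_of_const hx hT hR hUc hxI hc hs
    have e1 : caputo α (fun s => u x s) (t n) = 0 := by
      unfold caputo
      rw [intervalIntegral.integral_of_le htn.le, integral_Ioc_eq_integral_Ioo]
      apply setIntegral_eq_zero_of_forall_eq_zero
      intro s hs
      have hs' : s ∈ Ioo 0 T := ⟨hs.1, hs.2.trans_le htT⟩
      have hd2 : HasDerivAt (fun s => u x s) 0 s := by
        apply (hasDerivAt_const s (u x 0)).congr_of_eventuallyEq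
        filter_upwards [isOpen_Ioo.mem_nhds hs'] with r hr
        exact hc0 r (Ioo_subset_Icc_self hr)
      rw [hd2.deriv, mul_zero]
    have e2 : l1Caputo α t (fun k => u x (t k)) n = 0 := by
      apply Finset.sum_eq_zero
      intro k hk
      rw [Finset.mem_Icc] at hk
      beta_reduce
      rw [hc0 _ (hmem k hk.2), hc0 _ (hmem (k - 1) (by omega)), sub_self, mul_zero]
    rw [e1, e2, sub_zero]
  refine ⟨?_, ?_, fun e => ?_⟩
  · rw [hw, gridPoint_zero]
    exact hend xl (left_mem_Icc.2 hx.le) hl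
  · rw [hw, gridPoint_last hM]
    exact hend xr (right_mem_Icc.2 hx.le) hr
  · have e1 : gridForm xl xr μ M w e
        = functionalDefect α T t n U (gridFunctional xl xr μ M e) := by
      unfold gridFunctional gridForm
      rw [functionalDefect_sum hint]
      apply Finset.sum_congr rfl
      intro i hi
      rw [Finset.mem_range] at hi
      have e2 : (integralCLM xl xr (gridPoint xl xr M i) (gridPoint xl xr M (i + 1))).comp
          (SobolevH.weakDeriv 1) = ∑ j ∈ {i, i + 1}, (if j = i then -1 else 1 : ℝ) • l j := by
        ext V
        have h1 := gridPoint_mem_Icc hx hM (i := i) (by omega)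
        have h2 := gridPoint_mem_Icc hx hM (i := i + 1) (by omega)
        have h3 := gridPoint_succ (xl := xl) (xr := xr) (M := M) i
        have h4 := meshWidth_pos hx hM
        have h5 := intervalIntegral.integral_add_adjacent_intervals
          ((SobolevH.weakDeriv 1 V).intervalIntegrable (left_mem_Icc.2 hx.le) h1)
          ((SobolevH.weakDeriv 1 V).intervalIntegrable h1 h2)
        rw [Finset.sum_pair (by omega)]
        simp only [l, add_apply, smul_apply, ContinuousLinearMap.comp_apply]
        rw [integralCLM_apply _ h1.1 (by linarith) h2.2, integralCLM_apply _ le_rfl h1.1 h1.2,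
          integralCLM_apply _ le_rfl h2.1 h2.2, ← h5]
        simp
      rw [e2, functionalDefect_sum hint, Finset.sum_pair (by omega), hwl i (by omega),
        hwl (i + 1) (by omega)]
      simp
      ring
    have hg := hWS (gridFunctional xl xr μ M e) _ (by positivity)
      (abs_gridFunctional_le hx hM hμ e)
    have h3 := hg.abs_caputo_sub_l1Caputo_le (by positivity) ht h0 h1 hσ hσ1 hn1 hn
    rw [hg.caputo_eq htn htT] at h3
    rw [e1]
    refine h3.trans (le_of_eq ?_)
    ring

end temporal

/-! ### The energy estimate -/

section energy

variable {xl xr α μ₁ κ CΩ : ℝ} {μ c : ℝ → ℝ} {M n : ℕ} {t : ℕ → ℝ}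

/-- Abel summation: increasing weights against a nonnegative sequence that ends at zero. -/
theorem sum_Icc_mul_sub_nonneg {A b : ℕ → ℝ} {n : ℕ} (hn : 1 ≤ n) (hA : 0 ≤ A 1)
    (hmono : ∀ k, 1 ≤ k → k < n → A k ≤ A (k + 1)) (hb : ∀ k, k ≤ n → 0 ≤ b k) (hbn : b n = 0) :
    0 ≤ ∑ k ∈ Finset.Icc 1 n, A k * (b (k - 1) - b k) := by
  have key : ∀ m, 1 ≤ m → m ≤ n →
      -(A m * b m) ≤ ∑ k ∈ Finset.Icc 1 m, A k * (b (k - 1) - b k) := by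
    intro m hm
    induction m, hm using Nat.le_induction with
    | base =>
      intro _
      have := mul_nonneg hA (hb 0 (by omega))
      simp only [Finset.Icc_self, Finset.sum_singleton, Nat.sub_self]
      linarith
    | succ m hm ih =>
      intro hmn
      rw [Finset.sum_Icc_succ_top (by omega), Nat.add_sub_cancel]
      have h1 := ih (by omega)
      have h2 := mul_le_mul_of_nonneg_right (hmono m hm (by omega)) (hb m (by omega))
      linarith
  have := key n hn le_rfl
  rwa [hbn, mul_zero, neg_zero] at this

theorem gridForm_sub_left (v v' w : ℕ → ℝ) :
    gridForm xl xr μ M (fun i => v i - v' i) w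
      = gridForm xl xr μ M v w - gridForm xl xr μ M v' w := by
  unfold gridForm
  rw [← Finset.sum_sub_distrib]
  exact Finset.sum_congr rfl fun i _ => by ring

theorem gridForm_sum_left {s : Finset ℕ} (a : ℕ → ℝ) (v : ℕ → ℕ → ℝ) (w : ℕ → ℝ) :
    gridForm xl xr μ M (fun i => ∑ k ∈ s, a k * v k i) w
      = ∑ k ∈ s, a k * gridForm xl xr μ M (v k) w := by
  unfold gridForm
  simp_rw [Finset.mul_sum]
  rw [Finset.sum_comm]
  apply Finset.sum_congr rfl
  intro i _
  rw [← Finset.sum_sub_distrib, Finset.sum_mul, Finset.mul_sum]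
  exact Finset.sum_congr rfl fun k _ => by ring

/-- The L1 formula inherits `2 v ∂v ≥ ∂(v²)` from the monotonicity of its kernel. -/
theorem sum_l1Kernel_gridForm_le {T : ℝ} {N : ℕ} (hx : xl < xr) (hM : 1 ≤ M)
    (hμ : ∀ x ∈ Icc xl xr, 0 ≤ μ x) (ht : IsTimeMesh T N t) (h0 : 0 < α) (h1 : α < 1)
    (hn1 : 1 ≤ n) (hn : n ≤ N) (e : ℕ → ℕ → ℝ) :
    ∑ k ∈ Finset.Icc 1 n, l1Kernel α t n k *
        (gridForm xl xr μ M (e k) (e k) - gridForm xl xr μ M (e (k - 1)) (e (k - 1)))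
      ≤ 2 * gridForm xl xr μ M (fun i => l1Caputo α t (fun k => e k i) n) (e n) := by
  have h := sum_Icc_mul_sub_nonneg (A := l1Kernel α t n) (b := fun k =>
      (gridForm xl xr μ M (e n) (e n) + gridForm xl xr μ M (e k) (e k))
        - 2 * gridForm xl xr μ M (e k) (e n)) hn1
    (ht.l1Kernel_nonneg h0 h1 hn n 1 le_rfl hn1 le_rfl)
    (fun k hk hkn => l1Kernel_mono ht h0 h1 hk hkn hn)
    (fun k _ => by
      have := gridForm_le_half hx hM hμ (e k) (e n)
      linarith) (by ring)
  have e1 : gridForm xl xr μ M (fun i => l1Caputo α t (fun k => e k i) n) (e n)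
      = ∑ k ∈ Finset.Icc 1 n, l1Kernel α t n k *
        (gridForm xl xr μ M (e k) (e n) - gridForm xl xr μ M (e (k - 1)) (e n)) := by
    unfold l1Caputo
    rw [gridForm_sum_left (v := fun k i => e k i - e (k - 1) i)]
    simp_rw [gridForm_sub_left]
  rw [e1, Finset.mul_sum]
  rw [← sub_nonneg, ← Finset.sum_sub_distrib]
  refine h.trans (le_of_eq (Finset.sum_congr rfl fun k _ => ?_))
  ring

/-- The energy inequality: the error equation `∂e + L_h e = c e - w + R` is tested with `L_h e^n`.
Young's inequality absorbs `c e` and `R` into `‖L_h e‖²`, whereas `w` is only controlled in the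
energy form. -/
theorem energy_inequality {T : ℝ} {N : ℕ} {ξ η2 : ℝ} (hx : xl < xr) (hM : 1 ≤ M)
    (hμ : ∀ x ∈ Icc xl xr, 0 ≤ μ x) (ht : IsTimeMesh T N t) (h0 : 0 < α) (h1 : α < 1)
    (hn1 : 1 ≤ n) (hn : n ≤ N) (hc : ∀ x ∈ Ioo xl xr, |c x| ≤ κ)
    (hCΩ : EmbeddingConstant xl xr μ CΩ) {e : ℕ → ℕ → ℝ} {w R : ℕ → ℝ}
    (he0 : ∀ k, e k 0 = 0) (heM : ∀ k, e k M = 0)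
    (heq : ∀ i, 0 < i → i < M → l1Caputo α t (fun k => e k i) n + discreteOp xl xr μ M (e n) i
      = c (gridPoint xl xr M i) * e n i - w i + R i)
    (hw0 : w 0 = 0) (hwM : w M = 0)
    (hw : |gridForm xl xr μ M w (e n)| ≤ √(gridForm xl xr μ M (e n) (e n)) * ξ)
    (hR : gridInner xl xr M R R ≤ η2) :
    ∑ k ∈ Finset.Icc 1 n, l1Kernel α t n k *
        (gridH1 xl xr μ M (e k) ^ 2 - gridH1 xl xr μ M (e (k - 1)) ^ 2)
      ≤ κ ^ 2 * CΩ * gridH1 xl xr μ M (e n) ^ 2 + 2 * gridH1 xl xr μ M (e n) * ξ + η2 := by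
  have hh := meshWidth_pos hx hM
  have hsq := fun k => gridH1_sq hx hM hμ (he0 k) (heM k)
  simp_rw [hsq]
  have hH1 : gridH1 xl xr μ M (e n) = √(gridForm xl xr μ M (e n) (e n)) := by
    exact (hsq n ▸ Real.sqrt_sq (Real.sqrt_nonneg _)).symm
  refine (sum_l1Kernel_gridForm_le hx hM hμ ht h0 h1 hn1 hn e).trans ?_
  set g := discreteOp xl xr μ M (e n) with hg
  have hd0 : l1Caputo α t (fun k => e k 0) n = 0 :=
    Finset.sum_eq_zero fun k _ => by simp only [he0, sub_self, mul_zero]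
  have hdM : l1Caputo α t (fun k => e k M) n = 0 :=
    Finset.sum_eq_zero fun k _ => by simp only [heM, sub_self, mul_zero]
  rw [← gridInner_discreteOp (w := e n) (v := fun i => l1Caputo α t (fun k => e k i) n) hx hM
    hd0 hdM]
  have hwg : gridInner xl xr M w g = gridForm xl xr μ M w (e n) :=
    gridInner_discreteOp hx hM hw0 hwM
  have hL2 : gridInner xl xr M (e n) (e n) ≤ CΩ * gridForm xl xr μ M (e n) (e n) := by
    rw [← gridL2_sq hx hM, ← hsq]
    exact hCΩ M hM (e n) (he0 n) (heM n)
  have hmain : 2 * gridInner xl xr M (fun i => l1Caputo α t (fun k => e k i) n) g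
      ≤ κ ^ 2 * gridInner xl xr M (e n) (e n) - 2 * gridInner xl xr M w g
        + gridInner xl xr M R R := by
    have hpt : ∀ i ∈ Finset.Ioo 0 M, 2 * (l1Caputo α t (fun k => e k i) n * g i)
        ≤ κ ^ 2 * (e n i * e n i) - 2 * (w i * g i) + R i * R i := by
      intro i hi
      rw [Finset.mem_Ioo] at hi
      have hE := heq i hi.1 hi.2
      have hcκ := hc _ (gridPoint_mem_Ioo hx hM hi.1 hi.2)
      have hc2 : c (gridPoint xl xr M i) ^ 2 ≤ κ ^ 2 := by
        rw [← sq_abs]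
        exact pow_le_pow_left₀ (abs_nonneg _) hcκ 2
      have hl : l1Caputo α t (fun k => e k i) n
          = c (gridPoint xl xr M i) * e n i - w i + R i - g i := by rw [← hE]; ring
      rw [hl]
      have h2 := mul_le_mul_of_nonneg_right hc2 (mul_self_nonneg (e n i))
      have h3 := sq_nonneg (c (gridPoint xl xr M i) * e n i - g i)
      have h4 := sq_nonneg (R i - g i)
      linarith
    have hs := mul_le_mul_of_nonneg_left (Finset.sum_le_sum hpt) hh.le
    unfold gridInner
    rw [Finset.sum_add_distrib, Finset.sum_sub_distrib, ← Finset.mul_sum, ← Finset.mul_sum,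
      ← Finset.mul_sum] at hs
    linarith
  have h5 := mul_le_mul_of_nonneg_left hL2 (sq_nonneg κ)
  have h6 := neg_abs_le (gridForm xl xr μ M w (e n))
  rw [hwg] at hmain
  rw [hH1, ← hH1, hH1]
  linarith

end energy

/-! ### Convergence -/

/-- The bound `l p_m^{(m)} ≤ 1/2` for the diagonal weight, from the step size restriction. -/
theorem IsComplementary.mul_diag_le_half {T α l : ℝ} {N m : ℕ} {t p : ℕ → ℝ}
    (ht : IsTimeMesh T N t) (h0 : 0 < α) (h1 : α < 1) (hp : IsComplementary (l1Kernel α t) m p)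
    (hm1 : 1 ≤ m) (hm : m ≤ N) (hl : 0 < l)
    (hτ : maxStep N t ≤ 1 / (2 * Real.Gamma (2 - α) * l) ^ (1 / α)) : l * p m ≤ 1 / 2 := by
  have hG : 0 < Real.Gamma (2 - α) := Real.Gamma_pos_of_pos (by linarith)
  have hs := ht.stepSize_pos hm1 hm
  have hd := hp.mul_diag_le (ht.l1Kernel_nonneg h0 h1 hm) hm1 le_rfl
  have hsτ := (ht.stepSize_le_maxStep hm1 hm).trans hτ
  have hX : 0 < 2 * Real.Gamma (2 - α) * l := by positivity
  have h2 : stepSize t m ^ α ≤ 1 / (2 * Real.Gamma (2 - α) * l) := by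
    refine (Real.rpow_le_rpow hs.le hsτ h0.le).trans (le_of_eq ?_)
    rw [Real.div_rpow zero_le_one (by positivity), Real.one_rpow, ← Real.rpow_mul hX.le,
      one_div_mul_cancel h0.ne', Real.rpow_one]
  rw [l1Kernel_self ht h1 hm1 hm, Real.rpow_neg hs.le] at hd
  have hsα : 0 < stepSize t m ^ α := Real.rpow_pos_of_pos hs α
  have h3 : p m ≤ Real.Gamma (2 - α) * stepSize t m ^ α := by
    have := mul_le_mul_of_nonneg_right hd (mul_pos hG hsα).le
    have e : p m * ((stepSize t m ^ α)⁻¹ / Real.Gamma (2 - α)) *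
        (Real.Gamma (2 - α) * stepSize t m ^ α) = p m := by field_simp
    linarith
  calc l * p m ≤ l * (Real.Gamma (2 - α) * (1 / (2 * Real.Gamma (2 - α) * l))) := by
        gcongr
        exact h3.trans (by gcongr)
    _ = 1 / 2 := by field_simp

/-- The complementary weights sum to at most `2 t_n^α`. -/
theorem IsComplementary.sum_le_rpow {T α : ℝ} {N n : ℕ} {t p : ℕ → ℝ}
    (ht : IsTimeMesh T N t) (h0 : 0 < α) (h1 : α < 1) (hp : IsComplementary (l1Kernel α t) n p)
    (hn : n ≤ N) : ∑ j ∈ Finset.Icc 1 n, p j ≤ 2 * t n ^ α := by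
  have h := hp.sum_omegaKernel_le ht h0 h1 hn h0 h1.le
  have e : ∀ s, omegaKernel (1 - α + α) s = 1 := fun s => by simp [omegaKernel]
  simp_rw [e, mul_one] at h
  refine h.trans ?_
  have hG : 1 / 2 ≤ Real.Gamma (α + 1) := by
    have h2 : Real.Gamma 2 ≤ Real.Gamma (α + 1 + 1) :=
      Real.Gamma_strictMonoOn_Ici.monotoneOn (by simp) (by simp; linarith) (by linarith)
    rw [Real.Gamma_two, Real.Gamma_add_one (by linarith)] at h2
    have h3 : 0 < Real.Gamma (α + 1) := Real.Gamma_pos_of_pos (by linarith)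
    nlinarith
  have ha : 0 ≤ t n ^ α := Real.rpow_nonneg (ht.nonneg hn) α
  unfold omegaKernel
  rw [add_sub_cancel_right, div_le_iff₀ (by linarith)]
  nlinarith

/-- Convergence of the scheme, with a constant that is explicit in `K`, `T`, `γ`, `Cγ` and the
bounds of the coefficient. -/
theorem gridH1_error_le {xl xr μ₁ A T γ Cγ K α σ κ ρ CΩ : ℝ} {μ m₁ m₂ c u0 : ℝ → ℝ}
    {f ub u : ℝ → ℝ → ℝ} {N M : ℕ} {t : ℕ → ℝ} {uh : ℕ → ℕ → ℝ} (hx : xl < xr)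
    (hμ : ∀ x ∈ Icc xl xr, 0 ≤ μ x ∧ μ x ≤ μ₁) (hA : CoefficientBound xl xr μ₁ A μ m₁ m₂)
    (hT : 0 < T) (hγ : 1 ≤ γ) (hCγ : 0 < Cγ) (h0 : 0 < α) (h1 : α < 1)
    (hσ : 0 < σ) (hσ2 : σ < 2) (hσ1 : σ ≠ 1) (hκ : 0 < κ) (hc : ∀ x ∈ Ioo xl xr, |c x| ≤ κ)
    (hρ0 : 0 < ρ) (hCΩ0 : 0 < CΩ) (hCΩ : EmbeddingConstant xl xr μ CΩ)
    (hub : ∀ x ∈ ({xl, xr} : Set ℝ), ∀ s ∈ Ioc 0 T, ∀ r ∈ Ioc 0 T, ub x s = ub x r)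
    (hu : SolvesSubdiffusion α xl xr T μ c f ub u0 u)
    (hu4 : MemCSobolev xl xr T 4 K u) (hu1 : MemCSigmaSobolev xl xr T σ 2 1 K u)
    (ht : IsTimeMesh T N t) (hρ : StepRatioBound N t ρ) (hg : GradedMesh N t γ Cγ)
    (hτ : maxStep N t ≤ 1 / (2 * Real.Gamma (2 - α) * κ ^ 2 * CΩ) ^ (1 / α))
    (hM : 1 ≤ M) (huh : SolvesL1Scheme α xl xr μ c f ub u0 N t M uh) {n : ℕ} (hn1 : 1 ≤ n)
    (hn : n ≤ N) :
    gridH1 xl xr μ M (fun i => u (gridPoint xl xr M i) (t n) - uh n i)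
      ≤ (4 * √μ₁ * |K| * consistencyConst T γ Cγ + 8 * √(spatialConst xl xr μ₁ A) * |K| + 1)
        / (σ * (1 - α)) * mittagLeffler α (2 * max 1 ρ * κ ^ 2 * CΩ * t n ^ α)
        * (maxStep N t ^ min (2 - α) (γ * σ) + t n ^ (α / 2) * meshWidth xl xr M ^ 2) := by
  obtain ⟨V, hVR, -, hVK⟩ := hu4
  obtain ⟨U, hUR, hUc, hUd, hUb⟩ := hu1
  have hK : 0 ≤ K := (norm_nonneg _).trans (hVK 0 (left_mem_Icc.2 hT.le))
  rw [abs_of_nonneg hK]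
  have hμ0 : ∀ x ∈ Icc xl xr, 0 ≤ μ x := fun x hx => (hμ x hx).1
  have htI : ∀ m, 1 ≤ m → m ≤ N → t m ∈ Ioc 0 T := fun m h2 h3 => ⟨ht.pos h2 h3, ht.le_last h3⟩
  have hcst : ∀ x ∈ ({xl, xr} : Set ℝ), ∀ s ∈ Ioc 0 T, ∀ r ∈ Ioc 0 T, u x s = u x r := by
    intro x hxb s hs r hr
    rw [hu.boundary x hxb s hs, hu.boundary x hxb r hr, hub x hxb s hs r hr]
  -- the scheme does not prescribe the boundary values at the initial level, so the error is
  -- set to zero there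
  let e : ℕ → ℕ → ℝ := fun m i =>
    if 1 ≤ m ∧ m ≤ N then u (gridPoint xl xr M i) (t m) - uh m i else 0
  have hepos : ∀ m, 1 ≤ m → m ≤ N → e m = fun i => u (gridPoint xl xr M i) (t m) - uh m i := by
    intro m hm hmN
    funext i
    simp only [e, if_pos (And.intro hm hmN)]
  have hezero : e 0 = fun _ => 0 := by
    funext i
    simp [e]
  have he0 : ∀ m, e m 0 = 0 := by
    intro m
    simp only [e]
    split_ifs with hm
    · rw [gridPoint_zero, (huh.boundary m hm.1 hm.2).1,
        hu.boundary xl (by simp) _ (htI m hm.1 hm.2), sub_self]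
    · rfl
  have heM : ∀ m, e m M = 0 := by
    intro m
    simp only [e]
    split_ifs with hm
    · rw [gridPoint_last hM, (huh.boundary m hm.1 hm.2).2,
        hu.boundary xr (by simp) _ (htI m hm.1 hm.2), sub_self]
    · rfl
  have heint : ∀ m, m ≤ N → ∀ i, 0 < i → i < M →
      e m i = u (gridPoint xl xr M i) (t m) - uh m i := by
    intro m hmN i hi0 hiM
    rcases Nat.eq_zero_or_pos m with rfl | hm
    · rw [hezero, ht.zero, huh.initial i hi0 hiM,
        hu.initial _ (gridPoint_mem_Ioo hx hM hi0 hiM), sub_self]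
    · rw [hepos m hm hmN]
  set ξ : ℕ → ℝ := fun m => √μ₁ * K * truncationBound α σ t m with hξ
  set η := √(spatialConst xl xr μ₁ A) * K * meshWidth xl xr M ^ 2 with hη
  set l := κ ^ 2 * CΩ with hl
  have hl0 : 0 < l := by positivity
  have hη2 : spatialConst xl xr μ₁ A * K ^ 2 * meshWidth xl xr M ^ 4 = η ^ 2 := by
    rw [hη, mul_pow, mul_pow, Real.sq_sqrt (spatialConst_nonneg hx)]
    ring
  have henergy : ∀ m, 1 ≤ m → m ≤ n → ∑ k ∈ Finset.Icc 1 m, l1Kernel α t m k *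
        (gridH1 xl xr μ M (e k) ^ 2 - gridH1 xl xr μ M (e (k - 1)) ^ 2)
      ≤ l * gridH1 xl xr μ M (e m) ^ 2 + 2 * gridH1 xl xr μ M (e m) * ξ m + η ^ 2 := by
    intro m hm1 hmn
    have hm := hmn.trans hn
    obtain ⟨hw0, hwM, hw⟩ := abs_gridForm_l1_defect_le (w := fun i =>
        caputo α (fun s => u (gridPoint xl xr M i) s) (t m)
          - l1Caputo α t (fun k => u (gridPoint xl xr M i) (t k)) m) hx hM hμ hT hK hUR hUc hUd
      (fun s hs => by simpa using hUb 2 (by norm_num) le_rfl s hs) (hcst xl (by simp))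
      (hcst xr (by simp)) h0 h1 hσ hσ1 ht hm1 hm (fun _ => rfl)
    have hm' : t m ∈ Icc 0 T := Ioc_subset_Icc_self (htI m hm1 hm)
    have hR := gridInner_consistency_le hx hM hA (hVR (t m) hm') (hVK (t m) hm')
      (fun i _ _ => rfl)
    rw [hη2] at hR
    refine energy_inequality hx hM hμ0 ht h0 h1 hm1 hm hc hCΩ he0 heM ?_ hw0 hwM (hw (e m)) hR
    intro i hi0 hiM
    have hxi := gridPoint_mem_Ioo hx hM hi0 hiM
    have e1 := hu.equation _ hxi _ (htI m hm1 hm)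
    have e2 := huh.equation m hm1 hm i hi0 hiM
    have e3 : l1Caputo α t (fun k => e k i) m
        = l1Caputo α t (fun k => u (gridPoint xl xr M i) (t k)) m
          - l1Caputo α t (fun k => uh k i) m := by
      unfold l1Caputo
      rw [← Finset.sum_sub_distrib]
      apply Finset.sum_congr rfl
      intro k hk
      rw [Finset.mem_Icc] at hk
      beta_reduce
      rw [heint k (by omega) i hi0 hiM, heint (k - 1) (by omega) i hi0 hiM]
      ring
    have e4 : discreteOp xl xr μ M (e m) i
        = discreteOp xl xr μ M (fun i => u (gridPoint xl xr M i) (t m)) i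
          - discreteOp xl xr μ M (uh m) i := by
      rw [hepos m hm1 hm]
      unfold discreteOp
      ring
    rw [e3, e4, heint m hm i hi0 hiM]
    linarith
  have hpex : ∀ m, ∃ p, m ≤ n → IsComplementary (l1Kernel α t) m p := by
    intro m
    by_cases hm : m ≤ n
    · obtain ⟨p, hp⟩ := ht.exists_complementary h0 h1 (hm.trans hn)
      exact ⟨p, fun _ => hp⟩
    · exact ⟨0, fun h => absurd h hm⟩
  choose p hp using hpex
  have hσα : 0 < σ * (1 - α) := mul_pos hσ (by linarith)
  have hμ1 : 0 ≤ √μ₁ * K := by positivity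
  set β := min (2 - α) (γ * σ) with hβ
  set Ξ := √μ₁ * K * (consistencyConst T γ Cγ / (σ * (1 - α)) * maxStep N t ^ β) with hΞ
  set S := 2 * (t n ^ (α / 2) * η) with hS
  have hmax := (ht.maxStep_pos).le
  have hcc : 0 < consistencyConst T γ Cγ := consistencyConst_pos T γ Cγ
  have hΞ0 : 0 ≤ Ξ := by positivity
  have htn : 0 < t n := ht.pos hn1 hn
  have hη0 : 0 ≤ η := by positivity
  have hS0 : 0 ≤ S := by positivity
  have hSsq : 4 * t n ^ α * η ^ 2 = S ^ 2 := by
    have h2 : (t n ^ (α / 2)) ^ 2 = t n ^ α := by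
      rw [← Real.rpow_natCast, ← Real.rpow_mul htn.le]
      norm_num
    rw [hS, ← h2]
    ring
  have hΛ : 0 ≤ 2 * max 1 ρ * l := by positivity
  have key := discrete_fractional_gronwall (A := l1Kernel α t) (n := n) (p := p)
    (v := fun m => gridH1 xl xr μ M (e m)) (ξ := ξ)
    (E := fun m => mittagLeffler α (2 * max 1 ρ * l * t m ^ α)) (l := l) (η := η) (S := S)
    (Ξ := Ξ) (fun m _ hm => hp m hm) (fun m _ => Real.sqrt_nonneg _)
    (by simp [hezero, gridH1, gridInner]) hl0.le hS0 hΞ0 henergy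
    (fun m h2 h3 => mul_nonneg hμ1 (truncationBound_nonneg ht h0 h1 hσ1 h2 (h3.trans hn)))
    (fun m h2 h3 => (hp m h3).mul_diag_le_half ht h0 h1 h2 (h3.trans hn) hl0
      (by rwa [hl, ← mul_assoc]))
    (fun m h2 h3 => by
      have h4 := (hp m h3).sum_truncationBound_le_rpow ht hg hγ hCγ h0 h1 hσ hσ2 hσ1 h2
        (h3.trans hn)
      have h5 := mul_le_mul_of_nonneg_left h4 hμ1
      refine le_trans (le_of_eq ?_) h5
      rw [Finset.mul_sum]
      exact Finset.sum_congr rfl fun j _ => by simp only [hξ]; ring)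
    (fun m h2 h3 => by
      have h4 := (hp m h3).sum_le_rpow ht h0 h1 (h3.trans hn)
      have h5 := Real.rpow_le_rpow (ht.nonneg (h3.trans hn)) (ht.le h3 hn) h0.le
      have h6 : 0 ≤ t n ^ α := Real.rpow_nonneg htn.le α
      rw [← hSsq]
      exact mul_le_mul_of_nonneg_right (by linarith) (sq_nonneg _))
    (fun m _ h3 => one_le_mittagLeffler h0
      (mul_nonneg hΛ (Real.rpow_nonneg (ht.nonneg (h3.trans hn)) α)))
    (fun j m _ h3 h4 => mittagLeffler_mono h0
      (mul_nonneg hΛ (Real.rpow_nonneg (ht.nonneg ((h3.trans h4).trans hn)) α))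
      (mul_le_mul_of_nonneg_left (Real.rpow_le_rpow (ht.nonneg ((h3.trans h4).trans hn))
        (ht.le h3 (h4.trans hn)) h0.le) hΛ))
    (fun m h2 h3 => (hp m h3).sum_mittagLeffler_le ht hρ hρ0 h0 h1 h2 (h3.trans hn) hl0.le)
    n hn1 le_rfl
  simp only [hepos n hn1 hn] at key
  refine key.trans ?_
  have harg : 2 * max 1 ρ * κ ^ 2 * CΩ * t n ^ α = 2 * max 1 ρ * l * t n ^ α := by
    rw [hl]; ring
  rw [harg]
  have hE1 : 1 ≤ mittagLeffler α (2 * max 1 ρ * l * t n ^ α) := one_le_mittagLeffler h0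
    (mul_nonneg hΛ (Real.rpow_nonneg htn.le α))
  set E := mittagLeffler α (2 * max 1 ρ * l * t n ^ α)
  set q := √(spatialConst xl xr μ₁ A) * K with hq
  have hq0 : 0 ≤ q := by positivity
  set a := maxStep N t ^ β
  set b := t n ^ (α / 2) * meshWidth xl xr M ^ 2 with hb
  have ha : 0 ≤ a := Real.rpow_nonneg hmax _
  have hb0 : 0 ≤ b := by positivity
  -- the spatial error needs no factor `1 / (σ (1 - α))`, which is at least `1 / 2`
  have hσα2 : σ * (1 - α) ≤ 2 := by nlinarith
  have hSb : 2 * S = 4 * (q * b) := by rw [hS, hη, hb]; ring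
  have h3 : 4 * (q * b) * (σ * (1 - α)) ≤ 8 * (q * b) := by
    have := mul_le_mul_of_nonneg_left hσα2 (mul_nonneg hq0 hb0)
    linarith
  have hfin : 4 * Ξ + 2 * S
      ≤ (4 * √μ₁ * K * consistencyConst T γ Cγ + 8 * √(spatialConst xl xr μ₁ A) * K + 1)
        / (σ * (1 - α)) * (a + b) := by
    rw [hSb, div_mul_eq_mul_div, le_div_iff₀ hσα, add_mul]
    have h4 : 4 * Ξ * (σ * (1 - α)) = 4 * √μ₁ * K * consistencyConst T γ Cγ * a := by
      have : 1 - α ≠ 0 := by linarith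
      rw [hΞ]; field_simp
    rw [h4]
    have h5 : 0 ≤ 4 * √μ₁ * K * consistencyConst T γ Cγ * b := by positivity
    have h6 : 0 ≤ q * a := mul_nonneg hq0 ha
    have h7 : 8 * √(spatialConst xl xr μ₁ A) * K = 8 * q := by rw [hq]; ring
    rw [h7]
    linarith
  calc E * (4 * Ξ + 2 * S) ≤ E * (_ / (σ * (1 - α)) * (a + b)) :=
        mul_le_mul_of_nonneg_left hfin (by linarith)
    _ = _ := by ring

end

theorem theorem3p6 (xl xr μ₀ μ₁ : ℝ) (hx : xl < xr) (hμ₀ : 0 < μ₀) (hμ₁ : μ₀ ≤ μ₁) :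
    -- an embedding constant depending only on the domain and on the bounds of `μ` exists
    (∃ CΩ : ℝ, 0 < CΩ ∧ ∀ μ : ℝ → ℝ, (∀ x ∈ Set.Icc xl xr, μ₀ ≤ μ x ∧ μ x ≤ μ₁) →
      EmbeddingConstant xl xr μ CΩ) ∧
    ∀ (μ : ℝ → ℝ) (T γ Cγ K : ℝ),
      (∀ x ∈ Set.Icc xl xr, μ₀ ≤ μ x ∧ μ x ≤ μ₁) → ContDiffOn ℝ 3 μ (Set.Icc xl xr) →
      0 < T → 1 ≤ γ → 0 < Cγ →
      -- `Cu` depends on the solution only through `K`; it is uniform in `α` and `σ`, and does not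
      -- depend on the meshes
      ∃ Cu : ℝ, 0 < Cu ∧
        ∀ (α σ κ ρ CΩ : ℝ) (c u0 : ℝ → ℝ) (f ub u : ℝ → ℝ → ℝ),
          0 < α → α < 1 → σ ∈ Set.Ioo (0 : ℝ) 1 ∪ Set.Ioo (1 : ℝ) 2 →
          0 < κ → (∀ x ∈ Set.Ioo xl xr, |c x| ≤ κ) →
          0 < ρ → 0 < CΩ → EmbeddingConstant xl xr μ CΩ →
          -- the boundary data do not depend on time
          (∀ x ∈ ({xl, xr} : Set ℝ), ∀ s ∈ Set.Ioc 0 T, ∀ t ∈ Set.Ioc 0 T, ub x s = ub x t) →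
          SolvesSubdiffusion α xl xr T μ c f ub u0 u →
          MemCSobolev xl xr T 4 K u → MemCSigmaSobolev xl xr T σ 2 1 K u →
          ∀ (N : ℕ) (t : ℕ → ℝ) (M : ℕ) (uh : ℕ → ℕ → ℝ),
            IsTimeMesh T N t → StepRatioBound N t ρ → GradedMesh N t γ Cγ →
            maxStep N t ≤ 1 / (2 * Real.Gamma (2 - α) * κ ^ 2 * CΩ) ^ (1 / α) →
            1 ≤ M → SolvesL1Scheme α xl xr μ c f ub u0 N t M uh →
            (∀ n : ℕ, 1 ≤ n → n ≤ N →
              gridH1 xl xr μ M (fun i => u (gridPoint xl xr M i) (t n) - uh n i)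
                ≤ Cu / (σ * (1 - α))
                  * mittagLeffler α (2 * max 1 ρ * κ ^ 2 * CΩ * t n ^ α)
                  * (maxStep N t ^ min (2 - α) (γ * σ)
                    + t n ^ (α / 2) * meshWidth xl xr M ^ 2)) ∧
            (max 1 ((2 - α) / σ) ≤ γ → ∀ n : ℕ, 1 ≤ n → n ≤ N →
              gridH1 xl xr μ M (fun i => u (gridPoint xl xr M i) (t n) - uh n i)
                ≤ Cu / (σ * (1 - α))
                  * mittagLeffler α (2 * max 1 ρ * κ ^ 2 * CΩ * t n ^ α)
                  * (maxStep N t ^ (2 - α) + t n ^ (α / 2) * meshWidth xl xr M ^ 2)) := by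
  constructor
  · exact ⟨(xr - xl) ^ 2 / μ₀, div_pos (pow_pos (sub_pos.2 hx) 2) hμ₀,
      fun μ hμ => embeddingConstant_of_bounds hx hμ₀ fun x hx => (hμ x hx).1⟩
  intro μ T γ Cγ K hμ hμC hT hγ hCγ
  have hμ' : ∀ x ∈ Set.Icc xl xr, 0 ≤ μ x ∧ μ x ≤ μ₁ := fun x hx =>
    ⟨hμ₀.le.trans (hμ x hx).1, (hμ x hx).2⟩
  obtain ⟨A, m₁, m₂, hA⟩ := exists_coefficientBound hx hμC fun x hx => by
    rw [abs_of_nonneg (hμ' x hx).1]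
    exact (hμ' x hx).2
  have hcc := consistencyConst_pos T γ Cγ
  refine ⟨4 * √μ₁ * |K| * consistencyConst T γ Cγ + 8 * √(spatialConst xl xr μ₁ A) * |K| + 1,
    by positivity, ?_⟩
  intro α σ κ ρ CΩ c u0 f ub u h0 h1 hσ hκ hc hρ0 hCΩ0 hCΩ hub hu hu4 hu1 N t M uh ht hρ hg hτ
    hM huh
  obtain ⟨hσ0, hσ2, hσ1⟩ : 0 < σ ∧ σ < 2 ∧ σ ≠ 1 := by
    rcases hσ with h | h
    · exact ⟨h.1, by linarith [h.2], h.2.ne⟩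
    · exact ⟨by linarith [h.1], h.2, h.1.ne'⟩
  have key := fun n (hn1 : 1 ≤ n) (hn : n ≤ N) => gridH1_error_le hx hμ' hA hT hγ hCγ h0 h1 hσ0
    hσ2 hσ1 hκ hc hρ0 hCΩ0 hCΩ hub hu hu4 hu1 ht hρ hg hτ hM huh hn1 hn
  refine ⟨key, fun hγσ n hn1 hn => ?_⟩
  have h2 : 2 - α ≤ γ * σ := (div_le_iff₀ hσ0).1 ((le_max_right _ _).trans hγσ)
  have h3 := key n hn1 hn
  rwa [min_eq_left h2] at h3
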